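/- Let $\varepsilon\in\{1,-1\}$ and let $E_5=\mathbb R^5$ carry the flat metric $\eta=\mathrm{diag}(1,1,1,-1,\varepsilon)$. Let $U\subseteq\mathbb R^4$ be a connected open set (a coordinate patch of a space-time), let $X:U\to E_5$ be a smooth immersion whose induced metric $g=X^*\eta$ is Lorentzian, with smooth unit normal $\xi$, $\eta(\xi,\xi)=\varepsilon$, and let $\Omega(V,W)=\eta(\tilde\nabla_V W,\xi)$ be its second fundamental form and $H=\varepsilon\,(\mathrm{tr}_g\Omega)\,\xi$ its mean curvature vector. Let $\{w,v,q,u\}$ be a smooth $g$-orthonormal tetrad with $u$ timelike in which $\Omega$ is diagonal, $$\Omega_{\alpha\beta}=\sigma w_\alpha w_\beta+\lambda v_\alpha v_\beta+\nu q_\alpha q_\beta-\mu u_\alpha u_\beta ,$$ with functions $\mu,\lambda,\nu,\sigma$ on $U$. Suppose that the immersion is ideal with $k=1$, $n_1=3$ and spacelike plane section $L=\mathrm{span}\{w,v,q\}$, i.e. $$\eta(H,H)=c(3)\,\bigl(R-\tau(L)\bigr),\qquad c(3)=\frac{2(4+1-3)}{4+1-1-3}=4,$$ at every point of $U$, where $\tau(L)$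 and $R$ are the sums of the sectional curvatures $K(e_\alpha\wedge e_\beta)$ over the pairs $\alpha<\beta$ of the orthonormal basis of $L$ and of the whole tangent space, respectively (so that $\sigma=\mu-\lambda-\nu$). 1. If on $U$ either $\mu=-\lambda,\ \nu=\lambda$, or $\mu=-\nu,\ \lambda=-3\nu$, or $\mu=-\lambda,\ \nu=-3\lambda$, then $\mu=\lambda=\nu=0$ on $U$ and $(U,g)$ is flat. 2. If $\mu=3\lambda$ and $\nu=\lambda$ on $U$, then either $\lambda=0$ on $U$ and $(U,g)$ is flat, or there are $k\in\{1,0,-1\}$ and a constant $c\neq0$ such that every point of $U$ has a neighbourhood with smooth coordinates $(r,\phi,\psi,t)$ (with $r>0$, $r<\pi$ if $k=1$, and $0<\phi<\pi$), in which $u=\partial_t$ and $g$ is the Robertson–Walker metric $$ds^2=a(t)^2\{dr^2+\Sigma(r,k)^2(d\phi^2+\sin^2\phi\,d\psi^2)\}-dt^2,\qquad \Sigma(r,k)=\sin r,\ r,\ \sinh r\ \text{ for }k=1,0,-1,$$ where the scale factor $a>0$ is smooth and satisfies $$(\partial_t a)^2=\varepsilon c^2a^6-k,\qquad \lambda=c\,a^2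 .$$ Moreover, for real numbers $\kappa,\rho,p$ and a tangent vector $V$ at a point of the neighbourhood, $V$ is unit timelike and the Einstein equations $R_{\alpha\beta}-\tfrac12 S g_{\alpha\beta}=\kappa\{(\rho+p)V_\alpha V_\beta+p\,g_{\alpha\beta}\}$ of a perfect fluid hold there ($R_{\alpha\beta}$ the Ricci tensor, $S$ its trace) if and only if $V=\pm u$ and $$\kappa\rho=3\varepsilon c^2a^4,\qquad \kappa p=-7\varepsilon c^2a^4 ;$$ for $\varepsilon=+1$ these are $\kappa\rho=3c^2a^4$ and $\kappa p=-7c^2a^4$. -/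

import Mathlib

open scoped ContDiff

noncomputable section

namespace IdealEmbedding

/-- Points (and tangent vectors) of a four-dimensional coordinate patch. -/
abbrev Coord : Type := Fin 4 → ℝ

/-- Points (and vectors) of the five-dimensional ambient space. -/
abbrev Ambient : Type := Fin 5 → ℝ

/-- The pseudo-Euclidean scalar product on the ambient space: signature `(4,1)` for `ε = 1`
and signature `(3,2)` for `ε = -1`. -/
def eta (ε : ℝ) (A B : Ambient) : ℝ :=
  A 0 * B 0 + A 1 * B 1 + A 2 * B 2 - A 3 * B 3 + ε * (A 4 * B 4)

/-! ### Intrinsic geometry of a metric on a coordinate patch -/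

/-- A field of symmetric bilinear forms, given by its coordinate components. -/
abbrev MetricField : Type := Coord → Matrix (Fin 4) (Fin 4) ℝ

/-- The partial derivative in the `i`-th coordinate direction. -/
def pderiv (i : Fin 4) (f : Coord → ℝ) (x : Coord) : ℝ :=
  fderiv ℝ f x (Pi.single i 1)

/-- `g_x(V, W)`. -/
def MetricField.inner (g : MetricField) (x : Coord) (V W : Coord) : ℝ :=
  ∑ i, ∑ j, g x i j * V i * W j

/-- The Christoffel symbol `Γ^l_{ij}` of the Levi-Civita connection. -/
def christoffel (g : MetricField) (l i j : Fin 4) (x : Coord) : ℝ :=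
  (1 / 2) * ∑ m, (g x)⁻¹ l m *
    (pderiv i (fun y => g y j m) x + pderiv j (fun y => g y i m) x
      - pderiv m (fun y => g y i j) x)

/-- The component `R^l_{kij}` of the Riemann tensor, with
`R(∂_i, ∂_j) ∂_k = ∇_i ∇_j ∂_k - ∇_j ∇_i ∂_k = ∑ l, R^l_{kij} ∂_l`. -/
def riemann (g : MetricField) (l k i j : Fin 4) (x : Coord) : ℝ :=
  pderiv i (christoffel g l j k) x - pderiv j (christoffel g l i k) x
    + ∑ m, (christoffel g l i m x * christoffel g m j k x
      - christoffel g l j m x * christoffel g m i k x)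

/-- The metric is flat at `x`: its Riemann tensor vanishes there. -/
def IsFlatAt (g : MetricField) (x : Coord) : Prop :=
  ∀ l k i j, riemann g l k i j x = 0

/-- The vector `R(V, W) Z`. -/
def curvatureOp (g : MetricField) (x : Coord) (V W Z : Coord) : Coord :=
  fun l => ∑ k, ∑ i, ∑ j, riemann g l k i j x * V i * W j * Z k

/-- The sectional curvature of the plane spanned by two orthonormal (non-null) vectors. -/
def sectional (g : MetricField) (x : Coord) (V W : Coord) : ℝ :=
  g.inner x V V * g.inner x W W * g.inner x (curvatureOp g x V W W) V

/-- The scalar curvature `∑_{α<β} K(e_α ∧ e_β)` of the plane section spanned by the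
orthonormal vectors `e`. If `e` is a basis of the whole tangent space, this is the scalar
curvature of the manifold in the normalization without double counting. -/
def sectionScalar (g : MetricField) (x : Coord) {r : ℕ} (e : Fin r → Coord) : ℝ :=
  ∑ α, ∑ β, if α < β then sectional g x (e α) (e β) else 0

/-- The Ricci tensor. -/
def ricci (g : MetricField) (k j : Fin 4) (x : Coord) : ℝ :=
  ∑ i, riemann g i k i j x

/-- The trace of the Ricci tensor. -/
def ricciScalar (g : MetricField) (x : Coord) : ℝ :=
  ∑ k, ∑ j, (g x)⁻¹ k j * ricci g k j x

/-- The Einstein tensor. -/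
def einstein (g : MetricField) (i j : Fin 4) (x : Coord) : ℝ :=
  ricci g i j x - (1 / 2) * ricciScalar g x * g x i j

/-- At `x` the Einstein equations `G_{ij} = κ T_{ij}` hold for a perfect fluid
`T_{ij} = (ρ + p) V_i V_j + p g_{ij}` with energy density `ρ`, pressure `p` and
unit timelike four-velocity `V`. -/
def IsPerfectFluidAt (g : MetricField) (κ ρ p : ℝ) (V : Coord) (x : Coord) : Prop :=
  g.inner x V V = -1 ∧
    ∀ i j, einstein g i j x =
      κ * ((ρ + p) * (∑ m, g x i m * V m) * (∑ m, g x j m * V m) + p * g x i j)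

/-! ### Geometry of an immersed hypersurface -/

/-- The induced metric `g_{ij} = η(∂_i X, ∂_j X)`. -/
def inducedMetric (ε : ℝ) (X : Coord → Ambient) : MetricField := fun x =>
  Matrix.of fun i j => eta ε (fderiv ℝ X x (Pi.single i 1)) (fderiv ℝ X x (Pi.single j 1))

/-- The component of the second fundamental form along the unit normal `ξ`:
`Ω(V, W) = η(D_V (dX(W)), ξ)`, where `D` is the flat connection of the ambient space. -/
def secondFF (ε : ℝ) (X ξ : Coord → Ambient) (x : Coord) (V W : Coord) : ℝ :=
  eta ε (fderiv ℝ (fun y => fderiv ℝ X y W) x V) (ξ x)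

/-- The mean curvature vector `H = ε (g^{ij} Ω_{ij}) ξ`. -/
def meanCurvature (ε : ℝ) (X ξ : Coord → Ambient) (x : Coord) : Ambient :=
  (ε * ∑ i, ∑ j, (inducedMetric ε X x)⁻¹ i j *
    secondFF ε X ξ x (Pi.single i 1) (Pi.single j 1)) • ξ x

/-- The constant `c(n₁, …, n_k) = 2 (m + k - ∑ n_j) / (m + k - 1 - ∑ n_j)`. -/
def chenConst (m : ℕ) (n : List ℕ) : ℝ :=
  2 * ((m : ℝ) + n.length - n.sum) / ((m : ℝ) + n.length - 1 - n.sum)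

/-- `X : U → E₅` is an isometric immersion of a space-time (a coordinate patch `U` with the
induced Lorentzian metric) with unit normal `ξ`, ideal for `k = 1`, `n₁ = 3`, with adapted
orthonormal tetrad `w, v, q` (spacelike), `u` (timelike).

* The second fundamental form is diagonal in the tetrad; its principal curvatures along
  `w, v, q, u` are `σ, lam, ν, μ`.
* There is equality `‖H‖² = c(3) (R - τ(L))` in the inequality between the squared mean
  curvature and the curvature invariant, attained on the spacelike `3`-plane section
  `L = span {w, v, q}`. -/
structure IsIdealTetrad (ε : ℝ) (U : Set Coord) (X ξ : Coord → Ambient)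
    (w v q u : Coord → Coord) (μ lam ν σ : Coord → ℝ) : Prop where
  smooth_X : ContDiffOn ℝ ∞ X U
  smooth_ξ : ContDiffOn ℝ ∞ ξ U
  smooth_w : ContDiffOn ℝ ∞ w U
  smooth_v : ContDiffOn ℝ ∞ v U
  smooth_q : ContDiffOn ℝ ∞ q U
  smooth_u : ContDiffOn ℝ ∞ u U
  normal : ∀ x ∈ U, ∀ V, eta ε (fderiv ℝ X x V) (ξ x) = 0
  unit_normal : ∀ x ∈ U, eta ε (ξ x) (ξ x) = ε
  orthonormal : ∀ x ∈ U, ∀ α β : Fin 4,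
    (inducedMetric ε X).inner x (![w x, v x, q x, u x] α) (![w x, v x, q x, u x] β)
      = if α = β then (![1, 1, 1, -1] : Fin 4 → ℝ) α else 0
  diagonal : ∀ x ∈ U, ∀ V W, secondFF ε X ξ x V W =
    σ x * (inducedMetric ε X).inner x (w x) V * (inducedMetric ε X).inner x (w x) W
    + lam x * (inducedMetric ε X).inner x (v x) V * (inducedMetric ε X).inner x (v x) W
    + ν x * (inducedMetric ε X).inner x (q x) V * (inducedMetric ε X).inner x (q x) W
    - μ x * (inducedMetric ε X).inner x (u x) V * (inducedMetric ε X).inner x (u x) W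
  chen_equality : ∀ x ∈ U,
    eta ε (meanCurvature ε X ξ x) (meanCurvature ε X ξ x) =
      chenConst 4 [3] *
        (sectionScalar (inducedMetric ε X) x ![w x, v x, q x, u x]
          - sectionScalar (inducedMetric ε X) x ![w x, v x, q x])

/-! ### Robertson-Walker metrics -/

/-- `Σ(r, k) = sin r, r, sinh r` for `k = 1, 0, -1`. -/
def rwSigma (k : ℤ) (r : ℝ) : ℝ :=
  if k = 1 then Real.sin r else if k = 0 then r else Real.sinh r

/-- The Robertson-Walker metric
`a(t)² (dr² + Σ(r,k)² (dφ² + sin² φ dψ²)) - dt²` in the coordinates `z = (r, φ, ψ, t)`. -/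
def rwInner (k : ℤ) (a : ℝ → ℝ) (z V W : Coord) : ℝ :=
  a (z 3) ^ 2 * (V 0 * W 0 + rwSigma k (z 0) ^ 2 *
    (V 1 * W 1 + Real.sin (z 1) ^ 2 * (V 2 * W 2))) - V 3 * W 3

/-- `Φ = (r, φ, ψ, t)` is a smooth change of coordinates that brings the metric `g` on its
domain to Robertson-Walker form with scale factor `a` and spatial curvature `k`. -/
structure IsRobertsonWalkerChart (g : MetricField) (k : ℤ) (a : ℝ → ℝ)
    (Φ : OpenPartialHomeomorph Coord Coord) : Prop where
  smooth : ContDiffOn ℝ ∞ Φ Φ.source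
  smooth_symm : ContDiffOn ℝ ∞ Φ.symm Φ.target
  smooth_a : ∀ z ∈ Φ.target, ContDiffAt ℝ ∞ a (z 3)
  a_pos : ∀ z ∈ Φ.target, 0 < a (z 3)
  r_range : ∀ z ∈ Φ.target, 0 < z 0 ∧ (k = 1 → z 0 < Real.pi)
  φ_range : ∀ z ∈ Φ.target, 0 < z 1 ∧ z 1 < Real.pi
  isometry : ∀ y ∈ Φ.source, ∀ V W,
    g.inner y V W = rwInner k a (Φ y) (fderiv ℝ Φ y V) (fderiv ℝ Φ y W)

end IdealEmbedding

end

open IdealEmbedding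

open scoped ContDiff

noncomputable section

namespace IdealEmbedding

/-! ### The ambient scalar product -/

section Eta

variable {ε : ℝ}

/-! Everything is computed in the ambient space with the moving frame `E_a = dX(e_a)`, `ξ`, where `e
= (w, v, q, u)`. Since `Ω` is diagonal, the Weingarten equation reads `D_{e_a} ξ = -κ_a E_a`.
Commuting two frame derivatives of `ξ` gives the Codazzi equations, and of `E_c` the Gauss
equations, both as relations between the coefficients `Γ_{abc} = η(D_{e_a} E_b, E_c)`. With the
Gauss equation for the Riemann tensor, the equality `η(H,H) = 4 (R - τ(L))` becomes `ε (σ + λ + ν -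
μ)² = 0`, so `σ = μ - λ - ν` (`IsIdealTetrad.sigma_eq`).

Case 1. Each alternative is, up to a permutation of the spacelike vectors, the ratio `-3 : 1 : 1 :
-1` of principal curvatures. Where `κ ≠ 0`, Codazzi reduces the relevant coefficients to `α =
Γ_{101}`, `β = Γ_{113}`, `Γ_{301}` and `Γ_{302}`. Gauss kills the last two and yields `α² = β²`,
`e_0 α = 3β² + 3εκ² - α²`, `e_0 β = 2αβ`. Differentiating `α² = β²` along `e_0` forces `α = 0`,
hence `β = 0`, and then `εκ² = 0`, a contradiction (`PrincipalFrame.isEmpty_of_ratio`).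

Case 2. The ratio is `1 : 1 : 1 : 3`. Put `l = λ`, `τ = -g(u, ·)`, and let `θ = Γ_{030}`. Codazzi
gives `dl = 2lθτ`, so `l` vanishes identically or nowhere on the connected set `U`. In the second
case `u` is geodesic, shear-free and irrotational, `dθ = (3εl² - θ²)τ`, and `(εl² - θ²) l` is
constant. Normalising this constant gives `k` and `c`. With `A = √(l/c)` one has `dA = θAτ` and
`θ²A² = εc²A⁶ - k`, the Friedmann equation; locally `τ = dt`.

The spatial geometry is read off in the ambient space (`PrincipalFrame.exists_robertsonWalker`):
with `N = E_3`, the vector `P = A l N + Aθ ξ` is constant, and the rescaled spatial part `A⁻¹ (dX -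
τ N)` of `dX` takes values in its orthogonal complement. It is, modulo `P`, the differential of an
explicit `Z`, whose components are Cartesian coordinates on a model of constant curvature `k`. Polar
coordinates there, together with `t`, form the chart. The fluid statement is linear algebra: the
Einstein tensor is `-εl² (7g + 4 u⊗u)`, with `u` lowered by `g`. -/

lemma eta_comm (ε : ℝ) (A B : Ambient) : eta ε A B = eta ε B A := by
  simp only [eta]; ring

lemma eta_add_left (ε : ℝ) (A B C : Ambient) : eta ε (A + B) C = eta ε A C + eta ε B C := by
  simp only [eta, Pi.add_apply]; ring

lemma eta_sub_left (ε : ℝ) (A B C : Ambient) : eta ε (A - B) C = eta ε A C - eta ε B C := by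
  simp only [eta, Pi.sub_apply]; ring

lemma eta_neg_left (ε : ℝ) (A C : Ambient) : eta ε (-A) C = - eta ε A C := by
  simp only [eta, Pi.neg_apply]; ring

lemma eta_smul_left (ε r : ℝ) (A C : Ambient) : eta ε (r • A) C = r * eta ε A C := by
  simp only [eta, Pi.smul_apply, smul_eq_mul]; ring

lemma eta_zero_left (ε : ℝ) (C : Ambient) : eta ε 0 C = 0 := by
  simp [eta]

lemma eta_add_right (ε : ℝ) (A B C : Ambient) : eta ε C (A + B) = eta ε C A + eta ε C B := by
  simp only [eta, Pi.add_apply]; ring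

lemma eta_sub_right (ε : ℝ) (A B C : Ambient) : eta ε C (A - B) = eta ε C A - eta ε C B := by
  simp only [eta, Pi.sub_apply]; ring

lemma eta_neg_right (ε : ℝ) (A C : Ambient) : eta ε C (-A) = - eta ε C A := by
  simp only [eta, Pi.neg_apply]; ring

lemma eta_smul_right (ε r : ℝ) (A C : Ambient) : eta ε C (r • A) = r * eta ε C A := by
  simp only [eta, Pi.smul_apply, smul_eq_mul]; ring

lemma eta_zero_right (ε : ℝ) (C : Ambient) : eta ε C 0 = 0 := by
  simp [eta]

lemma eta_sum_left {ι : Type*} (ε : ℝ) (s : Finset ι) (A : ι → Ambient) (C : Ambient) :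
    eta ε (∑ i ∈ s, A i) C = ∑ i ∈ s, eta ε (A i) C := by
  classical
  induction s using Finset.induction_on with
  | empty => simp [eta_zero_left]
  | insert a s ha ih => rw [Finset.sum_insert ha, Finset.sum_insert ha, eta_add_left, ih]

lemma eta_sum_right {ι : Type*} (ε : ℝ) (s : Finset ι) (A : ι → Ambient) (C : Ambient) :
    eta ε C (∑ i ∈ s, A i) = ∑ i ∈ s, eta ε C (A i) := by
  simp only [eta_comm ε C, eta_sum_left]

lemma eta_nondegenerate (hε : ε ≠ 0) {A A' : Ambient}
    (h : ∀ B, eta ε A B = eta ε A' B) : A = A' := by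
  funext i
  have := h (Pi.single i 1)
  fin_cases i <;> simpa [eta, Pi.single_apply, hε] using this

/-- The scalar product in terms of the components along an orthonormal frame. -/
lemma eta_eq_sum_of_orthonormal (hε : ε * ε = 1) (F : Fin 5 → Ambient)
    (hF : ∀ a b, eta ε (F a) (F b) = if a = b then (![1, 1, 1, -1, ε] : Fin 5 → ℝ) a else 0)
    (A B : Ambient) :
    eta ε A B = ∑ a, (![1, 1, 1, -1, ε] : Fin 5 → ℝ) a * eta ε A (F a) * eta ε B (F a) := by
  set s : Fin 5 → ℝ := ![1, 1, 1, -1, ε] with hs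
  have hss : ∀ a, s a * s a = 1 := by
    intro a; fin_cases a <;> simp [hs, hε]
  have heta : ∀ A B : Ambient, eta ε A B = ∑ i, s i * A i * B i := by
    intro A B
    simp [eta, hs, Fin.sum_univ_five]; ring
  let M : Matrix (Fin 5) (Fin 5) ℝ := Matrix.of F
  let G : Matrix (Fin 5) (Fin 5) ℝ := Matrix.diagonal s
  have hGG : G * G = 1 := by
    rw [Matrix.diagonal_mul_diagonal]
    simp [hss]
  have h1 : M * G * M.transpose = G := by
    ext a b
    have := hF a b
    rw [heta] at this
    rw [Matrix.mul_apply]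
    simp only [M, G, Matrix.mul_diagonal, Matrix.transpose_apply, Matrix.of_apply,
      Matrix.diagonal_apply]
    rw [← this]
    exact Finset.sum_congr rfl fun i _ => by ring
  have h2 : (M * G * M.transpose) * G = 1 := by rw [h1, hGG]
  -- Orthonormality says that `M` has a right inverse; for square matrices it is also a left
  -- inverse, which turns the orthonormality of the rows into the completeness relation `h5`.
  have h3 : (G * M.transpose * G) * M = 1 := by
    apply mul_eq_one_comm.mp
    rw [← h2]; simp only [Matrix.mul_assoc]
  have h4 : M.transpose * G * M = G := by
    calc M.transpose * G * M = (G * G) * (M.transpose * G * M) := by rw [hGG, one_mul]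
      _ = G * ((G * M.transpose * G) * M) := by simp only [Matrix.mul_assoc]
      _ = G := by rw [h3, mul_one]
  have h5 : ∀ i j, ∑ a, s a * F a i * F a j = if i = j then s i else 0 := by
    intro i j
    have := congrFun (congrFun h4 i) j
    rw [Matrix.mul_apply] at this
    simp only [M, G, Matrix.mul_diagonal, Matrix.transpose_apply, Matrix.of_apply,
      Matrix.diagonal_apply] at this
    rw [← this]
    exact Finset.sum_congr rfl fun i _ => by ring
  have h6 : ∀ a, s a * eta ε A (F a) * eta ε B (F a) =
      ∑ i, ∑ j, s i * A i * (s j * B j) * (s a * F a i * F a j) := by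
    intro a
    rw [heta, heta, mul_assoc, Finset.sum_mul_sum, Finset.mul_sum]
    refine Finset.sum_congr rfl fun i _ => ?_
    rw [Finset.mul_sum]
    exact Finset.sum_congr rfl fun j _ => by ring
  rw [Finset.sum_congr rfl fun a _ => h6 a, Finset.sum_comm, heta]
  refine Finset.sum_congr rfl fun i _ => ?_
  rw [Finset.sum_comm]
  simp only [← Finset.mul_sum, h5]
  simp only [mul_ite, mul_zero, Finset.sum_ite_eq, Finset.mem_univ, if_true]
  linear_combination (-(s i * A i * B i)) * hss i

variable {E : Type*} [NormedAddCommGroup E] [NormedSpace ℝ E]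

lemma hasFDerivAt_eta {f g : E → Ambient} {f' g' : E →L[ℝ] Ambient} {x : E}
    (hf : HasFDerivAt f f' x) (hg : HasFDerivAt g g' x) (ε : ℝ) :
    ∃ h' : E →L[ℝ] ℝ, HasFDerivAt (fun y => eta ε (f y) (g y)) h' x ∧
      ∀ V, h' V = eta ε (f' V) (g x) + eta ε (f x) (g' V) := by
  have hf' := fun i => hasFDerivAt_pi'.1 hf i
  have hg' := fun i => hasFDerivAt_pi'.1 hg i
  refine ⟨_, ((((hf' 0).mul (hg' 0)).add ((hf' 1).mul (hg' 1))).add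
    ((hf' 2).mul (hg' 2))).sub ((hf' 3).mul (hg' 3)) |>.add
    (((hf' 4).mul (hg' 4)).const_mul ε), ?_⟩
  intro V
  simp [eta]
  ring

lemma fderiv_eta {f g : E → Ambient} {x : E} (hf : DifferentiableAt ℝ f x)
    (hg : DifferentiableAt ℝ g x) (ε : ℝ) (V : E) :
    fderiv ℝ (fun y => eta ε (f y) (g y)) x V =
      eta ε (fderiv ℝ f x V) (g x) +
        eta ε (f x) (fderiv ℝ g x V) := by
  obtain ⟨h', hh, hV⟩ := hasFDerivAt_eta hf.hasFDerivAt hg.hasFDerivAt ε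
  rw [hh.fderiv, hV]

lemma contDiffOn_eta {f g : E → Ambient} {s : Set E} {n : WithTop ℕ∞}
    (hf : ContDiffOn ℝ n f s) (hg : ContDiffOn ℝ n g s) (ε : ℝ) :
    ContDiffOn ℝ n (fun y => eta ε (f y) (g y)) s := by
  have hf' := fun i => contDiffOn_pi.1 hf i
  have hg' := fun i => contDiffOn_pi.1 hg i
  exact (((((hf' 0).mul (hg' 0)).add ((hf' 1).mul (hg' 1))).add
    ((hf' 2).mul (hg' 2))).sub ((hf' 3).mul (hg' 3))).add
    (contDiffOn_const.mul ((hf' 4).mul (hg' 4)))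

end Eta

/-! ### Calculus on open sets -/

section Calculus

variable {E F : Type*} [NormedAddCommGroup E] [NormedSpace ℝ E]
  [NormedAddCommGroup F] [NormedSpace ℝ F]

lemma two_le_smooth : minSmoothness ℝ 2 ≤ (∞ : WithTop ℕ∞) := by
  rw [minSmoothness_of_isRCLikeNormedField]
  exact WithTop.coe_le_coe.2 (le_top : (2 : ℕ∞) ≤ ⊤)

lemma differentiableAt_of_smoothOn {f : E → F} {U : Set E} (hU : IsOpen U)
    (hf : ContDiffOn ℝ ∞ f U) {x : E} (hx : x ∈ U) : DifferentiableAt ℝ f x :=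
  (hf.contDiffAt (hU.mem_nhds hx)).differentiableAt (by simp)

lemma smoothOn_fderiv {f : E → F} {U : Set E} (hU : IsOpen U)
    (hf : ContDiffOn ℝ ∞ f U) : ContDiffOn ℝ ∞ (fderiv ℝ f) U :=
  hf.fderiv_of_isOpen hU (by simp)

lemma smoothOn_fderiv_apply {f : E → F} {p : E → E} {U : Set E} (hU : IsOpen U)
    (hf : ContDiffOn ℝ ∞ f U) (hp : ContDiffOn ℝ ∞ p U) :
    ContDiffOn ℝ ∞ (fun y => fderiv ℝ f y (p y)) U :=
  (smoothOn_fderiv hU hf).clm_apply hp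

lemma fderiv_fderiv_comm {f : E → F} {U : Set E} (hU : IsOpen U)
    (hf : ContDiffOn ℝ ∞ f U) {x : E} (hx : x ∈ U) (V W : E) :
    fderiv ℝ (fun y => fderiv ℝ f y W) x V = fderiv ℝ (fun y => fderiv ℝ f y V) x W := by
  have hd := differentiableAt_of_smoothOn hU (smoothOn_fderiv hU hf) hx
  have hs : IsSymmSndFDerivAt ℝ f x :=
    (hf.contDiffAt (hU.mem_nhds hx)).isSymmSndFDerivAt two_le_smooth
  rw [fderiv_clm_apply hd (differentiableAt_const _),
    fderiv_clm_apply hd (differentiableAt_const _)]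
  simpa using hs V W

/-- The commutator of the derivatives along two vector fields. -/
lemma fderiv_commutator {f : E → F} {p r : E → E} {U : Set E} (hU : IsOpen U)
    (hf : ContDiffOn ℝ ∞ f U) (hp : ContDiffOn ℝ ∞ p U) (hr : ContDiffOn ℝ ∞ r U)
    {x : E} (hx : x ∈ U) :
    fderiv ℝ (fun y => fderiv ℝ f y (r y)) x (p x)
      - fderiv ℝ (fun y => fderiv ℝ f y (p y)) x (r x)
      = fderiv ℝ f x (fderiv ℝ r x (p x) - fderiv ℝ p x (r x)) := by
  have hd := differentiableAt_of_smoothOn hU (smoothOn_fderiv hU hf) hx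
  have hs : IsSymmSndFDerivAt ℝ f x :=
    (hf.contDiffAt (hU.mem_nhds hx)).isSymmSndFDerivAt two_le_smooth
  have hp' := differentiableAt_of_smoothOn hU hp hx
  have hr' := differentiableAt_of_smoothOn hU hr hx
  rw [fderiv_clm_apply hd hr', fderiv_clm_apply hd hp']
  simp only [add_apply, ContinuousLinearMap.comp_apply,
    ContinuousLinearMap.flip_apply, map_sub]
  rw [hs (p x) (r x)]
  abel

end Calculus

/-! ### Principal frames of a hypersurface -/

/-- The signs of a Lorentzian orthonormal tetrad. -/
def tetradSign : Fin 4 → ℝ := ![1, 1, 1, -1]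

lemma tetradSign_mul_self (a : Fin 4) : tetradSign a * tetradSign a = 1 := by
  fin_cases a <;> simp [tetradSign]

lemma tetradSign_ne_zero (a : Fin 4) : tetradSign a ≠ 0 := by
  fin_cases a <;> simp [tetradSign]

/-- A smooth orthonormal tetrad `e` of principal directions of the hypersurface `X`, with
unit normal `ξ` and principal curvatures `κ`. -/
structure PrincipalFrame (ε : ℝ) (U : Set Coord) (X ξ : Coord → Ambient)
    (e : Fin 4 → Coord → Coord) (κ : Fin 4 → Coord → ℝ) : Prop where
  sq_sign : ε * ε = 1
  isOpen : IsOpen U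
  smooth_X : ContDiffOn ℝ ∞ X U
  smooth_ξ : ContDiffOn ℝ ∞ ξ U
  smooth_e : ∀ a, ContDiffOn ℝ ∞ (e a) U
  normal : ∀ x ∈ U, ∀ V, eta ε (fderiv ℝ X x V) (ξ x) = 0
  unit_normal : ∀ x ∈ U, eta ε (ξ x) (ξ x) = ε
  orthonormal : ∀ x ∈ U, ∀ a b, eta ε (fderiv ℝ X x (e a x)) (fderiv ℝ X x (e b x)) =
    if a = b then tetradSign a else 0
  principal : ∀ x ∈ U, ∀ a V, secondFF ε X ξ x (e a x) V =
    κ a x * eta ε (fderiv ℝ X x (e a x)) (fderiv ℝ X x V)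

/-- The image `dX(e_a)` of a tetrad vector in the ambient space. -/
def pushFrame (X : Coord → Ambient) (e : Fin 4 → Coord → Coord) (a : Fin 4) (x : Coord) :
    Ambient := fderiv ℝ X x (e a x)

/-- The connection coefficient `η(D_{e_a} (dX(e_b)), dX(e_c))`. -/
def connCoeff (ε : ℝ) (X : Coord → Ambient) (e : Fin 4 → Coord → Coord) (a b c : Fin 4)
    (x : Coord) : ℝ :=
  eta ε (fderiv ℝ (pushFrame X e b) x (e a x)) (pushFrame X e c x)

namespace PrincipalFrame

variable {ε : ℝ} {U : Set Coord} {X ξ : Coord → Ambient} {e : Fin 4 → Coord → Coord}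
  {κ : Fin 4 → Coord → ℝ} (h : PrincipalFrame ε U X ξ e κ)
include h

lemma sign_ne_zero : ε ≠ 0 := fun h0 => by simpa [h0] using h.sq_sign

lemma smooth_pushFrame (a : Fin 4) : ContDiffOn ℝ ∞ (pushFrame X e a) U :=
  smoothOn_fderiv_apply h.isOpen h.smooth_X (h.smooth_e a)

lemma eta_pushFrame {x : Coord} (hx : x ∈ U) (a b : Fin 4) :
    eta ε (pushFrame X e a x) (pushFrame X e b x) = if a = b then tetradSign a else 0 :=
  h.orthonormal x hx a b

lemma eta_pushFrame_normal {x : Coord} (hx : x ∈ U) (a : Fin 4) :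
    eta ε (pushFrame X e a x) (ξ x) = 0 :=
  h.normal x hx _

lemma eta_normal_pushFrame {x : Coord} (hx : x ∈ U) (a : Fin 4) :
    eta ε (ξ x) (pushFrame X e a x) = 0 := by
  rw [eta_comm]; exact h.normal x hx _

/-- The scalar product in terms of the components along the adapted frame. -/
lemma eta_eq_sum {x : Coord} (hx : x ∈ U) (A B : Ambient) :
    eta ε A B = ∑ a, tetradSign a * eta ε A (pushFrame X e a x) * eta ε B (pushFrame X e a x)
      + ε * eta ε A (ξ x) * eta ε B (ξ x) := by
  have key := eta_eq_sum_of_orthonormal h.sq_sign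
    ![pushFrame X e 0 x, pushFrame X e 1 x, pushFrame X e 2 x, pushFrame X e 3 x, ξ x] (by
      intro a b
      have h1 := h.eta_pushFrame hx
      have h2 := h.eta_pushFrame_normal hx
      have h3 := h.eta_normal_pushFrame hx
      have h4 := h.unit_normal x hx
      fin_cases a <;> fin_cases b <;> simp [h1, h2, h3, h4, tetradSign]) A B
  rw [key]
  simp [Fin.sum_univ_five, Fin.sum_univ_four, tetradSign]

lemma ambient_ext {x : Coord} (hx : x ∈ U) {A B : Ambient}
    (h1 : ∀ a, eta ε A (pushFrame X e a x) = eta ε B (pushFrame X e a x))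
    (h2 : eta ε A (ξ x) = eta ε B (ξ x)) : A = B := by
  refine eta_nondegenerate h.sign_ne_zero fun C => ?_
  rw [h.eta_eq_sum hx A C, h.eta_eq_sum hx B C, h2]
  simp only [h1]

/-- A tangent vector in terms of its components along the tetrad. -/
lemma tangent_eq_sum {x : Coord} (hx : x ∈ U) (V : Coord) :
    V = ∑ a, (tetradSign a * eta ε (fderiv ℝ X x V) (pushFrame X e a x)) • e a x := by
  have hcomp : ∀ (g : Fin 4 → ℝ) b,
      eta ε (fderiv ℝ X x (∑ a, g a • e a x)) (pushFrame X e b x) = g b * tetradSign b := by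
    intro g b
    rw [map_sum, eta_sum_left]
    simp only [map_smul, eta_smul_left]
    have : ∀ a, eta ε (fderiv ℝ X x (e a x)) (pushFrame X e b x) =
      if a = b then tetradSign a else 0 := fun a => h.eta_pushFrame hx a b
    simp [this]
  -- Pairing a vanishing combination with each `E_b` isolates its coefficients, so the tetrad is a
  -- basis.
  have hli : LinearIndependent ℝ (fun a => e a x) := by
    rw [Fintype.linearIndependent_iff]
    intro g hg b
    have := hcomp g b
    rw [hg, map_zero, eta_zero_left] at this
    exact (mul_eq_zero.1 this.symm).resolve_right (tetradSign_ne_zero b)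
  let bas := basisOfLinearIndependentOfCardEqFinrank hli (by simp)
  have hV : V = ∑ a, bas.repr V a • e a x := by
    conv_lhs => rw [← bas.sum_repr V]
    simp [bas]
  have hc : ∀ b, tetradSign b * eta ε (fderiv ℝ X x V) (pushFrame X e b x) = bas.repr V b := by
    intro b
    conv_lhs => rw [hV]
    rw [hcomp]
    linear_combination (bas.repr V b) * tetradSign_mul_self b
  simp only [hc]
  exact hV

lemma map_eq_sum {F : Type*} [AddCommGroup F] [Module ℝ F] {x : Coord} (hx : x ∈ U)
    (L : Coord →ₗ[ℝ] F) (V : Coord) :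
    L V = ∑ a, (tetradSign a * eta ε (fderiv ℝ X x V) (pushFrame X e a x)) • L (e a x) := by
  conv_lhs => rw [h.tangent_eq_sum hx V]
  simp only [map_sum, map_smul]

/-- The Weingarten equation. -/
lemma eta_fderiv_normal {x : Coord} (hx : x ∈ U) (V W : Coord) :
    eta ε (fderiv ℝ ξ x V) (fderiv ℝ X x W) = - secondFF ε X ξ x V W := by
  have hX := differentiableAt_of_smoothOn h.isOpen
    (smoothOn_fderiv_apply h.isOpen h.smooth_X (contDiffOn_const (c := W))) hx
  have hξ := differentiableAt_of_smoothOn h.isOpen h.smooth_ξ hx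
  have h1 := fderiv_eta hX hξ ε V
  have h2 : (fun y => eta ε (fderiv ℝ X y W) (ξ y)) =ᶠ[nhds x] fun _ => 0 := by
    filter_upwards [h.isOpen.mem_nhds hx] with y hy using h.normal y hy W
  rw [h2.fderiv_eq] at h1
  simp only [fderiv_fun_const, Pi.zero_apply, zero_apply] at h1
  rw [secondFF, eta_comm]
  linarith

lemma eta_fderiv_normal_normal {x : Coord} (hx : x ∈ U) (V : Coord) :
    eta ε (fderiv ℝ ξ x V) (ξ x) = 0 := by
  have hξ := differentiableAt_of_smoothOn h.isOpen h.smooth_ξ hx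
  have h1 := fderiv_eta hξ hξ ε V
  have h2 : (fun y => eta ε (ξ y) (ξ y)) =ᶠ[nhds x] fun _ => ε := by
    filter_upwards [h.isOpen.mem_nhds hx] with y hy using h.unit_normal y hy
  rw [h2.fderiv_eq, eta_comm ε (ξ x)] at h1
  simp only [fderiv_fun_const, Pi.zero_apply, zero_apply] at h1
  linarith

/-- The derivative of a unit normal has no normal component, and its tangential components are those
of `-Ω`, which is diagonal in the frame. -/
lemma fderiv_normal_frame {x : Coord} (hx : x ∈ U) (a : Fin 4) :
    fderiv ℝ ξ x (e a x) = -(κ a x • pushFrame X e a x) := by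
  refine h.ambient_ext hx (fun b => ?_) ?_
  · rw [pushFrame, h.eta_fderiv_normal hx, h.principal x hx, eta_neg_left, eta_smul_left]
    rfl
  · rw [h.eta_fderiv_normal_normal hx, eta_neg_left, eta_smul_left, h.eta_pushFrame_normal hx]
    simp

lemma secondFF_comm {x : Coord} (hx : x ∈ U) (V W : Coord) :
    secondFF ε X ξ x V W = secondFF ε X ξ x W V := by
  rw [secondFF, fderiv_fderiv_comm h.isOpen h.smooth_X hx]; rfl

/-- Components of the derivative of a tetrad vector along the normal. -/
lemma eta_fderiv_pushFrame_normal {x : Coord} (hx : x ∈ U) (a b : Fin 4) :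
    eta ε (fderiv ℝ (pushFrame X e b) x (e a x)) (ξ x) =
      if a = b then κ a x * tetradSign a else 0 := by
  have hE := differentiableAt_of_smoothOn h.isOpen (h.smooth_pushFrame b) hx
  have hξ := differentiableAt_of_smoothOn h.isOpen h.smooth_ξ hx
  have h1 := fderiv_eta hE hξ ε (e a x)
  have h2 : (fun y => eta ε (pushFrame X e b y) (ξ y)) =ᶠ[nhds x] fun _ => 0 := by
    filter_upwards [h.isOpen.mem_nhds hx] with y hy using h.normal y hy _
  rw [h2.fderiv_eq] at h1
  simp only [fderiv_fun_const, Pi.zero_apply, zero_apply] at h1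
  rw [h.fderiv_normal_frame hx, eta_neg_right, eta_smul_right, h.eta_pushFrame hx] at h1
  by_cases hab : a = b
  · subst hab; simp only [if_true] at h1 ⊢; linarith
  · rw [if_neg (Ne.symm hab)] at h1; rw [if_neg hab]; linarith

lemma connCoeff_antisymm {x : Coord} (hx : x ∈ U) (a b c : Fin 4) :
    connCoeff ε X e a b c x = - connCoeff ε X e a c b x := by
  have hb := differentiableAt_of_smoothOn h.isOpen (h.smooth_pushFrame b) hx
  have hc := differentiableAt_of_smoothOn h.isOpen (h.smooth_pushFrame c) hx
  have h1 := fderiv_eta hb hc ε (e a x)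
  have h2 : (fun y => eta ε (pushFrame X e b y) (pushFrame X e c y)) =ᶠ[nhds x]
      fun _ => if b = c then tetradSign b else 0 := by
    filter_upwards [h.isOpen.mem_nhds hx] with y hy using h.eta_pushFrame hy b c
  rw [h2.fderiv_eq, eta_comm ε (pushFrame X e b x)] at h1
  simp only [fderiv_fun_const, Pi.zero_apply, zero_apply] at h1
  simp only [connCoeff]
  linarith

lemma smooth_connCoeff (a b c : Fin 4) : ContDiffOn ℝ ∞ (connCoeff ε X e a b c) U :=
  contDiffOn_eta (smoothOn_fderiv_apply h.isOpen (h.smooth_pushFrame b) (h.smooth_e a))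
    (h.smooth_pushFrame c) ε

/-- The tetrad components of the Lie bracket of two tetrad vectors. -/
lemma eta_bracket {x : Coord} (hx : x ∈ U) (a b c : Fin 4) :
    eta ε (fderiv ℝ X x (fderiv ℝ (e b) x (e a x) - fderiv ℝ (e a) x (e b x)))
      (pushFrame X e c x) = connCoeff ε X e a b c x - connCoeff ε X e b a c x := by
  rw [← fderiv_commutator h.isOpen h.smooth_X (h.smooth_e a) (h.smooth_e b) hx, eta_sub_left]
  rfl

/-- The commutator of tetrad derivatives. -/
lemma fderiv_commutator_frame {F : Type*} [NormedAddCommGroup F] [NormedSpace ℝ F]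
    {f : Coord → F} (hf : ContDiffOn ℝ ∞ f U) {x : Coord} (hx : x ∈ U) (a b : Fin 4) :
    fderiv ℝ (fun y => fderiv ℝ f y (e b y)) x (e a x)
      - fderiv ℝ (fun y => fderiv ℝ f y (e a y)) x (e b x)
      = ∑ c, (tetradSign c * (connCoeff ε X e a b c x - connCoeff ε X e b a c x)) •
        fderiv ℝ f x (e c x) := by
  rw [fderiv_commutator h.isOpen hf (h.smooth_e a) (h.smooth_e b) hx]
  have := h.map_eq_sum hx (fderiv ℝ f x : Coord →ₗ[ℝ] F)
    (fderiv ℝ (e b) x (e a x) - fderiv ℝ (e a) x (e b x))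
  simp only [ContinuousLinearMap.coe_coe] at this
  rw [this]
  simp only [h.eta_bracket hx]

/-- Smoothness of the principal curvatures is not part of the structure; this formula supplies it.
-/
lemma curvature_eq {x : Coord} (hx : x ∈ U) (a : Fin 4) :
    κ a x = - (tetradSign a * eta ε (fderiv ℝ ξ x (e a x)) (pushFrame X e a x)) := by
  rw [h.fderiv_normal_frame hx, eta_neg_left, eta_smul_left, h.eta_pushFrame hx, if_pos rfl]
  linear_combination (-κ a x) * tetradSign_mul_self a

lemma smooth_curvature (a : Fin 4) : ContDiffOn ℝ ∞ (κ a) U :=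
  ((contDiffOn_const.mul (contDiffOn_eta (smoothOn_fderiv_apply h.isOpen h.smooth_ξ (h.smooth_e a))
    (h.smooth_pushFrame a) ε)).neg).congr fun _ hx => h.curvature_eq hx a

/-- The Codazzi equation in a principal frame. -/
lemma codazzi {x : Coord} (hx : x ∈ U) (a b c : Fin 4) :
    (κ c x - κ b x) * connCoeff ε X e a b c x - (κ c x - κ a x) * connCoeff ε X e b a c x =
      (if b = c then fderiv ℝ (κ b) x (e a x) * tetradSign b else 0)
        - (if a = c then fderiv ℝ (κ a) x (e b x) * tetradSign a else 0) := by
  -- Codazzi is the commutator identity for `ξ`, with `D_{e_b} ξ = -κ_b E_b` inserted and the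
  -- component along `E_c` taken.
  have key := h.fderiv_commutator_frame h.smooth_ξ hx a b
  have hd : ∀ a b, fderiv ℝ (fun y => fderiv ℝ ξ y (e b y)) x (e a x) =
      -(κ b x • fderiv ℝ (pushFrame X e b) x (e a x)
        + fderiv ℝ (κ b) x (e a x) • pushFrame X e b x) := by
    intro a b
    have h2 : (fun y => fderiv ℝ ξ y (e b y)) =ᶠ[nhds x]
        fun y => -(κ b y • pushFrame X e b y) := by
      filter_upwards [h.isOpen.mem_nhds hx] with y hy using h.fderiv_normal_frame hy b
    rw [h2.fderiv_eq, fderiv_fun_neg, fderiv_fun_smul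
      (differentiableAt_of_smoothOn h.isOpen (h.smooth_curvature b) hx)
      (differentiableAt_of_smoothOn h.isOpen (h.smooth_pushFrame b) hx)]
    simp
  rw [hd, hd] at key
  have key2 := congrArg (fun A => eta ε A (pushFrame X e c x)) key
  simp only [eta_sum_left, eta_sub_left, eta_neg_left, eta_smul_left, eta_add_left,
    h.fderiv_normal_frame hx, h.eta_pushFrame hx, mul_ite, mul_zero, mul_neg,
    Finset.sum_neg_distrib, Finset.sum_ite_eq', Finset.mem_univ, if_true]
    at key2
  simp only [connCoeff] at key2 ⊢
  have hcc := tetradSign_mul_self c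
  split_ifs at key2 ⊢ <;>
    linear_combination key2 - (κ c x) * (eta ε (fderiv ℝ (pushFrame X e b) x (e a x))
      (pushFrame X e c x) - eta ε (fderiv ℝ (pushFrame X e a) x (e b x))
      (pushFrame X e c x)) * hcc

/-- The Gauss equation in a principal frame. -/
lemma gauss {x : Coord} (hx : x ∈ U) (a b c d : Fin 4) :
    fderiv ℝ (connCoeff ε X e b c d) x (e a x) - fderiv ℝ (connCoeff ε X e a c d) x (e b x) =
      ∑ f, tetradSign f * (connCoeff ε X e b c f x * connCoeff ε X e a d f x
        - connCoeff ε X e a c f x * connCoeff ε X e b d f x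
        + (connCoeff ε X e a b f x - connCoeff ε X e b a f x) * connCoeff ε X e f c d x)
      + ε * ((if b = c then κ b x * tetradSign b else 0) *
          (if a = d then κ a x * tetradSign a else 0)
        - (if a = c then κ a x * tetradSign a else 0) *
          (if b = d then κ b x * tetradSign b else 0)) := by
  -- Gauss is the commutator identity for `E_c` along `E_d`. The products of connection coefficients
  -- and the `ε` term arise when the scalar product of two derivatives of frame vectors is expanded
  -- in the adapted frame.
  have key := congrArg (fun A => eta ε A (pushFrame X e d x))
    (h.fderiv_commutator_frame (h.smooth_pushFrame c) hx a b)
  have hd : ∀ a b, fderiv ℝ (connCoeff ε X e b c d) x (e a x) =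
      eta ε (fderiv ℝ (fun y => fderiv ℝ (pushFrame X e c) y (e b y)) x (e a x))
        (pushFrame X e d x)
      + (∑ f, tetradSign f * connCoeff ε X e b c f x * connCoeff ε X e a d f x
        + ε * (if b = c then κ b x * tetradSign b else 0) *
          (if a = d then κ a x * tetradSign a else 0)) := by
    intro a b
    have h1 := fderiv_eta (differentiableAt_of_smoothOn h.isOpen
      (smoothOn_fderiv_apply h.isOpen (h.smooth_pushFrame c) (h.smooth_e b)) hx)
      (differentiableAt_of_smoothOn h.isOpen (h.smooth_pushFrame d) hx) ε (e a x)
    rw [h.eta_eq_sum hx (fderiv ℝ (pushFrame X e c) x (e b x)),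
      h.eta_fderiv_pushFrame_normal hx, h.eta_fderiv_pushFrame_normal hx] at h1
    exact h1
  rw [hd, hd]
  simp only [eta_sub_left, eta_sum_left, eta_smul_left] at key
  have e1 : ∀ f, eta ε (fderiv ℝ (pushFrame X e c) x (e f x)) (pushFrame X e d x) =
    connCoeff ε X e f c d x := fun f => rfl
  simp only [e1, Fin.sum_univ_four] at key ⊢
  linear_combination key

end PrincipalFrame

lemma fderiv_eq_of_eqOn {E F : Type*} [NormedAddCommGroup E] [NormedSpace ℝ E]
    [NormedAddCommGroup F] [NormedSpace ℝ F] {f g : E → F} {U : Set E} (hU : IsOpen U)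
    (hfg : ∀ y ∈ U, f y = g y) {x : E} (hx : x ∈ U) : fderiv ℝ f x = fderiv ℝ g x :=
  Filter.EventuallyEq.fderiv_eq (by filter_upwards [hU.mem_nhds hx] with y hy using hfg y hy)

namespace PrincipalFrame

variable {ε : ℝ} {U : Set Coord} {X ξ : Coord → Ambient} {e : Fin 4 → Coord → Coord}
  {κ : Fin 4 → Coord → ℝ}

lemma mono (h : PrincipalFrame ε U X ξ e κ) {V : Set Coord} (hV : IsOpen V) (hVU : V ⊆ U) :
    PrincipalFrame ε V X ξ e κ where
  sq_sign := h.sq_sign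
  isOpen := hV
  smooth_X := h.smooth_X.mono hVU
  smooth_ξ := h.smooth_ξ.mono hVU
  smooth_e a := (h.smooth_e a).mono hVU
  normal x hx := h.normal x (hVU hx)
  unit_normal x hx := h.unit_normal x (hVU hx)
  orthonormal x hx := h.orthonormal x (hVU hx)
  principal x hx := h.principal x (hVU hx)

lemma connCoeff_self (h : PrincipalFrame ε U X ξ e κ) {x : Coord} (hx : x ∈ U) (a b : Fin 4) :
    connCoeff ε X e a b b x = 0 := by
  have := h.connCoeff_antisymm hx a b b
  linarith

/-! ### Hypersurfaces with principal curvatures in the ratio `-3 : 1 : 1 : -1` -/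

/-- The connection coefficients that the Codazzi equation forces to vanish, and the relations
between the others, when the principal curvatures are `-3κ, κ, κ, -κ` with `κ ≠ 0`. -/
structure RatioRelations (Γ : Fin 4 → Fin 4 → Fin 4 → ℝ) : Prop where
  r001 : Γ 0 0 1 = 0
  r002 : Γ 0 0 2 = 0
  r003 : Γ 0 0 3 = 3 * Γ 1 1 3
  r013 : Γ 0 1 3 = -2 * Γ 3 0 1
  r023 : Γ 0 2 3 = -2 * Γ 3 0 2
  r102 : Γ 1 0 2 = 0
  r103 : Γ 1 0 3 = 2 * Γ 3 0 1
  r123 : Γ 1 2 3 = 0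
  r201 : Γ 2 0 1 = 0
  r202 : Γ 2 0 2 = Γ 1 0 1
  r203 : Γ 2 0 3 = 2 * Γ 3 0 2
  r213 : Γ 2 1 3 = 0
  r223 : Γ 2 2 3 = Γ 1 1 3
  r303 : Γ 3 0 3 = 2 * Γ 1 0 1
  r313 : Γ 3 1 3 = 0
  r323 : Γ 3 2 3 = 0

lemma codazzi_self (h : PrincipalFrame ε U X ξ e κ) {x : Coord} (hx : x ∈ U) {a b : Fin 4}
    (hab : a ≠ b) : (κ b x - κ a x) * connCoeff ε X e b a b x =
      -(fderiv ℝ (κ b) x (e a x) * tetradSign b) := by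
  have := h.codazzi hx a b b
  rw [if_pos rfl, if_neg hab] at this
  linarith

/-- When `a ≠ b` as well, no derivative of a curvature enters Codazzi, so it is purely algebraic;
`codazzi_self` carries the derivatives. -/
lemma codazzi_distinct (h : PrincipalFrame ε U X ξ e κ) {x : Coord} (hx : x ∈ U) {a b c : Fin 4}
    (hac : a ≠ c) (hbc : b ≠ c) : (κ c x - κ b x) * connCoeff ε X e a b c x =
      (κ c x - κ a x) * connCoeff ε X e b a c x := by
  have := h.codazzi hx a b c
  rw [if_neg hac, if_neg hbc] at this
  linarith

section Ratio

variable (h : PrincipalFrame ε U X ξ e κ) (h0 : ∀ x ∈ U, κ 0 x = -3 * κ 1 x)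
  (h2 : ∀ x ∈ U, κ 2 x = κ 1 x) (h3 : ∀ x ∈ U, κ 3 x = -κ 1 x) (hne : ∀ x ∈ U, κ 1 x ≠ 0)
include h h0 h2 h3 hne

/-- For each direction, the instances of `codazzi_self` all contain the same derivative of `κ 1`;
eliminating it leaves linear relations. The instances of `codazzi_distinct` relate or kill the
coefficients with three different indices. Each identity appears multiplied by `κ 1 x`, which is
cancelled. -/
lemma ratioRelations {x : Coord} (hx : x ∈ U) :
    RatioRelations (fun a b c => connCoeff ε X e a b c x) := by
  have hl := hne x hx
  have k1 := differentiableAt_of_smoothOn h.isOpen (h.smooth_curvature 1) hx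
  have d0 : ∀ V, fderiv ℝ (κ 0) x V = -3 * fderiv ℝ (κ 1) x V := by
    intro V
    rw [fderiv_eq_of_eqOn h.isOpen h0 hx, fderiv_const_mul k1]; simp
  have d2 : ∀ V, fderiv ℝ (κ 2) x V = fderiv ℝ (κ 1) x V := by
    intro V
    rw [fderiv_eq_of_eqOn h.isOpen h2 hx]
  have d3 : ∀ V, fderiv ℝ (κ 3) x V = - fderiv ℝ (κ 1) x V := by
    intro V
    rw [fderiv_eq_of_eqOn h.isOpen h3 hx, fderiv_fun_neg]; simp
  have an := h.connCoeff_antisymm hx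
  have s0 : tetradSign 0 = 1 := rfl
  have s1 : tetradSign 1 = 1 := rfl
  have s2 : tetradSign 2 = 1 := rfl
  have s3 : tetradSign 3 = -1 := rfl
  have cs : ∀ {a b : Fin 4}, a ≠ b → _ := fun {a b} hab => h.codazzi_self hx hab
  have cd : ∀ {a b c : Fin 4}, a ≠ c → b ≠ c → _ :=
    fun {a b c} hac hbc => h.codazzi_distinct hx hac hbc
  have c12 := cs (a := 1) (b := 2) (by decide)
  have c21 := cs (a := 2) (b := 1) (by decide)
  have c01 := cs (a := 0) (b := 1) (by decide)
  have c02 := cs (a := 0) (b := 2) (by decide)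
  have c03 := cs (a := 0) (b := 3) (by decide)
  have c31 := cs (a := 3) (b := 1) (by decide)
  have c32 := cs (a := 3) (b := 2) (by decide)
  have c30 := cs (a := 3) (b := 0) (by decide)
  have c10 := cs (a := 1) (b := 0) (by decide)
  have c20 := cs (a := 2) (b := 0) (by decide)
  have c13 := cs (a := 1) (b := 3) (by decide)
  have c23 := cs (a := 2) (b := 3) (by decide)
  have c102 := cd (a := 1) (b := 0) (c := 2) (by decide) (by decide)
  have c201 := cd (a := 2) (b := 0) (c := 1) (by decide) (by decide)
  have c132 := cd (a := 1) (b := 3) (c := 2) (by decide) (by decide)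
  have c231 := cd (a := 2) (b := 3) (c := 1) (by decide) (by decide)
  have c031 := cd (a := 0) (b := 3) (c := 1) (by decide) (by decide)
  have c032 := cd (a := 0) (b := 3) (c := 2) (by decide) (by decide)
  have c013 := cd (a := 0) (b := 1) (c := 3) (by decide) (by decide)
  have c023 := cd (a := 0) (b := 2) (c := 3) (by decide) (by decide)
  simp only [d0, d2, d3, h0 x hx, h2 x hx, h3 x hx, s0, s1, s2, s3]
    at c12 c21 c01 c02 c03 c31 c32 c30 c10 c20 c13 c23 c102 c201 c132 c231 c031 c032 c013 c023
  constructor <;> refine mul_left_cancel₀ hl ?_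
  · linear_combination (κ 1 x) * an 0 0 1 + c10 / 4 + (3 / 4) * c12
  · linear_combination (κ 1 x) * an 0 0 2 + c20 / 4 + (3 / 4) * c21
  · linear_combination (κ 1 x) * an 0 0 3 + c30 / 2 + (3 / 2) * c31 - 3 * κ 1 x * an 1 1 3
  · linear_combination (κ 1 x) * an 0 1 3 - c031 / 2
  · linear_combination (κ 1 x) * an 0 2 3 - c032 / 2
  · linear_combination c102 / 4
  · linear_combination - c013 / 2 - (κ 1 x) * an 0 1 3 + c031 / 2
  · linear_combination (κ 1 x) * an 1 2 3 - c132 / 2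
  · linear_combination c201 / 4
  · linear_combination c02 / 4 - c01 / 4
  · linear_combination - c023 / 2 - (κ 1 x) * an 0 2 3 + c032 / 2
  · linear_combination (κ 1 x) * an 2 1 3 - c231 / 2
  · linear_combination (κ 1 x) * an 2 2 3 - c32 / 2 + c31 / 2 - (κ 1 x) * an 1 1 3
  · linear_combination c03 / 2 - c01 / 2
  · linear_combination - c13 / 2 + c12 / 2
  · linear_combination - c23 / 2 + c21 / 2

/-- The Gauss equations overdetermine what Codazzi leaves: an algebraic relation between `Γ 1 0 1`
and `Γ 1 1 3` is not preserved along `e 0` unless both vanish, and then the curvature must vanish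
too. -/
lemma isEmpty_of_ratio {x : Coord} (hx : x ∈ U) : False := by
  have R := fun y (hy : y ∈ U) => h.ratioRelations h0 h2 h3 hne hy
  set Γ := connCoeff ε X e with hΓ
  have hdiff : ∀ a b c, ∀ y ∈ U, DifferentiableAt ℝ (Γ a b c) y := fun a b c y hy =>
    differentiableAt_of_smoothOn h.isOpen (h.smooth_connCoeff a b c) hy
  have dzero : ∀ {a b c : Fin 4}, (∀ y ∈ U, Γ a b c y = 0) → ∀ y ∈ U, fderiv ℝ (Γ a b c) y = 0 := by
    intro a b c hz y hy
    rw [fderiv_eq_of_eqOn h.isOpen hz hy]; simp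
  have s0 : tetradSign 0 = 1 := rfl
  have s1 : tetradSign 1 = 1 := rfl
  have s2 : tetradSign 2 = 1 := rfl
  have s3 : tetradSign 3 = -1 := rfl
  have swap : ∀ y ∈ U, (∀ a, Γ a 1 0 y = - Γ a 0 1 y) ∧ (∀ a, Γ a 2 0 y = - Γ a 0 2 y) ∧
      (∀ a, Γ a 3 0 y = - Γ a 0 3 y) ∧ (∀ a, Γ a 2 1 y = - Γ a 1 2 y) ∧
      (∀ a, Γ a 3 1 y = - Γ a 1 3 y) ∧ (∀ a, Γ a 3 2 y = - Γ a 2 3 y) ∧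
      (∀ a b, Γ a b b y = 0) := fun y hy =>
    ⟨fun a => h.connCoeff_antisymm hy a 1 0, fun a => h.connCoeff_antisymm hy a 2 0,
      fun a => h.connCoeff_antisymm hy a 3 0, fun a => h.connCoeff_antisymm hy a 2 1,
      fun a => h.connCoeff_antisymm hy a 3 1, fun a => h.connCoeff_antisymm hy a 3 2,
      fun a b => h.connCoeff_self hy a b⟩
  have z001 := dzero fun y hy => (R y hy).r001
  have z002 := dzero fun y hy => (R y hy).r002
  have z102 := dzero fun y hy => (R y hy).r102
  have z331 := dzero (a := 3) (b := 3) (c := 1) fun y hy => by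
    rw [(swap y hy).2.2.2.2.1, (R y hy).r313, neg_zero]
  have e202 : ∀ y ∈ U, fderiv ℝ (Γ 2 0 2) y = fderiv ℝ (Γ 1 0 1) y := fun y hy =>
    fderiv_eq_of_eqOn h.isOpen (fun z hz => (R z hz).r202) hy
  have e131 : ∀ y ∈ U, fderiv ℝ (Γ 1 3 1) y = - fderiv ℝ (Γ 1 1 3) y := fun y hy => by
    rw [fderiv_eq_of_eqOn h.isOpen (fun z hz => (swap z hz).2.2.2.2.1 1) hy, fderiv_fun_neg]
  have e030 : ∀ y ∈ U, fderiv ℝ (Γ 0 3 0) y = (-3 : ℝ) • fderiv ℝ (Γ 1 1 3) y := fun y hy => by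
    rw [fderiv_eq_of_eqOn h.isOpen (g := fun z => (-3) * Γ 1 1 3 z) (fun z hz => by
      rw [(swap z hz).2.2.1, (R z hz).r003]; ring) hy, fderiv_const_mul (hdiff _ _ _ _ hy)]
  have e330 : ∀ y ∈ U, fderiv ℝ (Γ 3 3 0) y = (-2 : ℝ) • fderiv ℝ (Γ 1 0 1) y := fun y hy => by
    rw [fderiv_eq_of_eqOn h.isOpen (g := fun z => (-2) * Γ 1 0 1 z) (fun z hz => by
      rw [(swap z hz).2.2.1, (R z hz).r303]; ring) hy, fderiv_const_mul (hdiff _ _ _ _ hy)]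
  -- The derivative of `Γ 1 0 1` along `e 0` is given both by the `1001` and the `2002` Gauss
  -- equation, which differ only in `Γ 3 0 1 ^ 2` against `Γ 3 0 2 ^ 2`. The mixed equation `1002`
  -- says that the product of the two is zero.
  have pzero : ∀ y ∈ U, Γ 3 0 1 y = 0 ∧ Γ 3 0 2 y = 0 := by
    intro y hy
    obtain ⟨w10, w20, w30, w21, w31, w32, w⟩ := swap y hy
    obtain ⟨r001, r002, r003, r013, r023, r102, r103, r123, r201, r202, r203, r213, r223, r303,
      r313, r323⟩ := R y hy
    have g1001 := h.gauss hy 1 0 0 1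
    have g2002 := h.gauss hy 2 0 0 2
    have g1002 := h.gauss hy 1 0 0 2
    simp only [← hΓ, Fin.sum_univ_four, w10, w20, w21, w, r001, r002, r003, r013, r023, r102,
      r103, r123, r201, r202, r203, r223, z001 y hy, z002 y hy, z102 y hy, e202 y hy, s0, s1,
      s2, s3, h0 y hy, h2 y hy, zero_apply, Fin.reduceEq, if_true, if_false]
      at g1001 g2002 g1002
    have pq : Γ 3 0 1 y * Γ 3 0 2 y = 0 := by linarith
    have pp : Γ 3 0 1 y ^ 2 = Γ 3 0 2 y ^ 2 := by linarith
    rcases mul_eq_zero.1 pq with h1 | h1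
    · rw [h1] at pp; exact ⟨h1, by simpa using pp.symm⟩
    · rw [h1] at pp; exact ⟨by simpa using pp, h1⟩
  have z031 := dzero (a := 0) (b := 3) (c := 1) fun y hy => by
    rw [(swap y hy).2.2.2.2.1, (R y hy).r013, (pzero y hy).1]; ring
  -- Equation `1001` gives `e_0 α`, `1031` gives `e_0 β`, and `1331` gives `e_3 β`. Inserting these
  -- in `0330` leaves `α² = β²`, the curvature terms cancelling.
  have main : ∀ y ∈ U, Γ 1 0 1 y ^ 2 = Γ 1 1 3 y ^ 2 ∧
      fderiv ℝ (Γ 1 0 1) y (e 0 y) = 3 * Γ 1 1 3 y ^ 2 + 3 * ε * κ 1 y ^ 2 - Γ 1 0 1 y ^ 2 ∧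
      fderiv ℝ (Γ 1 1 3) y (e 0 y) = 2 * Γ 1 0 1 y * Γ 1 1 3 y := by
    intro y hy
    obtain ⟨w10, w20, w30, w21, w31, w32, w⟩ := swap y hy
    obtain ⟨r001, r002, r003, r013, r023, r102, r103, r123, r201, r202, r203, r213, r223, r303,
      r313, r323⟩ := R y hy
    have g1001 := h.gauss hy 1 0 0 1
    have g2002 := h.gauss hy 2 0 0 2
    have g1331 := h.gauss hy 1 3 3 1
    have g1031 := h.gauss hy 1 0 3 1
    have g0330 := h.gauss hy 0 3 3 0
    simp only [← hΓ, Fin.sum_univ_four, w10, w20, w30, w21, w31, w32, w, r001, r002, r003, r013,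
      r023, r102, r103, r123, r201, r202, r203, r213, r223, r303, r313, r323, z001 y hy, z002 y hy,
      z331 y hy, e202 y hy, e131 y hy, e030 y hy, e330 y hy, z031 y hy, s0, s1, s2, s3,
      h0 y hy, h2 y hy, h3 y hy, zero_apply, neg_apply, smul_apply, smul_eq_mul, Fin.reduceEq,
      (pzero y hy).1, (pzero y hy).2, if_true, if_false] at g1001 g2002 g1331 g1031 g0330
    refine ⟨by linarith, by linarith, by linarith⟩
  -- Along `e 0` the relation `α² = β²` becomes `α (3β² + 3εκ² - α²) = 2αβ²`, that is `3εκ² α = 0`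
  -- by the relation itself.
  have azero : ∀ y ∈ U, Γ 1 0 1 y = 0 := by
    intro y hy
    obtain ⟨m1, m2, m3⟩ := main y hy
    have hd := congrArg (fun L => L (e 0 y))
      (fderiv_eq_of_eqOn h.isOpen (fun z hz => (main z hz).1) hy)
    simp only [fderiv_fun_pow 2 (hdiff _ _ _ _ hy), smul_apply, smul_eq_mul, m2, m3] at hd
    by_contra hne0
    have : ε * κ 1 y ^ 2 = 0 := by
      refine mul_left_cancel₀ hne0 ?_
      simp at hd
      linear_combination hd / 6 + (1 / 3) * Γ 1 0 1 y * m1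
    rcases mul_eq_zero.1 this with h1 | h1
    · exact h.sign_ne_zero h1
    · exact hne y hy (by simpa using h1)
  obtain ⟨m1, m2, -⟩ := main x hx
  rw [dzero azero x hx, azero x hx] at m2
  rw [azero x hx] at m1
  have : ε * κ 1 x ^ 2 = 0 := by
    simp at m2
    linarith
  rcases mul_eq_zero.1 this with h1 | h1
  · exact h.sign_ne_zero h1
  · exact hne x hx (by simpa using h1)

end Ratio

/-- A hypersurface with principal curvatures `-3κ, κ, κ, -κ` is totally geodesic. -/
lemma curvature_eq_zero_of_ratio (h : PrincipalFrame ε U X ξ e κ)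
    (h0 : ∀ x ∈ U, κ 0 x = -3 * κ 1 x) (h2 : ∀ x ∈ U, κ 2 x = κ 1 x)
    (h3 : ∀ x ∈ U, κ 3 x = -κ 1 x) {x : Coord} (hx : x ∈ U) : κ 1 x = 0 := by
  by_contra hne
  -- The frame is restricted to the open set where the curvature does not vanish, which must then be
  -- empty.
  have hO : IsOpen (U ∩ {y | κ 1 y ≠ 0}) :=
    (h.smooth_curvature 1).continuousOn.isOpen_inter_preimage h.isOpen isOpen_compl_singleton
  exact (h.mono hO Set.inter_subset_left).isEmpty_of_ratio (fun y hy => h0 y hy.1)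
    (fun y hy => h2 y hy.1) (fun y hy => h3 y hy.1) (fun y hy => hy.2) ⟨hx, hne⟩

end PrincipalFrame

/-! ### The intrinsic Gauss equation -/

lemma coord_eq_sum (V : Coord) : V = ∑ i, V i • (Pi.single i 1 : Coord) := by
  funext j
  simp [Finset.sum_apply, Pi.single_apply]

lemma linear_eq_sum {F : Type*} [AddCommGroup F] [Module ℝ F] (L : Coord →ₗ[ℝ] F) (V : Coord) :
    L V = ∑ i, V i • L (Pi.single i 1) := by
  conv_lhs => rw [coord_eq_sum V]
  simp only [map_sum, map_smul]

lemma fderiv_eq_sum {F : Type*} [NormedAddCommGroup F] [NormedSpace ℝ F] (f : Coord → F)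
    (x V : Coord) : fderiv ℝ f x V = ∑ i, V i • fderiv ℝ f x (Pi.single i 1) :=
  linear_eq_sum (fderiv ℝ f x : Coord →ₗ[ℝ] F) V

lemma inducedMetric_apply (ε : ℝ) (X : Coord → Ambient) (x : Coord) (i j : Fin 4) :
    inducedMetric ε X x i j =
      eta ε (fderiv ℝ X x (Pi.single i 1)) (fderiv ℝ X x (Pi.single j 1)) := rfl

lemma inducedMetric_inner (ε : ℝ) (X : Coord → Ambient) (x V W : Coord) :
    (inducedMetric ε X).inner x V W = eta ε (fderiv ℝ X x V) (fderiv ℝ X x W) := by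
  rw [fderiv_eq_sum X x V, fderiv_eq_sum X x W, eta_sum_left]
  simp only [eta_sum_right, eta_smul_left, eta_smul_right, MetricField.inner, inducedMetric_apply]
  exact Finset.sum_congr rfl fun i _ => Finset.sum_congr rfl fun j _ => by ring

lemma inducedMetric_lower (ε : ℝ) (X : Coord → Ambient) (x V : Coord) (i : Fin 4) :
    ∑ m, inducedMetric ε X x i m * V m =
      eta ε (fderiv ℝ X x (Pi.single i 1)) (fderiv ℝ X x V) := by
  rw [fderiv_eq_sum X x V, eta_sum_right]
  simp only [eta_smul_right, inducedMetric_apply]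
  exact Finset.sum_congr rfl fun i _ => by ring

namespace PrincipalFrame

variable {ε : ℝ} {U : Set Coord} {X ξ : Coord → Ambient} {e : Fin 4 → Coord → Coord}
  {κ : Fin 4 → Coord → ℝ} (h : PrincipalFrame ε U X ξ e κ)
include h

lemma ambient_ext_tangent {x : Coord} (hx : x ∈ U) {A B : Ambient}
    (h1 : ∀ V, eta ε A (fderiv ℝ X x V) = eta ε B (fderiv ℝ X x V))
    (h2 : eta ε A (ξ x) = eta ε B (ξ x)) : A = B :=
  h.ambient_ext hx (fun _ => h1 _) h2

/-- The inverse metric in terms of the tetrad. -/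
lemma inv_inducedMetric {x : Coord} (hx : x ∈ U) (l m : Fin 4) :
    (inducedMetric ε X x)⁻¹ l m = ∑ a, tetradSign a * e a x l * e a x m := by
  have : (inducedMetric ε X x)⁻¹ =
      Matrix.of fun l m => ∑ a, tetradSign a * e a x l * e a x m := by
    refine Matrix.inv_eq_right_inv ?_
    ext i n
    rw [Matrix.mul_apply]
    have key := congrFun (h.tangent_eq_sum hx (Pi.single i 1)) n
    simp only [Finset.sum_apply, Pi.smul_apply, smul_eq_mul] at key
    have e1 : ∀ a, eta ε (fderiv ℝ X x (Pi.single i 1)) (pushFrame X e a x) =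
        ∑ m, inducedMetric ε X x i m * e a x m := fun a =>
      (inducedMetric_lower ε X x (e a x) i).symm
    rw [Matrix.one_apply]
    have e2 : (if i = n then (1 : ℝ) else 0) = (Pi.single i 1 : Coord) n := by
      simp [Pi.single_apply, eq_comm]
    rw [e2, key]
    simp only [e1, Matrix.of_apply, Finset.mul_sum, Finset.sum_mul]
    rw [Finset.sum_comm]
    exact Finset.sum_congr rfl fun _ _ => Finset.sum_congr rfl fun _ _ => by ring
  rw [this, Matrix.of_apply]

/-- Raising an index: contraction with the inverse metric gives the components of the tangential
projection of `A`. -/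
lemma sum_inv_mul_eta {x : Coord} (hx : x ∈ U) (l : Fin 4) (A : Ambient) :
    ∑ m, (inducedMetric ε X x)⁻¹ l m * eta ε A (fderiv ℝ X x (Pi.single m 1)) =
      ∑ a, tetradSign a * eta ε A (pushFrame X e a x) * e a x l := by
  have e1 : ∀ a, eta ε A (pushFrame X e a x) =
      ∑ m, e a x m * eta ε A (fderiv ℝ X x (Pi.single m 1)) := by
    intro a
    rw [pushFrame, fderiv_eq_sum X x (e a x), eta_sum_right]
    simp only [eta_smul_right]
  simp only [h.inv_inducedMetric hx, e1, Finset.mul_sum, Finset.sum_mul]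
  rw [Finset.sum_comm]
  exact Finset.sum_congr rfl fun _ _ => Finset.sum_congr rfl fun _ _ => by ring

/-- The second partial derivatives of the immersion. -/
lemma smooth_secondDeriv (i j : Fin 4) : ContDiffOn ℝ ∞
    (fun y => fderiv ℝ (fun z => fderiv ℝ X z (Pi.single j 1)) y (Pi.single i 1)) U :=
  smoothOn_fderiv_apply h.isOpen (smoothOn_fderiv_apply h.isOpen h.smooth_X contDiffOn_const)
    contDiffOn_const

/-- In the Koszul combination the symmetric second derivatives of `X` cancel except `∂_i ∂_j X`, so
the Christoffel symbols are the components of its tangential part. -/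
lemma christoffel_eq {x : Coord} (hx : x ∈ U) (l i j : Fin 4) :
    christoffel (inducedMetric ε X) l i j x = ∑ a, tetradSign a *
      eta ε (fderiv ℝ (fun z => fderiv ℝ X z (Pi.single j 1)) x (Pi.single i 1))
        (pushFrame X e a x) * e a x l := by
  have hd : ∀ i, DifferentiableAt ℝ (fun z => fderiv ℝ X z (Pi.single i 1)) x := fun i =>
    differentiableAt_of_smoothOn h.isOpen
      (smoothOn_fderiv_apply h.isOpen h.smooth_X contDiffOn_const) hx
  have hp : ∀ i j m, pderiv i (fun y => inducedMetric ε X y j m) x =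
      eta ε (fderiv ℝ (fun z => fderiv ℝ X z (Pi.single j 1)) x (Pi.single i 1))
        (fderiv ℝ X x (Pi.single m 1)) +
      eta ε (fderiv ℝ (fun z => fderiv ℝ X z (Pi.single m 1)) x (Pi.single i 1))
        (fderiv ℝ X x (Pi.single j 1)) := by
    intro i j m
    have := fderiv_eta (hd j) (hd m) ε (Pi.single i 1)
    rw [eta_comm ε (fderiv ℝ X x (Pi.single j 1))] at this
    exact this
  rw [← h.sum_inv_mul_eta hx, christoffel, Finset.mul_sum]
  refine Finset.sum_congr rfl fun m _ => ?_
  rw [hp, hp, hp, fderiv_fderiv_comm h.isOpen h.smooth_X hx (Pi.single m 1) (Pi.single i 1),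
    fderiv_fderiv_comm h.isOpen h.smooth_X hx (Pi.single m 1) (Pi.single j 1),
    fderiv_fderiv_comm h.isOpen h.smooth_X hx (Pi.single j 1) (Pi.single i 1)]
  ring

lemma smooth_christoffel (l i j : Fin 4) :
    ContDiffOn ℝ ∞ (christoffel (inducedMetric ε X) l i j) U := by
  refine ContDiffOn.congr ?_ fun x hx => h.christoffel_eq hx l i j
  refine ContDiffOn.sum fun a _ => ?_
  exact (contDiffOn_const.mul (contDiffOn_eta (h.smooth_secondDeriv i j)
    (h.smooth_pushFrame a) ε)).mul (contDiffOn_pi.1 (h.smooth_e a) l)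

lemma eta_fderiv_sum {x : Coord} (hx : x ∈ U) (A : Ambient) (W : Coord) :
    eta ε (fderiv ℝ X x (∑ a, (tetradSign a * eta ε A (pushFrame X e a x)) • e a x))
      (fderiv ℝ X x W) = eta ε A (fderiv ℝ X x W) := by
  rw [h.eta_eq_sum hx A (fderiv ℝ X x W), h.normal x hx W, map_sum, eta_sum_left, mul_zero,
    add_zero]
  refine Finset.sum_congr rfl fun a _ => ?_
  rw [map_smul, eta_smul_left, eta_comm ε _ (fderiv ℝ X x W)]
  rfl

/-- The Gauss formula. -/
lemma gauss_formula {x : Coord} (hx : x ∈ U) (i j : Fin 4) :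
    fderiv ℝ (fun z => fderiv ℝ X z (Pi.single j 1)) x (Pi.single i 1) =
      fderiv ℝ X x (fun l => christoffel (inducedMetric ε X) l i j x) +
        (ε * secondFF ε X ξ x (Pi.single i 1) (Pi.single j 1)) • ξ x := by
  have hC : (fun l => christoffel (inducedMetric ε X) l i j x) =
      ∑ a, (tetradSign a * eta ε (fderiv ℝ (fun z => fderiv ℝ X z (Pi.single j 1)) x
        (Pi.single i 1)) (pushFrame X e a x)) • e a x := by
    funext l
    rw [h.christoffel_eq hx]
    simp [Finset.sum_apply]
  refine h.ambient_ext_tangent hx (fun W => ?_) ?_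
  · rw [hC, eta_add_left, h.eta_fderiv_sum hx, eta_smul_left, eta_comm ε (ξ x), h.normal x hx]
    ring
  · rw [eta_add_left, h.normal x hx, eta_smul_left, h.unit_normal x hx, secondFF]
    linear_combination (-eta ε (fderiv ℝ (fun z => fderiv ℝ X z (Pi.single j 1)) x
      (Pi.single i 1)) (ξ x)) * h.sq_sign

lemma smooth_secondFF (V W : Coord) : ContDiffOn ℝ ∞ (fun x => secondFF ε X ξ x V W) U :=
  contDiffOn_eta (smoothOn_fderiv_apply h.isOpen
    (smoothOn_fderiv_apply h.isOpen h.smooth_X contDiffOn_const) contDiffOn_const) h.smooth_ξ ε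

/-- Third derivatives of the immersion. -/
lemma eta_thirdDeriv {x : Coord} (hx : x ∈ U) (i j k : Fin 4) (W : Coord) :
    eta ε (fderiv ℝ (fun y => fderiv ℝ (fun z => fderiv ℝ X z (Pi.single k 1)) y (Pi.single j 1))
        x (Pi.single i 1)) (fderiv ℝ X x W) =
      eta ε (fderiv ℝ X x (fun l => pderiv i (christoffel (inducedMetric ε X) l j k) x +
        ∑ m, christoffel (inducedMetric ε X) l i m x * christoffel (inducedMetric ε X) m j k x))
        (fderiv ℝ X x W)
      - ε * secondFF ε X ξ x (Pi.single j 1) (Pi.single k 1) *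
        secondFF ε X ξ x (Pi.single i 1) W := by
  set C : Coord → Coord := fun y l => christoffel (inducedMetric ε X) l j k y with hCdef
  have hC : DifferentiableAt ℝ C x := differentiableAt_pi.2 fun l =>
    differentiableAt_of_smoothOn h.isOpen (h.smooth_christoffel l j k) hx
  have hCd : fderiv ℝ C x (Pi.single i 1) =
      fun l => pderiv i (christoffel (inducedMetric ε X) l j k) x := by
    funext l
    rw [fderiv_pi fun l => differentiableAt_of_smoothOn h.isOpen (h.smooth_christoffel l j k) hx]
    rfl
  have hX := differentiableAt_of_smoothOn h.isOpen (smoothOn_fderiv h.isOpen h.smooth_X) hx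
  have hS := differentiableAt_of_smoothOn h.isOpen
    (h.smooth_secondFF (Pi.single j 1) (Pi.single k 1)) hx
  have hξ := differentiableAt_of_smoothOn h.isOpen h.smooth_ξ hx
  have hD2 : fderiv ℝ (fderiv ℝ X) x (Pi.single i 1) (C x) = ∑ m, C x m •
      fderiv ℝ (fun z => fderiv ℝ X z (Pi.single m 1)) x (Pi.single i 1) := by
    have := linear_eq_sum (fderiv ℝ (fderiv ℝ X) x (Pi.single i 1) : Coord →ₗ[ℝ] Ambient) (C x)
    simp only [ContinuousLinearMap.coe_coe] at this
    rw [this]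
    refine Finset.sum_congr rfl fun m _ => ?_
    rw [fderiv_clm_apply hX (differentiableAt_const _)]
    simp
  -- The Gauss formula for `∂_j ∂_k X` is differentiated once more; its normal part contributes the
  -- product of second fundamental forms through the Weingarten equation.
  rw [fderiv_eq_of_eqOn h.isOpen (g := fun y => fderiv ℝ X y (C y) +
      (ε * secondFF ε X ξ y (Pi.single j 1) (Pi.single k 1)) • ξ y)
      (fun y hy => h.gauss_formula hy j k) hx,
    fderiv_fun_add (hX.clm_apply hC) ((hS.const_mul ε).fun_smul hξ), add_apply,
    fderiv_clm_apply hX hC, fderiv_fun_smul (hS.const_mul ε) hξ]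
  simp only [add_apply, ContinuousLinearMap.comp_apply, ContinuousLinearMap.flip_apply, smul_apply,
    ContinuousLinearMap.smulRight_apply]
  rw [hCd, hD2]
  have hsum : (fun l => pderiv i (christoffel (inducedMetric ε X) l j k) x +
        ∑ m, christoffel (inducedMetric ε X) l i m x * christoffel (inducedMetric ε X) m j k x) =
      (fun l => pderiv i (christoffel (inducedMetric ε X) l j k) x) +
        ∑ m, C x m • (fun l => christoffel (inducedMetric ε X) l i m x) := by
    funext l
    simp only [Pi.add_apply, Finset.sum_apply, Pi.smul_apply, smul_eq_mul, hCdef]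
    congr 1
    exact Finset.sum_congr rfl fun _ _ => mul_comm _ _
  rw [hsum, map_add, map_sum]
  simp only [map_smul, eta_add_left, eta_sum_left, eta_smul_left, h.eta_fderiv_normal hx]
  have : ∀ m, eta ε (fderiv ℝ (fun z => fderiv ℝ X z (Pi.single m 1)) x (Pi.single i 1))
      (fderiv ℝ X x W) = eta ε (fderiv ℝ X x fun l => christoffel (inducedMetric ε X) l i m x)
      (fderiv ℝ X x W) := by
    intro m
    rw [h.gauss_formula hx, eta_add_left, eta_smul_left, eta_comm ε (ξ x), h.normal x hx]
    ring
  simp only [this, eta_comm ε (ξ x), h.normal x hx]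
  ring

/-- The Gauss equation for the Riemann tensor of the induced metric. -/
lemma eta_riemann {x : Coord} (hx : x ∈ U) (k i j : Fin 4) (W : Coord) :
    eta ε (fderiv ℝ X x fun l => riemann (inducedMetric ε X) l k i j x) (fderiv ℝ X x W) =
      ε * (secondFF ε X ξ x (Pi.single j 1) (Pi.single k 1) * secondFF ε X ξ x (Pi.single i 1) W
        - secondFF ε X ξ x (Pi.single i 1) (Pi.single k 1) *
          secondFF ε X ξ x (Pi.single j 1) W) := by
  have h1 := h.eta_thirdDeriv hx i j k W
  have h2 := h.eta_thirdDeriv hx j i k W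
  -- Third derivatives of `X` are symmetric in `i` and `j`; the difference of the two expansions is
  -- the Riemann tensor plus the quadratic term in `Ω`.
  rw [fderiv_fderiv_comm h.isOpen (smoothOn_fderiv_apply h.isOpen h.smooth_X
    (contDiffOn_const (c := (Pi.single k 1 : Coord)))) hx, h2] at h1
  have hR : (fun l => riemann (inducedMetric ε X) l k i j x) =
      (fun l => pderiv i (christoffel (inducedMetric ε X) l j k) x +
        ∑ m, christoffel (inducedMetric ε X) l i m x * christoffel (inducedMetric ε X) m j k x) -
      (fun l => pderiv j (christoffel (inducedMetric ε X) l i k) x +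
        ∑ m, christoffel (inducedMetric ε X) l j m x *
          christoffel (inducedMetric ε X) m i k x) := by
    funext l
    simp only [riemann, Pi.sub_apply, Finset.sum_sub_distrib]
    ring
  rw [hR, map_sub, eta_sub_left]
  linarith

lemma secondFF_eq_sum_left {x : Coord} (hx : x ∈ U) (V W : Coord) :
    secondFF ε X ξ x V W = ∑ i, V i * secondFF ε X ξ x (Pi.single i 1) W := by
  have e1 : ∀ V, secondFF ε X ξ x V W = - eta ε (fderiv ℝ ξ x V) (fderiv ℝ X x W) := fun V => by
    rw [h.eta_fderiv_normal hx, neg_neg]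
  simp only [e1]
  rw [fderiv_eq_sum ξ x V, eta_sum_left]
  simp [eta_smul_left]

lemma eta_curvatureOp {x : Coord} (hx : x ∈ U) (V W Z Y : Coord) :
    eta ε (fderiv ℝ X x (curvatureOp (inducedMetric ε X) x V W Z)) (fderiv ℝ X x Y) =
      ε * (secondFF ε X ξ x W Z * secondFF ε X ξ x V Y
        - secondFF ε X ξ x V Z * secondFF ε X ξ x W Y) := by
  have hc : curvatureOp (inducedMetric ε X) x V W Z = ∑ k, ∑ i, ∑ j, (V i * W j * Z k) •
      (fun l => riemann (inducedMetric ε X) l k i j x) := by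
    funext l
    simp only [curvatureOp, Finset.sum_apply, Pi.smul_apply, smul_eq_mul]
    exact Finset.sum_congr rfl fun _ _ => Finset.sum_congr rfl fun _ _ =>
      Finset.sum_congr rfl fun _ _ => by ring
  have e1 : ∀ V W : Coord, secondFF ε X ξ x V W =
      ∑ i, ∑ j, V i * W j * secondFF ε X ξ x (Pi.single i 1) (Pi.single j 1) := by
    intro V W
    rw [h.secondFF_eq_sum_left hx V W]
    refine Finset.sum_congr rfl fun i _ => ?_
    rw [h.secondFF_comm hx, h.secondFF_eq_sum_left hx W, Finset.mul_sum]
    refine Finset.sum_congr rfl fun j _ => ?_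
    rw [h.secondFF_comm hx]; ring
  rw [hc]
  simp only [map_sum, map_smul, eta_sum_left, eta_smul_left, h.eta_riemann hx]
  rw [e1 W Z, e1 V Z, h.secondFF_eq_sum_left hx V Y, h.secondFF_eq_sum_left hx W Y]
  simp only [Fin.sum_univ_four]
  ring

lemma riemann_eq {x : Coord} (hx : x ∈ U) (l k i j : Fin 4) :
    riemann (inducedMetric ε X) l k i j x = ∑ a, tetradSign a *
      (ε * (secondFF ε X ξ x (Pi.single j 1) (Pi.single k 1) *
        secondFF ε X ξ x (Pi.single i 1) (e a x)
        - secondFF ε X ξ x (Pi.single i 1) (Pi.single k 1) *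
          secondFF ε X ξ x (Pi.single j 1) (e a x))) * e a x l := by
  have := congrFun (h.tangent_eq_sum hx fun l => riemann (inducedMetric ε X) l k i j x) l
  simp only [pushFrame, h.eta_riemann hx] at this
  rw [this]
  simp [Finset.sum_apply]

lemma secondFF_frame {x : Coord} (hx : x ∈ U) (a b : Fin 4) :
    secondFF ε X ξ x (e a x) (e b x) = if a = b then κ a x * tetradSign a else 0 := by
  rw [h.principal x hx, h.orthonormal x hx]; simp

lemma secondFF_eq_sum {x : Coord} (hx : x ∈ U) (V W : Coord) :
    secondFF ε X ξ x V W = ∑ a, tetradSign a * κ a x * eta ε (fderiv ℝ X x V) (pushFrame X e a x)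
      * eta ε (fderiv ℝ X x W) (pushFrame X e a x) := by
  have e1 : ∀ V, secondFF ε X ξ x V W = - eta ε (fderiv ℝ ξ x V) (fderiv ℝ X x W) := fun V => by
    rw [h.eta_fderiv_normal hx, neg_neg]
  have := h.map_eq_sum hx (fderiv ℝ ξ x : Coord →ₗ[ℝ] Ambient) V
  simp only [ContinuousLinearMap.coe_coe, h.fderiv_normal_frame hx] at this
  rw [e1, this, eta_sum_left, ← Finset.sum_neg_distrib]
  refine Finset.sum_congr rfl fun a _ => ?_
  rw [eta_smul_left, eta_neg_left, eta_smul_left, eta_comm ε (pushFrame X e a x)]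
  ring

/-- A hypersurface is flat where its principal curvatures vanish. -/
lemma isFlatAt {x : Coord} (hx : x ∈ U) (h0 : ∀ a, κ a x = 0) :
    IsFlatAt (inducedMetric ε X) x := by
  intro l k i j
  rw [h.riemann_eq hx]
  simp [h.secondFF_eq_sum hx, h0]

/-- The signs of `e a` and `e b` each occur twice, once from the norms and once from `Ω`, so
timelike planes obey the same formula as spacelike ones. -/
lemma sectional_frame {x : Coord} (hx : x ∈ U) {a b : Fin 4} (hab : a ≠ b) :
    sectional (inducedMetric ε X) x (e a x) (e b x) = ε * (κ a x * κ b x) := by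
  simp only [sectional, inducedMetric_inner, h.eta_curvatureOp hx, h.secondFF_frame hx,
    h.orthonormal x hx, if_pos, hab, if_false]
  linear_combination (ε * κ a x * κ b x * tetradSign a * tetradSign a) * tetradSign_mul_self b
    + ε * κ a x * κ b x * tetradSign_mul_self a

lemma trace_secondFF {x : Coord} (hx : x ∈ U) :
    ∑ i, ∑ j, (inducedMetric ε X x)⁻¹ i j * secondFF ε X ξ x (Pi.single i 1) (Pi.single j 1) =
      ∑ a, κ a x := by
  have e1 : ∀ a, κ a x = tetradSign a *
      ∑ i, ∑ j, e a x i * e a x j * secondFF ε X ξ x (Pi.single i 1) (Pi.single j 1) := by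
    intro a
    have : secondFF ε X ξ x (e a x) (e a x) =
        ∑ i, ∑ j, e a x i * e a x j * secondFF ε X ξ x (Pi.single i 1) (Pi.single j 1) := by
      rw [h.secondFF_eq_sum_left hx]
      refine Finset.sum_congr rfl fun i _ => ?_
      rw [h.secondFF_comm hx, h.secondFF_eq_sum_left hx, Finset.mul_sum]
      refine Finset.sum_congr rfl fun j _ => ?_
      rw [h.secondFF_comm hx]; ring
    rw [← this, h.secondFF_frame hx, if_pos rfl]
    linear_combination (-κ a x) * tetradSign_mul_self a
  rw [Finset.sum_congr rfl fun a _ => e1 a]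
  simp only [h.inv_inducedMetric hx, Fin.sum_univ_four]
  ring

lemma eta_meanCurvature {x : Coord} (hx : x ∈ U) :
    eta ε (meanCurvature ε X ξ x) (meanCurvature ε X ξ x) = ε * (∑ a, κ a x) ^ 2 := by
  simp only [meanCurvature, h.trace_secondFF hx, eta_smul_left, eta_smul_right,
    h.unit_normal x hx]
  linear_combination (ε * (∑ a, κ a x) ^ 2) * h.sq_sign

lemma ricci_eq {x : Coord} (hx : x ∈ U) (k j : Fin 4) :
    ricci (inducedMetric ε X) k j x = ε *
      ((∑ a, κ a x) * secondFF ε X ξ x (Pi.single j 1) (Pi.single k 1)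
        - ∑ a, tetradSign a * κ a x ^ 2 *
          eta ε (fderiv ℝ X x (Pi.single j 1)) (pushFrame X e a x) *
          eta ε (fderiv ℝ X x (Pi.single k 1)) (pushFrame X e a x)) := by
  have e1 : ∀ a V, ∑ i, e a x i * secondFF ε X ξ x (Pi.single i 1) V =
      κ a x * eta ε (fderiv ℝ X x V) (pushFrame X e a x) := by
    intro a V
    rw [← h.secondFF_eq_sum_left hx, h.principal x hx, eta_comm]; rfl
  have e2 : ∀ a, eta ε (fderiv ℝ X x (e a x)) (pushFrame X e a x) = tetradSign a := fun a => by
    have := h.orthonormal x hx a a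
    rwa [if_pos rfl] at this
  have e3 : ∀ a, secondFF ε X ξ x (Pi.single j 1) (e a x) =
      κ a x * eta ε (fderiv ℝ X x (Pi.single j 1)) (pushFrame X e a x) := by
    intro a
    rw [h.secondFF_comm hx, h.principal x hx, eta_comm]; rfl
  have e4 : ricci (inducedMetric ε X) k j x = ∑ a, tetradSign a * ε *
      (secondFF ε X ξ x (Pi.single j 1) (Pi.single k 1) *
        (∑ i, e a x i * secondFF ε X ξ x (Pi.single i 1) (e a x))
      - secondFF ε X ξ x (Pi.single j 1) (e a x) *
        (∑ i, e a x i * secondFF ε X ξ x (Pi.single i 1) (Pi.single k 1))) := by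
    simp only [ricci, h.riemann_eq hx]
    rw [Finset.sum_comm]
    refine Finset.sum_congr rfl fun a _ => ?_
    simp only [Fin.sum_univ_four]
    ring
  rw [e4]
  simp only [e1, e2, e3]
  have := tetradSign_mul_self
  simp only [Fin.sum_univ_four]
  linear_combination ε * secondFF ε X ξ x (Pi.single j 1) (Pi.single k 1) *
    (κ 0 x * this 0 + κ 1 x * this 1 + κ 2 x * this 2 + κ 3 x * this 3)

end PrincipalFrame

namespace PrincipalFrame

variable {ε : ℝ} {U : Set Coord} {X ξ : Coord → Ambient} {e : Fin 4 → Coord → Coord}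
  {κ : Fin 4 → Coord → ℝ} (h : PrincipalFrame ε U X ξ e κ)
include h

/-- Reordering the vectors of a principal frame. -/
lemma perm (π : Equiv.Perm (Fin 4)) (hπ : ∀ a, tetradSign (π a) = tetradSign a) :
    PrincipalFrame ε U X ξ (e ∘ π) (κ ∘ π) where
  sq_sign := h.sq_sign
  isOpen := h.isOpen
  smooth_X := h.smooth_X
  smooth_ξ := h.smooth_ξ
  smooth_e a := h.smooth_e (π a)
  normal := h.normal
  unit_normal := h.unit_normal
  orthonormal x hx a b := by
    simp only [Function.comp_apply, h.orthonormal x hx, EmbeddingLike.apply_eq_iff_eq, hπ]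
  principal x hx a := h.principal x hx (π a)

/-! ### The Einstein tensor -/

/-- The eigenvalues of the Ricci tensor. -/
lemma ricci_eq_sum {x : Coord} (hx : x ∈ U) (k j : Fin 4) :
    ricci (inducedMetric ε X) k j x = ∑ a, tetradSign a * (ε * ((∑ b, κ b x) * κ a x - κ a x ^ 2)) *
      eta ε (fderiv ℝ X x (Pi.single k 1)) (pushFrame X e a x) *
      eta ε (fderiv ℝ X x (Pi.single j 1)) (pushFrame X e a x) := by
  rw [h.ricci_eq hx, h.secondFF_eq_sum hx]
  simp only [Fin.sum_univ_four]
  ring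

lemma ricciScalar_eq {x : Coord} (hx : x ∈ U) :
    ricciScalar (inducedMetric ε X) x = ∑ a, ε * ((∑ b, κ b x) * κ a x - κ a x ^ 2) := by
  have key : ∀ a, ∑ k, ∑ j, (inducedMetric ε X x)⁻¹ k j *
      (eta ε (fderiv ℝ X x (Pi.single k 1)) (pushFrame X e a x) *
      eta ε (fderiv ℝ X x (Pi.single j 1)) (pushFrame X e a x)) = tetradSign a := by
    intro a
    have h1 : ∀ k, ∑ j, (inducedMetric ε X x)⁻¹ k j *
        (eta ε (fderiv ℝ X x (Pi.single k 1)) (pushFrame X e a x) *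
        eta ε (fderiv ℝ X x (Pi.single j 1)) (pushFrame X e a x)) =
        e a x k * eta ε (fderiv ℝ X x (Pi.single k 1)) (pushFrame X e a x) := by
      intro k
      have := h.sum_inv_mul_eta hx k (pushFrame X e a x)
      simp only [h.eta_pushFrame hx, mul_ite, mul_zero, ite_mul, zero_mul, Finset.sum_ite_eq,
        Finset.mem_univ, if_true, tetradSign_mul_self, one_mul] at this
      rw [← this, Finset.sum_mul]
      refine Finset.sum_congr rfl fun j _ => ?_
      rw [eta_comm ε (fderiv ℝ X x (Pi.single j 1))]
      ring
    simp only [h1]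
    have h2 := h.eta_pushFrame hx a a
    rw [if_pos rfl] at h2
    nth_rewrite 1 [pushFrame] at h2
    rw [fderiv_eq_sum X x (e a x), eta_sum_left] at h2
    simpa only [eta_smul_left] using h2
  have h3 : ricciScalar (inducedMetric ε X) x = ∑ a, tetradSign a *
      (ε * ((∑ b, κ b x) * κ a x - κ a x ^ 2)) * ∑ k, ∑ j, (inducedMetric ε X x)⁻¹ k j *
      (eta ε (fderiv ℝ X x (Pi.single k 1)) (pushFrame X e a x) *
      eta ε (fderiv ℝ X x (Pi.single j 1)) (pushFrame X e a x)) := by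
    simp only [ricciScalar, h.ricci_eq_sum hx, Finset.mul_sum]
    rw [Finset.sum_congr rfl fun k _ => Finset.sum_comm, Finset.sum_comm]
    exact Finset.sum_congr rfl fun _ _ => Finset.sum_congr rfl fun _ _ =>
      Finset.sum_congr rfl fun _ _ => by ring
  rw [h3]
  refine Finset.sum_congr rfl fun a _ => ?_
  rw [key]
  linear_combination (ε * ((∑ b, κ b x) * κ a x - κ a x ^ 2)) * tetradSign_mul_self a

/-- The curvatures sum to `6l`, so the Ricci eigenvalues are `5εl²` (three times) and `9εl²`, with
trace `24εl²`. Subtracting half the trace leaves `-7εl²` and `-3εl²`. -/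
lemma einstein_eq {x : Coord} (hx : x ∈ U) {l : ℝ} (h0 : κ 0 x = l) (h1 : κ 1 x = l)
    (h2 : κ 2 x = l) (h3 : κ 3 x = 3 * l) (i j : Fin 4) :
    einstein (inducedMetric ε X) i j x = -(ε * l ^ 2) *
      (7 * eta ε (fderiv ℝ X x (Pi.single i 1)) (fderiv ℝ X x (Pi.single j 1)) +
      4 * eta ε (fderiv ℝ X x (Pi.single i 1)) (pushFrame X e 3 x) *
        eta ε (fderiv ℝ X x (Pi.single j 1)) (pushFrame X e 3 x)) := by
  rw [einstein, h.ricciScalar_eq hx, h.ricci_eq_sum hx, inducedMetric_apply,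
    h.eta_eq_sum hx (fderiv ℝ X x (Pi.single i 1)) (fderiv ℝ X x (Pi.single j 1)), h.normal x hx]
  simp only [Fin.sum_univ_four, h0, h1, h2, h3]
  simp [tetradSign]
  ring

/-- The Einstein equations of a perfect fluid on a hypersurface with principal curvatures
`l, l, l, 3l`. -/
lemma isPerfectFluidAt_iff {x : Coord} (hx : x ∈ U) {l : ℝ} (hl : l ≠ 0) (h0 : κ 0 x = l)
    (h1 : κ 1 x = l) (h2 : κ 2 x = l) (h3 : κ 3 x = 3 * l) (K ρ p : ℝ) (V : Coord) :
    IsPerfectFluidAt (inducedMetric ε X) K ρ p V x ↔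
      (K * ρ = 3 * ε * l ^ 2 ∧ K * p = -7 * ε * l ^ 2 ∧ (V = e 3 x ∨ V = - e 3 x)) := by
  have s0 : tetradSign 0 = 1 := rfl
  have s1 : tetradSign 1 = 1 := rfl
  have s2 : tetradSign 2 = 1 := rfl
  have s3 : tetradSign 3 = -1 := rfl
  have hu : eta ε (fderiv ℝ X x (e 3 x)) (fderiv ℝ X x (e 3 x)) = -1 := by
    rw [h.orthonormal x hx, if_pos rfl, s3]
  rw [IsPerfectFluidAt, inducedMetric_inner]
  simp only [inducedMetric_lower, h.einstein_eq hx h0 h1 h2 h3]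
  simp only [inducedMetric_apply]
  constructor
  · rintro ⟨hV, hE⟩
    -- The coordinate equations are extended bilinearly so that they can be evaluated on the tetrad.
    have hF : ∀ Y Z : Coord, -(ε * l ^ 2) * (7 * eta ε (fderiv ℝ X x Y) (fderiv ℝ X x Z) +
        4 * eta ε (fderiv ℝ X x Y) (pushFrame X e 3 x) *
          eta ε (fderiv ℝ X x Z) (pushFrame X e 3 x)) =
        K * ((ρ + p) * eta ε (fderiv ℝ X x Y) (fderiv ℝ X x V) *
          eta ε (fderiv ℝ X x Z) (fderiv ℝ X x V) +
          p * eta ε (fderiv ℝ X x Y) (fderiv ℝ X x Z)) := by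
      intro Y Z
      have e1 : ∀ Y A, eta ε (fderiv ℝ X x Y) A =
          ∑ i, Y i * eta ε (fderiv ℝ X x (Pi.single i 1)) A := by
        intro Y A
        rw [fderiv_eq_sum X x Y, eta_sum_left]
        exact Finset.sum_congr rfl fun _ _ => eta_smul_left _ _ _ _
      have e2 : eta ε (fderiv ℝ X x Y) (fderiv ℝ X x Z) = ∑ i, ∑ j, Y i * Z j *
          eta ε (fderiv ℝ X x (Pi.single i 1)) (fderiv ℝ X x (Pi.single j 1)) := by
        rw [e1 Y]
        refine Finset.sum_congr rfl fun i _ => ?_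
        rw [eta_comm, e1 Z, Finset.mul_sum]
        refine Finset.sum_congr rfl fun j _ => ?_
        rw [eta_comm]; ring
      have e3 : ∑ i, ∑ j, Y i * Z j * (-(ε * l ^ 2) *
          (7 * eta ε (fderiv ℝ X x (Pi.single i 1)) (fderiv ℝ X x (Pi.single j 1)) +
          4 * eta ε (fderiv ℝ X x (Pi.single i 1)) (pushFrame X e 3 x) *
          eta ε (fderiv ℝ X x (Pi.single j 1)) (pushFrame X e 3 x))) = ∑ i, ∑ j, Y i * Z j *
          (K * ((ρ + p) * eta ε (fderiv ℝ X x (Pi.single i 1)) (fderiv ℝ X x V) *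
          eta ε (fderiv ℝ X x (Pi.single j 1)) (fderiv ℝ X x V) +
          p * eta ε (fderiv ℝ X x (Pi.single i 1)) (fderiv ℝ X x (Pi.single j 1)))) :=
        Finset.sum_congr rfl fun i _ => Finset.sum_congr rfl fun j _ => by rw [hE i j]
      rw [e2, e1 Y, e1 Z, e1 Y (fderiv ℝ X x V), e1 Z (fderiv ℝ X x V)]
      simp only [Fin.sum_univ_four] at e3 ⊢
      linear_combination e3
    have hv : ∀ a, eta ε (fderiv ℝ X x (e a x)) (fderiv ℝ X x V) =
        eta ε (fderiv ℝ X x V) (pushFrame X e a x) := fun a => eta_comm _ _ _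
    have hFab : ∀ a b, _ := fun a b => hF (e a x) (e b x)
    have ho : ∀ a b, eta ε (fderiv ℝ X x (e a x)) (pushFrame X e b x) =
      if a = b then tetradSign a else 0 := h.orthonormal x hx
    simp only [hv, h.orthonormal x hx, ho] at hFab
    have hVs := h.tangent_eq_sum hx V
    rw [h.eta_eq_sum hx (fderiv ℝ X x V) (fderiv ℝ X x V), h.normal x hx] at hV
    simp only [Fin.sum_univ_four, s0, s1, s2, s3] at hV hVs
    have f00 := hFab 0 0
    have f03 := hFab 0 3
    have f13 := hFab 1 3
    have f23 := hFab 2 3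
    have f33 := hFab 3 3
    simp only [Fin.reduceEq, if_true, if_false, s0, s3] at f00 f03 f13 f23 f33
    set V0 := eta ε (fderiv ℝ X x V) (pushFrame X e 0 x)
    set V1 := eta ε (fderiv ℝ X x V) (pushFrame X e 1 x)
    set V2 := eta ε (fderiv ℝ X x V) (pushFrame X e 2 x)
    set V3 := eta ε (fderiv ℝ X x V) (pushFrame X e 3 x)
    have hV3 : V3 ≠ 0 := by
      intro h0
      rw [h0] at hV
      nlinarith [sq_nonneg V0, sq_nonneg V1, sq_nonneg V2]
    have hεl : ε * l ^ 2 ≠ 0 := mul_ne_zero h.sign_ne_zero (pow_ne_zero 2 hl)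
    -- Adding the `00` and `33` equations eliminates `p` and gives `-4εl² = K(ρ+p)(V0² + V3²)`. The
    -- mixed equations with index `3` then kill the spatial components of `V`, because `V3 ≠ 0`.
    have hD : K * (ρ + p) ≠ 0 := by
      intro hD
      refine hεl ?_
      linear_combination -f00 / 4 - f33 / 4 - ((V0 * V0 + V3 * V3) / 4) * hD
    have hz : ∀ t : ℝ, K * (ρ + p) * t * V3 = 0 → t = 0 := by
      intro t ht
      rcases mul_eq_zero.1 ht with h1 | h1
      · exact (mul_eq_zero.1 h1).resolve_left hD
      · exact absurd h1 hV3
    have z0 : V0 = 0 := hz _ (by linear_combination -f03)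
    have z1 : V1 = 0 := hz _ (by linear_combination -f13)
    have z2 : V2 = 0 := hz _ (by linear_combination -f23)
    rw [z0, z1, z2] at hV hVs
    rw [z0] at f00
    have hV32 : V3 * V3 = 1 := by linear_combination -hV
    refine ⟨?_, by linear_combination -f00, ?_⟩
    · linear_combination -f33 - K * (ρ + p) * hV32
    · rcases mul_self_eq_one_iff.1 hV32 with h1 | h1
      · right; rw [hVs, h1]; simp
      · left; rw [hVs, h1]; simp
  · rintro ⟨hρ, hp, rfl | rfl⟩
    · refine ⟨hu, fun i j => ?_⟩
      simp only [pushFrame]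
      linear_combination (-eta ε (fderiv ℝ X x (Pi.single i 1)) (fderiv ℝ X x (e 3 x)) *
        eta ε (fderiv ℝ X x (Pi.single j 1)) (fderiv ℝ X x (e 3 x))) * (hρ + hp) -
        eta ε (fderiv ℝ X x (Pi.single i 1)) (fderiv ℝ X x (Pi.single j 1)) * hp
    · simp only [map_neg, eta_neg_right, eta_neg_left, neg_neg]
      refine ⟨hu, fun i j => ?_⟩
      simp only [pushFrame]
      linear_combination (-eta ε (fderiv ℝ X x (Pi.single i 1)) (fderiv ℝ X x (e 3 x)) *
        eta ε (fderiv ℝ X x (Pi.single j 1)) (fderiv ℝ X x (e 3 x))) * (hρ + hp) -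
        eta ε (fderiv ℝ X x (Pi.single i 1)) (fderiv ℝ X x (Pi.single j 1)) * hp

end PrincipalFrame

/-! ### Ideal tetrads -/

namespace IsIdealTetrad

variable {ε : ℝ} {U : Set Coord} {X ξ : Coord → Ambient} {w v q u : Coord → Coord}
  {μ lam ν σ : Coord → ℝ}

lemma principalFrame (h : IsIdealTetrad ε U X ξ w v q u μ lam ν σ) (hε : ε = 1 ∨ ε = -1)
    (hU : IsOpen U) : PrincipalFrame ε U X ξ ![w, v, q, u] ![σ, lam, ν, μ] := by
  have hev : ∀ (a : Fin 4) x, (![w, v, q, u] : Fin 4 → Coord → Coord) a x =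
      (![w x, v x, q x, u x] : Fin 4 → Coord) a := by
    intro a x; fin_cases a <;> rfl
  have ho : ∀ x ∈ U, ∀ a b, eta ε (fderiv ℝ X x ((![w, v, q, u] : Fin 4 → Coord → Coord) a x))
      (fderiv ℝ X x ((![w, v, q, u] : Fin 4 → Coord → Coord) b x)) =
      if a = b then tetradSign a else 0 := by
    intro x hx a b
    rw [hev, hev, ← inducedMetric_inner, h.orthonormal x hx]
    rfl
  refine ⟨?_, hU, h.smooth_X, h.smooth_ξ, ?_, h.normal, h.unit_normal, ho, ?_⟩
  · rcases hε with rfl | rfl <;> norm_num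
  · intro a
    fin_cases a
    exacts [h.smooth_w, h.smooth_v, h.smooth_q, h.smooth_u]
  · intro x hx a V
    have o := ho x hx
    simp only [Fin.forall_fin_succ, Matrix.cons_val_zero, Matrix.cons_val_succ, Fin.isValue,
      IsEmpty.forall_iff, and_true, Fin.reduceSucc, Fin.reduceEq, if_true, if_false] at o
    obtain ⟨⟨o00, o01, o02, o03⟩, ⟨o10, o11, o12, o13⟩, ⟨o20, o21, o22, o23⟩,
      ⟨o30, o31, o32, o33⟩⟩ := o
    rw [h.diagonal x hx]
    simp only [inducedMetric_inner]
    fin_cases a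
    · simp [o00, o10, o20, o30, tetradSign]
    · simp [o01, o11, o21, o31, tetradSign]
    · simp [o02, o12, o22, o32, tetradSign]
    · simp [o03, o13, o23, o33, tetradSign]

/-- The equality in the curvature inequality determines one of the principal curvatures. -/
lemma sigma_eq (h : IsIdealTetrad ε U X ξ w v q u μ lam ν σ) (hε : ε = 1 ∨ ε = -1)
    (hU : IsOpen U) {x : Coord} (hx : x ∈ U) : σ x = μ x - lam x - ν x := by
  have hF := h.principalFrame hε hU
  have hc := h.chen_equality x hx
  have hs : ∀ {a b : Fin 4}, a ≠ b → _ := fun {a b} hab => hF.sectional_frame hx hab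
  have s01 := hs (a := 0) (b := 1) (by decide)
  have s02 := hs (a := 0) (b := 2) (by decide)
  have s03 := hs (a := 0) (b := 3) (by decide)
  have s12 := hs (a := 1) (b := 2) (by decide)
  have s13 := hs (a := 1) (b := 3) (by decide)
  have s23 := hs (a := 2) (b := 3) (by decide)
  simp at s01 s02 s03 s12 s13 s23
  rw [hF.eta_meanCurvature hx] at hc
  simp [sectionScalar, Fin.sum_univ_four, Fin.sum_univ_three, chenConst, s01, s02, s03, s12, s13,
    s23] at hc
  -- Only planes containing `u` survive in `R - τ(L)`, so the equality reads `ε(s + μ)² = 4εμs` with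
  -- `s = σ + λ + ν`, a perfect square.
  have hsq : ε * (σ x + lam x + ν x - μ x) ^ 2 = 0 := by
    linear_combination hc
  have := (mul_eq_zero.1 hsq).resolve_left hF.sign_ne_zero
  have := pow_eq_zero_iff (two_ne_zero) |>.1 this
  linarith

/-- With `σ = μ - λ - ν` the curvature in ratio `-3` sits on `w`, `v` and `q` respectively in the
three alternatives; a transposition moves it to index `0`. -/
lemma eq_zero_of_ratio (h : IsIdealTetrad ε U X ξ w v q u μ lam ν σ) (hε : ε = 1 ∨ ε = -1)
    (hU : IsOpen U)
    (hr : (∀ x ∈ U, μ x = -lam x ∧ ν x = lam x) ∨ (∀ x ∈ U, μ x = -ν x ∧ lam x = -3 * ν x) ∨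
      (∀ x ∈ U, μ x = -lam x ∧ ν x = -3 * lam x)) {x : Coord} (hx : x ∈ U) :
    μ x = 0 ∧ lam x = 0 ∧ ν x = 0 ∧ IsFlatAt (inducedMetric ε X) x := by
  have hF := h.principalFrame hε hU
  have hσ := fun y (hy : y ∈ U) => h.sigma_eq hε hU hy
  have hz : μ x = 0 ∧ lam x = 0 ∧ ν x = 0 := by
    rcases hr with hr | hr | hr
    · have := hF.curvature_eq_zero_of_ratio
        (fun y hy => by simp [hσ y hy, hr y hy]; ring)
        (fun y hy => by simp [hr y hy]) (fun y hy => by simp [hr y hy]) hx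
      simp at this
      simp [hr x hx, this]
    · have p2 : Equiv.swap (0 : Fin 4) 1 2 = 2 := by decide
      have p3 : Equiv.swap (0 : Fin 4) 1 3 = 3 := by decide
      have := (hF.perm (Equiv.swap 0 1) (by
          intro a; fin_cases a <;> simp [p2, p3, tetradSign])).curvature_eq_zero_of_ratio
        (fun y hy => by simp [hσ y hy, hr y hy]; ring)
        (fun y hy => by simp [p2, hσ y hy, hr y hy]; ring)
        (fun y hy => by simp [p3, hσ y hy, hr y hy]; ring) hx
      simp [hσ x hx, hr x hx] at this
      have hν : ν x = 0 := by linarith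
      simp [hr x hx, hν]
    · have p1 : Equiv.swap (0 : Fin 4) 2 1 = 1 := by decide
      have p3 : Equiv.swap (0 : Fin 4) 2 3 = 3 := by decide
      have := (hF.perm (Equiv.swap 0 2) (by
          intro a; fin_cases a <;> simp [p1, p3, tetradSign])).curvature_eq_zero_of_ratio
        (fun y hy => by simp [p1, hr y hy])
        (fun y hy => by simp [p1, hσ y hy, hr y hy]; ring)
        (fun y hy => by simp [p1, p3, hr y hy]) hx
      simp [p1] at this
      simp [hr x hx, this]
  refine ⟨hz.1, hz.2.1, hz.2.2, hF.isFlatAt hx fun a => ?_⟩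
  fin_cases a <;> simp [hz, hσ x hx]

end IsIdealTetrad

/-! ### The dual form of the time direction, and propagation of zeros on connected sets -/

/-- The `1`-form `-g(N, ·)` dual to the tangent vector field with ambient image `N`. -/
def timeForm (ε : ℝ) (X N : Coord → Ambient) (x : Coord) : Coord →L[ℝ] ℝ :=
  ∑ i, (-eta ε (fderiv ℝ X x (Pi.single i 1)) (N x)) • ContinuousLinearMap.proj (R := ℝ) i

lemma timeForm_apply (ε : ℝ) (X N : Coord → Ambient) (x V : Coord) :
    timeForm ε X N x V = - eta ε (fderiv ℝ X x V) (N x) := by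
  rw [fderiv_eq_sum X x V, eta_sum_left]
  simp [timeForm, eta_smul_left, mul_comm]

lemma smoothOn_timeForm {ε : ℝ} {X N : Coord → Ambient} {U : Set Coord} (hU : IsOpen U)
    (hX : ContDiffOn ℝ ∞ X U) (hN : ContDiffOn ℝ ∞ N U) :
    ContDiffOn ℝ ∞ (timeForm ε X N) U := by
  refine ContDiffOn.sum fun i _ => ?_
  exact (contDiffOn_eta (smoothOn_fderiv_apply hU hX contDiffOn_const) hN ε).neg.smul
    contDiffOn_const

/-- A function on a connected open set whose differential is a multiple of itself vanishes
identically or nowhere. -/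
lemma eq_zero_or_ne_zero_of_fderiv_eq_smul {E : Type*} [NormedAddCommGroup E] [NormedSpace ℝ E]
    {U : Set E} (hU : IsOpen U) (hUc : IsPreconnected U) {f : E → ℝ} {L : E → E →L[ℝ] ℝ}
    (hf : DifferentiableOn ℝ f U) (hL : ContinuousOn L U)
    (hfL : ∀ x ∈ U, fderiv ℝ f x = f x • L x) :
    (∀ x ∈ U, f x = 0) ∨ ∀ x ∈ U, f x ≠ 0 := by
  have hopen : IsOpen (U ∩ {x | f x = 0}) := by
    rw [isOpen_iff_mem_nhds]
    rintro x ⟨hx, hx0⟩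
    obtain ⟨δ, hδ, hball⟩ := Metric.isOpen_iff.1 hU x hx
    filter_upwards [Metric.ball_mem_nhds x hδ] with y hy
    refine ⟨hball hy, ?_⟩
    -- On the segment from a zero `x` to `y`, `f` solves a linear homogeneous ODE with bounded
    -- coefficient, so a Grönwall estimate keeps it zero. Hence the zero set is open in `U`.
    set γ : ℝ → E := fun s => x + s • (y - x) with hγ
    have hγU : ∀ s ∈ Set.Icc (0 : ℝ) 1, γ s ∈ U := by
      intro s hs
      apply hball
      rw [Metric.mem_ball, dist_eq_norm] at hy ⊢
      have : γ s - x = s • (y - x) := by simp [hγ]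
      rw [this, norm_smul, Real.norm_of_nonneg hs.1]
      calc s * ‖y - x‖ ≤ 1 * ‖y - x‖ := by gcongr; exact hs.2
        _ < δ := by rw [one_mul]; exact hy
    have hγd : ∀ s, HasDerivAt γ (y - x) s := fun s => by
      have := ((hasDerivAt_id s).smul_const (y - x)).const_add x
      rwa [one_smul] at this
    have hγc : Continuous γ := by fun_prop
    obtain ⟨K, hK⟩ := isCompact_Icc.exists_bound_of_continuousOn
      ((hL.comp hγc.continuousOn hγU).clm_apply (continuousOn_const (c := y - x)))
    have hder : ∀ s ∈ Set.Icc (0 : ℝ) 1,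
        HasDerivAt (fun s => f (γ s)) (f (γ s) * L (γ s) (y - x)) s := by
      intro s hs
      have h1 := ((hf _ (hγU s hs)).differentiableAt (hU.mem_nhds (hγU s hs))).hasFDerivAt
      have h2 := h1.comp_hasDerivAt s (hγd s)
      rw [hfL _ (hγU s hs)] at h2
      exact h2
    have hz := eq_zero_of_abs_deriv_le_mul_abs_self_of_eq_zero_right (f := fun s => f (γ s))
      (K := K) (a := 0) (b := 1) (fun s hs => (hder s hs).continuousAt.continuousWithinAt)
      (fun s hs => (hder s ⟨hs.1, hs.2.le⟩).hasDerivWithinAt)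
      (by simpa [hγ] using hx0)
      (fun s hs => by
        rw [norm_mul, mul_comm]
        exact mul_le_mul_of_nonneg_right (hK s ⟨hs.1, hs.2.le⟩) (norm_nonneg _))
    simpa [hγ] using hz 1 (by simp)
  have hopen' : IsOpen (U ∩ {x | f x ≠ 0}) :=
    hf.continuousOn.isOpen_inter_preimage hU isOpen_compl_singleton
  rcases hUc.subset_or_subset hopen hopen'
    (Set.disjoint_left.2 fun x hx hx' => hx'.2 hx.2)
    (fun x hx => by
      by_cases h0 : f x = 0
      · exact Or.inl ⟨hx, h0⟩
      · exact Or.inr ⟨hx, h0⟩) with h | h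
  · exact Or.inl fun x hx => (h hx).2
  · exact Or.inr fun x hx => (h hx).2

namespace PrincipalFrame

variable {ε : ℝ} {U : Set Coord} {X ξ : Coord → Ambient} {e : Fin 4 → Coord → Coord}
  {κ : Fin 4 → Coord → ℝ}

/-! ### Hypersurfaces with principal curvatures in the ratio `1 : 1 : 1 : 3` -/

section Umbilic

variable (h : PrincipalFrame ε U X ξ e κ) (hk : ∀ x ∈ U, ∀ i, i ≠ 3 → κ i x = κ 0 x)
  (h3 : ∀ x ∈ U, κ 3 x = 3 * κ 0 x)
include h hk

/-- A second spatial direction `j ≠ i` has the same principal curvature, so the left side of Codazzi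
vanishes. -/
lemma fderiv_curvature_spatial {x : Coord} (hx : x ∈ U) {i : Fin 4} (hi : i ≠ 3) :
    fderiv ℝ (κ 0) x (e i x) = 0 := by
  obtain ⟨j, hj, hji⟩ : ∃ j : Fin 4, j ≠ 3 ∧ i ≠ j := by
    by_cases h0 : i = 0
    · exact ⟨1, by decide, by rw [h0]; decide⟩
    · exact ⟨0, by decide, h0⟩
  have hc := h.codazzi_self hx hji
  rw [hk x hx i hi, hk x hx j hj, fderiv_eq_of_eqOn h.isOpen (fun y hy => hk y hy j hj) hx] at hc
  have : fderiv ℝ (κ 0) x (e i x) * tetradSign j = 0 := by linarith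
  exact (mul_eq_zero.1 this).resolve_right (tetradSign_ne_zero j)

include h3

lemma fderiv_curvature_time {x : Coord} (hx : x ∈ U) {i : Fin 4} (hi : i ≠ 3) :
    fderiv ℝ (κ 0) x (e 3 x) = 2 * κ 0 x * connCoeff ε X e i 3 i x := by
  have hc := h.codazzi_self hx hi.symm
  rw [hk x hx i hi, h3 x hx, fderiv_eq_of_eqOn h.isOpen (fun y hy => hk y hy i hi) hx] at hc
  have : tetradSign i = 1 := by fin_cases i <;> simp_all [tetradSign]
  rw [this] at hc
  linarith

/-- The differential is exhibited as a multiple of the function itself, the form needed for the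
dichotomy on connected sets. -/
lemma fderiv_curvature {x : Coord} (hx : x ∈ U) :
    fderiv ℝ (κ 0) x = κ 0 x •
      ((2 * connCoeff ε X e 0 3 0 x) • timeForm ε X (pushFrame X e 3) x) := by
  ext V
  have := h.map_eq_sum hx (fderiv ℝ (κ 0) x : Coord →ₗ[ℝ] ℝ) V
  simp only [ContinuousLinearMap.coe_coe, Fin.sum_univ_four,
    h.fderiv_curvature_spatial hk hx (show (0 : Fin 4) ≠ 3 by decide),
    h.fderiv_curvature_spatial hk hx (show (1 : Fin 4) ≠ 3 by decide),
    h.fderiv_curvature_spatial hk hx (show (2 : Fin 4) ≠ 3 by decide),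
    h.fderiv_curvature_time hk h3 hx (show (0 : Fin 4) ≠ 3 by decide)] at this
  rw [this]
  simp [timeForm_apply, tetradSign]
  ring

lemma curvature_eq_zero_or_ne_zero (hUc : IsPreconnected U) :
    (∀ x ∈ U, κ 0 x = 0) ∨ ∀ x ∈ U, κ 0 x ≠ 0 :=
  eq_zero_or_ne_zero_of_fderiv_eq_smul h.isOpen hUc
    ((h.smooth_curvature 0).differentiableOn (by simp))
    (((contDiffOn_const.mul (h.smooth_connCoeff 0 3 0)).smul
      (smoothOn_timeForm h.isOpen h.smooth_X (h.smooth_pushFrame 3))).continuousOn)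
    (fun _ hx => h.fderiv_curvature hk h3 hx)

/-- The derivative of the unit normal. -/
lemma fderiv_normal {x : Coord} (hx : x ∈ U) (V : Coord) :
    fderiv ℝ ξ x V = -(κ 0 x • fderiv ℝ X x V)
      - (2 * κ 0 x * timeForm ε X (pushFrame X e 3) x V) • pushFrame X e 3 x := by
  have s0 : tetradSign 0 = 1 := rfl
  have s1 : tetradSign 1 = 1 := rfl
  have s2 : tetradSign 2 = 1 := rfl
  have s3 : tetradSign 3 = -1 := rfl
  have e1 := h.map_eq_sum hx (fderiv ℝ ξ x : Coord →ₗ[ℝ] Ambient) V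
  have e2 := h.map_eq_sum hx (fderiv ℝ X x : Coord →ₗ[ℝ] Ambient) V
  simp only [ContinuousLinearMap.coe_coe, h.fderiv_normal_frame hx, Fin.sum_univ_four, h3 x hx,
    hk x hx 1 (by decide), hk x hx 2 (by decide), s0, s1, s2, s3] at e1 e2
  rw [e1, timeForm_apply]
  conv_rhs => rw [sub_eq_add_neg]; enter [1, 1]; rw [e2]
  simp only [pushFrame]
  module

variable (hne : ∀ x ∈ U, κ 0 x ≠ 0)
include hne

lemma connCoeff_spatial_time {x : Coord} (hx : x ∈ U) {i : Fin 4} (hi : i ≠ 3) :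
    connCoeff ε X e i 3 i x = connCoeff ε X e 0 3 0 x := by
  have h1 := h.fderiv_curvature_time hk h3 hx hi
  rw [h.fderiv_curvature_time hk h3 hx (show (0 : Fin 4) ≠ 3 by decide)] at h1
  exact (mul_left_cancel₀ (mul_ne_zero two_ne_zero (hne x hx)) h1).symm

lemma connCoeff_spatial_time_spatial {x : Coord} (hx : x ∈ U) {i j : Fin 4} (hi : i ≠ 3)
    (hj : j ≠ 3) (hij : i ≠ j) : connCoeff ε X e i 3 j x = 0 := by
  have h1 := h.codazzi_distinct hx hij hj.symm
  rw [hk x hx i hi, hk x hx j hj, h3 x hx] at h1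
  have h2 : κ 0 x * connCoeff ε X e i 3 j x = 0 := by linarith
  exact (mul_eq_zero.1 h2).resolve_left (hne x hx)

lemma connCoeff_time_time {x : Coord} (hx : x ∈ U) (i : Fin 4) :
    connCoeff ε X e 3 3 i x = 0 := by
  by_cases hi : i = 3
  · rw [hi]; exact h.connCoeff_self hx 3 3
  have h1 := h.codazzi_self hx hi
  have h2 := differentiableAt_of_smoothOn h.isOpen (h.smooth_curvature 0) hx
  rw [hk x hx i hi, h3 x hx, fderiv_eq_of_eqOn h.isOpen h3 hx, fderiv_const_mul h2, smul_apply,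
    h.fderiv_curvature_spatial hk hx hi] at h1
  have h3 : κ 0 x * connCoeff ε X e 3 i 3 x = 0 := by
    rw [smul_zero] at h1; linarith
  rw [h.connCoeff_antisymm hx, (mul_eq_zero.1 h3).resolve_left (hne x hx), neg_zero]

/-- `u` is geodesic, and its spatial derivative is pure expansion, without shear or rotation. -/
lemma connCoeff_eq {x : Coord} (hx : x ∈ U) :
    (∀ i, connCoeff ε X e 3 3 i x = 0) ∧
    connCoeff ε X e 1 3 1 x = connCoeff ε X e 0 3 0 x ∧
    connCoeff ε X e 2 3 2 x = connCoeff ε X e 0 3 0 x ∧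
    connCoeff ε X e 0 3 1 x = 0 ∧ connCoeff ε X e 0 3 2 x = 0 ∧
    connCoeff ε X e 1 3 0 x = 0 ∧ connCoeff ε X e 1 3 2 x = 0 ∧
    connCoeff ε X e 2 3 0 x = 0 ∧ connCoeff ε X e 2 3 1 x = 0 := by
  refine ⟨h.connCoeff_time_time hk h3 hne hx, h.connCoeff_spatial_time hk h3 hne hx (by decide),
    h.connCoeff_spatial_time hk h3 hne hx (by decide), ?_, ?_, ?_, ?_, ?_, ?_⟩ <;>
  exact h.connCoeff_spatial_time_spatial hk h3 hne hx (by decide) (by decide) (by decide)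

/-- The differential of the expansion `θ`. -/
lemma fderiv_expansion {x : Coord} (hx : x ∈ U) :
    fderiv ℝ (connCoeff ε X e 0 3 0) x =
      (3 * ε * κ 0 x ^ 2 - connCoeff ε X e 0 3 0 x ^ 2) • timeForm ε X (pushFrame X e 3) x := by
  have hc := fun y (hy : y ∈ U) => h.connCoeff_eq hk h3 hne hy
  have dzero : ∀ {a b c : Fin 4}, (∀ y ∈ U, connCoeff ε X e a b c y = 0) →
      fderiv ℝ (connCoeff ε X e a b c) x = 0 := by
    intro a b c hz
    rw [fderiv_eq_of_eqOn h.isOpen hz hx]; simp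
  have d330 := dzero fun y hy => (hc y hy).1 0
  have d131 : fderiv ℝ (connCoeff ε X e 1 3 1) x = fderiv ℝ (connCoeff ε X e 0 3 0) x :=
    fderiv_eq_of_eqOn h.isOpen (fun y hy => (hc y hy).2.1) hx
  have d031 := dzero fun y hy => (hc y hy).2.2.2.1
  have d130 := dzero fun y hy => (hc y hy).2.2.2.2.2.1
  have d230 := dzero fun y hy => (hc y hy).2.2.2.2.2.2.2.1
  obtain ⟨c33, c131, c232, c031, c032, c130, c132, c230, c231⟩ := hc x hx
  have s0 : tetradSign 0 = 1 := rfl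
  have s1 : tetradSign 1 = 1 := rfl
  have s2 : tetradSign 2 = 1 := rfl
  have s3 : tetradSign 3 = -1 := rfl
  have w := h.connCoeff_self hx
  have an := h.connCoeff_antisymm hx
  -- `3030` is the Raychaudhuri-type equation for the time derivative. A spatial derivative of `θ`
  -- needs a Gauss equation with two different spatial indices; along `e 0` this means reading `θ`
  -- as the coefficient `131`.
  have g3030 := h.gauss hx 3 0 3 0
  have g0131 := h.gauss hx 0 1 3 1
  have g1030 := h.gauss hx 1 0 3 0
  have g2030 := h.gauss hx 2 0 3 0
  simp only [Fin.sum_univ_four, d330, d131, d031, d130, d230, c33, c131, c232, c031, c032, c130,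
    c132, c230, c231, s0, s1, s2, s3, w, zero_apply, h3 x hx, Fin.reduceEq, if_true, if_false]
    at g3030 g0131 g1030 g2030
  have D0 : fderiv ℝ (connCoeff ε X e 0 3 0) x (e 0 x) = 0 := by
    rw [an 1 0 1] at g0131; linarith
  have D1 : fderiv ℝ (connCoeff ε X e 0 3 0) x (e 1 x) = 0 := by
    rw [an 0 1 0] at g1030; linarith
  have D2 : fderiv ℝ (connCoeff ε X e 0 3 0) x (e 2 x) = 0 := by
    rw [an 0 2 0] at g2030; linarith
  have D3 : fderiv ℝ (connCoeff ε X e 0 3 0) x (e 3 x) =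
      3 * ε * κ 0 x ^ 2 - connCoeff ε X e 0 3 0 x ^ 2 := by linarith
  ext V
  have := h.map_eq_sum hx (fderiv ℝ (connCoeff ε X e 0 3 0) x : Coord →ₗ[ℝ] ℝ) V
  simp only [ContinuousLinearMap.coe_coe, Fin.sum_univ_four, D0, D1, D2, D3] at this
  rw [this]
  simp [timeForm_apply, tetradSign]
  ring

/-- The derivative of the unit timelike field in the ambient space. -/
lemma fderiv_time {x : Coord} (hx : x ∈ U) (V : Coord) :
    fderiv ℝ (pushFrame X e 3) x V = connCoeff ε X e 0 3 0 x •
      (fderiv ℝ X x V - timeForm ε X (pushFrame X e 3) x V • pushFrame X e 3 x)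
      - (3 * ε * κ 0 x * timeForm ε X (pushFrame X e 3) x V) • ξ x := by
  obtain ⟨c33, c131, c232, c031, c032, c130, c132, c230, c231⟩ := h.connCoeff_eq hk h3 hne hx
  have w := h.connCoeff_self hx
  have s0 : tetradSign 0 = 1 := rfl
  have s1 : tetradSign 1 = 1 := rfl
  have s2 : tetradSign 2 = 1 := rfl
  have s3 : tetradSign 3 = -1 := rfl
  -- Spatial derivatives of `E_3` are `θ E_a`. The derivative along `u` is purely normal, with
  -- `Ω(u,u) = -3l`, and the factor `ε` comes from `η(ξ,ξ) = ε`.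
  have hcomp : ∀ a, fderiv ℝ (pushFrame X e 3) x (e a x) =
      if a = 3 then -((3 * ε * κ 0 x) • ξ x) else
        connCoeff ε X e 0 3 0 x • pushFrame X e a x := by
    intro a
    refine h.ambient_ext hx (fun b => ?_) ?_
    · change connCoeff ε X e a 3 b x = _
      split_ifs with ha
      · subst ha
        rw [c33, eta_neg_left, eta_smul_left, h.eta_normal_pushFrame hx]; simp
      · rw [eta_smul_left, h.eta_pushFrame hx]
        fin_cases a <;> fin_cases b <;> simp_all
    · rw [h.eta_fderiv_pushFrame_normal hx]
      split_ifs with ha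
      · subst ha
        rw [eta_neg_left, eta_smul_left, h.unit_normal x hx, h3 x hx, s3]
        linear_combination (3 * κ 0 x) * h.sq_sign
      · rw [eta_smul_left, h.eta_pushFrame_normal hx]; simp
  have e1 := h.map_eq_sum hx (fderiv ℝ (pushFrame X e 3) x : Coord →ₗ[ℝ] Ambient) V
  have e2 := h.map_eq_sum hx (fderiv ℝ X x : Coord →ₗ[ℝ] Ambient) V
  simp only [ContinuousLinearMap.coe_coe, hcomp, Fin.sum_univ_four, Fin.reduceEq, if_true,
    if_false, s0, s1, s2, s3] at e1 e2
  rw [e1, timeForm_apply]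
  conv_rhs => rw [sub_eq_add_neg, sub_eq_add_neg]; enter [1, 2, 1]; rw [e2]
  simp only [pushFrame]
  module

end Umbilic

end PrincipalFrame

/-! ### Local coordinates -/

/-- The inverse function theorem, with a ball as the range of the chart. -/
lemma exists_chart_of_injective_fderiv {E : Type*} [NormedAddCommGroup E] [NormedSpace ℝ E]
    [FiniteDimensional ℝ E] {N : Set E} (hN : IsOpen N) {F : E → E} (hF : ContDiffOn ℝ ∞ F N)
    (hinj : ∀ x ∈ N, Function.Injective (fderiv ℝ F x)) {x₀ : E} (hx₀ : x₀ ∈ N) :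
    ∃ (Φ : OpenPartialHomeomorph E E) (δ : ℝ), (∀ x, Φ x = F x) ∧ x₀ ∈ Φ.source ∧
      Φ.source ⊆ N ∧ 0 < δ ∧ Φ.target = Metric.ball (F x₀) δ ∧ ContDiffOn ℝ ∞ Φ.symm Φ.target := by
  have : CompleteSpace E := FiniteDimensional.complete ℝ E
  have hequiv : ∀ x ∈ N, ∃ L : E ≃L[ℝ] E, HasFDerivAt F (L : E →L[ℝ] E) x := by
    intro x hx
    refine ⟨(LinearMap.linearEquivOfInjective (fderiv ℝ F x : E →ₗ[ℝ] E)
      (hinj x hx) rfl).toContinuousLinearEquiv, ?_⟩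
    convert (differentiableAt_of_smoothOn hN hF hx).hasFDerivAt using 1
    ext v
    rfl
  obtain ⟨L, hL⟩ := hequiv x₀ hx₀
  have hc := hF.contDiffAt (hN.mem_nhds hx₀)
  set Φ₀ := hc.toOpenPartialHomeomorph F hL (by simp) with hΦ₀
  have hΦ₀F : ∀ x, Φ₀ x = F x := fun x => rfl
  have hx₀s : x₀ ∈ Φ₀.source := hc.mem_toOpenPartialHomeomorph_source hL (by simp)
  set Φ₁ := Φ₀.restrOpen N hN
  have hx₁ : x₀ ∈ Φ₁.source := ⟨hx₀s, hx₀⟩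
  obtain ⟨δ, hδ, hball⟩ := Metric.isOpen_iff.1 Φ₁.open_target (F x₀) (Φ₁.map_source hx₁)
  -- Restricting the inverse makes the target exactly a ball; its convexity is needed to recover
  -- functions of the last coordinate.
  set Φ := (Φ₁.symm.restrOpen (Metric.ball (F x₀) δ) Metric.isOpen_ball).symm
  have htarget : Φ.target = Metric.ball (F x₀) δ := by
    change Φ₁.target ∩ Metric.ball (F x₀) δ = _
    exact Set.inter_eq_right.2 hball
  have hsource : ∀ x ∈ Φ.source, x ∈ Φ₁.source := by
    intro x hx
    have h1 := Φ.map_source hx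
    rw [htarget] at h1
    have h2 := Φ₁.symm.map_source (hball h1)
    have h3 : Φ₁.symm (Φ x) = x := Φ.left_inv hx
    change Φ₁.symm (Φ x) ∈ Φ₁.source at h2
    rwa [h3] at h2
  have hmem : x₀ ∈ Φ.source := by
    have h1 : F x₀ ∈ Φ.target := by rw [htarget]; exact Metric.mem_ball_self hδ
    have h2 := Φ.map_target h1
    have h3 : Φ.symm (F x₀) = x₀ := Φ₁.left_inv hx₁
    rwa [h3] at h2
  refine ⟨Φ, δ, fun x => rfl, hmem, fun x hx => (hsource x hx).2, hδ, htarget, ?_⟩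
  intro z hz
  have hzN : Φ.symm z ∈ N := (hsource _ (Φ.map_target hz)).2
  obtain ⟨L', hL'⟩ := hequiv _ hzN
  exact (Φ.contDiffAt_symm hz hL' (hF.contDiffAt (hN.mem_nhds hzN))).contDiffWithinAt

/-- A function whose differential is a multiple of that of the last coordinate of a chart onto a
ball is a function of this coordinate. -/
lemma exists_eq_comp_coord {N : Set Coord} (hN : IsOpen N) {F : Coord → Coord}
    (hF : ContDiffOn ℝ ∞ F N) {Φ : OpenPartialHomeomorph Coord Coord} (hΦF : ∀ x, Φ x = F x)
    (hΦN : Φ.source ⊆ N) {z₀ : Coord} {δ : ℝ} (hδ : Φ.target = Metric.ball z₀ δ)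
    (hsymm : ContDiffOn ℝ ∞ Φ.symm Φ.target) {A b : Coord → ℝ} (hA : ContDiffOn ℝ ∞ A N)
    (hdA : ∀ x ∈ N, ∀ V, fderiv ℝ A x V = b x * fderiv ℝ F x V 3) :
    ∃ a : ℝ → ℝ, (∀ z ∈ Φ.target, ContDiffAt ℝ ∞ a (z 3)) ∧
      ∀ x ∈ Φ.source, a (Φ x 3) = A x ∧ deriv a (Φ x 3) = b x := by
  have hsN : ∀ z ∈ Φ.target, Φ.symm z ∈ N := fun z hz => hΦN (Φ.map_target hz)
  set G : Coord → ℝ := fun z => A (Φ.symm z) with hG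
  have hGc : ContDiffOn ℝ ∞ G Φ.target := hA.comp hsymm hsN
  have hGd : ∀ z ∈ Φ.target, ∀ V, fderiv ℝ G z V = b (Φ.symm z) * V 3 := by
    intro z hz V
    have h1 := (differentiableAt_of_smoothOn hN hA (hsN z hz)).hasFDerivAt
    have h2 := (differentiableAt_of_smoothOn Φ.open_target hsymm hz).hasFDerivAt
    have h3 := (differentiableAt_of_smoothOn hN hF (hsN z hz)).hasFDerivAt
    have h4 : HasFDerivAt (fun z => F (Φ.symm z)) (ContinuousLinearMap.id ℝ Coord) z := by
      refine (hasFDerivAt_id z).congr_of_eventuallyEq ?_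
      filter_upwards [Φ.open_target.mem_nhds hz] with z' hz'
      rw [← hΦF]; exact Φ.right_inv hz'
    have h5 := (h3.comp z h2).unique h4
    have h6 := (h1.comp z h2).fderiv
    change fderiv ℝ G z = _ at h6
    rw [h6, ContinuousLinearMap.comp_apply, hdA _ (hsN z hz),
      ← ContinuousLinearMap.comp_apply, h5]
    rfl
  have hline : ∀ (z : Coord) (τ : ℝ), (z + (τ - z 3) • (Pi.single 3 1 : Coord)) 3 = τ := by
    intro z τ; simp
  -- By the mean value theorem on the convex target, `G` takes equal values at points with the same
  -- last coordinate.
  have hGeq : ∀ z ∈ Φ.target, ∀ z' ∈ Φ.target, z 3 = z' 3 → G z = G z' := by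
    intro z hz z' hz' hzz
    obtain ⟨p, hp, hp'⟩ := domain_mvt (f := G) (f' := fderiv ℝ G) (s := Φ.target)
      (fun y hy => (differentiableAt_of_smoothOn Φ.open_target hGc hy).hasFDerivAt.hasFDerivWithinAt)
      (by rw [hδ]; exact convex_ball _ _) hz' hz
    have hpt : p ∈ Φ.target := by
      rw [hδ] at hz hz' ⊢
      exact (convex_ball z₀ δ).segment_subset hz' hz hp
    rw [hGd p hpt, Pi.sub_apply, hzz, sub_self, mul_zero] at hp'
    linarith
  -- Projecting a point of the ball to the line through its centre in the last coordinate direction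
  -- does not leave the ball, since the norm is the sup norm. So `a` can be defined along this
  -- single line.
  have hmem : ∀ z ∈ Φ.target, (z₀ + (z 3 - z₀ 3) • (Pi.single 3 1 : Coord)) ∈ Φ.target := by
    intro z hz
    rw [hδ, Metric.mem_ball] at hz ⊢
    refine lt_of_le_of_lt ?_ hz
    rw [dist_eq_norm, dist_eq_norm, add_sub_cancel_left, norm_smul]
    have h1 : ‖(Pi.single 3 1 : Coord)‖ ≤ 1 := by
      rw [pi_norm_le_iff_of_nonneg zero_le_one]
      intro i
      by_cases hi : i = 3
      · subst hi; simp
      · simp [hi]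
    calc ‖z 3 - z₀ 3‖ * ‖(Pi.single 3 1 : Coord)‖ ≤ ‖z 3 - z₀ 3‖ * 1 := by gcongr
      _ = ‖(z - z₀) 3‖ := by simp
      _ ≤ ‖z - z₀‖ := norm_le_pi_norm _ 3
  refine ⟨fun τ => G (z₀ + (τ - z₀ 3) • (Pi.single 3 1 : Coord)), ?_, ?_⟩
  · intro z hz
    have h1 := hGc.contDiffAt (Φ.open_target.mem_nhds (hmem z hz))
    have h2 : ContDiffAt ℝ ∞ (fun τ : ℝ => z₀ + (τ - z₀ 3) • (Pi.single 3 1 : Coord)) (z 3) := by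
      fun_prop
    exact ContDiffAt.comp (g := G) (z 3) h1 h2
  · intro x hx
    have hz := Φ.map_source hx
    set z := Φ x with hzdef
    have hxz : Φ.symm z = x := Φ.left_inv hx
    have hev : (fun τ => G (z₀ + (τ - z₀ 3) • (Pi.single 3 1 : Coord))) =ᶠ[nhds (z 3)]
        fun τ => G (z + (τ - z 3) • (Pi.single 3 1 : Coord)) := by
      have hcont : ContinuousAt (fun τ : ℝ => z + (τ - z 3) • (Pi.single 3 1 : Coord)) (z 3) := by
        fun_prop
      have hnh : Φ.target ∈ nhds (z + (z 3 - z 3) • (Pi.single 3 1 : Coord)) := by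
        rw [sub_self, zero_smul, add_zero]; exact Φ.open_target.mem_nhds hz
      filter_upwards [hcont.preimage_mem_nhds hnh] with τ hτ
      have hm := hmem _ hτ
      beta_reduce at hm
      rw [hline] at hm
      exact hGeq _ hm _ hτ (by rw [hline, hline])
    constructor
    · have := hev.eq_of_nhds
      simp only [sub_self, zero_smul, add_zero] at this
      beta_reduce
      rw [this, hG]; simp only [hxz]
    · rw [hev.deriv_eq]
      have h1 : HasDerivAt (fun τ : ℝ => z + (τ - z 3) • (Pi.single 3 1 : Coord))
          (Pi.single 3 1 : Coord) (z 3) := by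
        have := (((hasDerivAt_id (z 3)).sub_const (z 3)).smul_const
          (Pi.single 3 1 : Coord)).const_add z
        rwa [one_smul] at this
      have h2 : HasFDerivAt G (fderiv ℝ G z) (z + (z 3 - z 3) • (Pi.single 3 1 : Coord)) := by
        rw [sub_self, zero_smul, add_zero]
        exact (differentiableAt_of_smoothOn Φ.open_target hGc hz).hasFDerivAt
      have h3 := (h2.comp_hasDerivAt (z 3) h1).deriv
      change deriv (fun τ => G (z + (τ - z 3) • (Pi.single 3 1 : Coord))) (z 3) = _ at h3
      rw [h3, hGd z hz, hxz]
      simp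

/-! ### Polar coordinates on the spaces of constant curvature -/

/-- The derivative of `Σ(·, k)`. -/
def rwCos (k : ℤ) (r : ℝ) : ℝ :=
  if k = 1 then Real.cos r else if k = 0 then 1 else Real.cosh r

/-- The primitive of `Σ(·, k)` that vanishes at `0`. -/
def rwHeight (k : ℤ) (r : ℝ) : ℝ :=
  if k = 1 then 1 - Real.cos r else if k = 0 then r ^ 2 / 2 else Real.cosh r - 1

section Polar

variable {k : ℤ}

lemma hasDerivAt_rwSigma (k : ℤ) (r : ℝ) : HasDerivAt (rwSigma k) (rwCos k r) r := by
  unfold rwSigma rwCos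
  split_ifs
  · exact Real.hasDerivAt_sin r
  · exact hasDerivAt_id r
  · exact Real.hasDerivAt_sinh r

lemma hasDerivAt_rwHeight (k : ℤ) (r : ℝ) : HasDerivAt (rwHeight k) (rwSigma k r) r := by
  unfold rwSigma rwHeight
  split_ifs
  · simpa using (Real.hasDerivAt_cos r).const_sub 1
  · exact ((hasDerivAt_pow 2 r).div_const 2).congr_deriv (by norm_num)
  · simpa using (Real.hasDerivAt_cosh r).sub_const 1

lemma contDiff_rwSigma (k : ℤ) : ContDiff ℝ ∞ (rwSigma k) := by
  unfold rwSigma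
  split_ifs
  · exact Real.contDiff_sin
  · exact contDiff_id
  · exact Real.contDiff_sinh

lemma contDiff_rwHeight (k : ℤ) : ContDiff ℝ ∞ (rwHeight k) := by
  unfold rwHeight
  split_ifs
  · exact contDiff_const.sub Real.contDiff_cos
  · exact (contDiff_id.pow 2).div_const 2
  · exact Real.contDiff_cosh.sub contDiff_const

lemma rwCos_sq (hk : k = 1 ∨ k = 0 ∨ k = -1) (r : ℝ) :
    rwCos k r ^ 2 + k * rwSigma k r ^ 2 = 1 := by
  rcases hk with rfl | rfl | rfl <;> simp [rwCos, rwSigma]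
  linarith [Real.cosh_sq_sub_sinh_sq r]

lemma rwCos_eq (hk : k = 1 ∨ k = 0 ∨ k = -1) (r : ℝ) :
    rwCos k r = 1 - k * rwHeight k r := by
  rcases hk with rfl | rfl | rfl <;> simp [rwCos, rwHeight]

/-- This is the equation of the model quadric `|y|² + k T² = 2T`: a sphere, a paraboloid or a
hyperboloid through the origin, with `|y| = Σ` and `T` the height. -/
lemma rwSigma_sq (hk : k = 1 ∨ k = 0 ∨ k = -1) (r : ℝ) :
    rwSigma k r ^ 2 + k * rwHeight k r ^ 2 = 2 * rwHeight k r := by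
  rcases hk with rfl | rfl | rfl <;> simp [rwSigma, rwHeight]
  · linarith [Real.sin_sq_add_cos_sq r]
  · ring
  · linarith [Real.cosh_sq_sub_sinh_sq r]

lemma rwSigma_one_pos (k : ℤ) : 0 < rwSigma k 1 := by
  unfold rwSigma
  split_ifs
  · exact Real.sin_pos_of_pos_of_lt_pi one_pos (by linarith [Real.pi_gt_three])
  · exact one_pos
  · exact Real.sinh_pos_iff.2 one_pos

/-- A smooth local inverse of `rwHeight` near the radius `1`. -/
lemma exists_inverse_rwHeight (k : ℤ) : ∃ (ρ : ℝ → ℝ) (D : Set ℝ), IsOpen D ∧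
    rwHeight k 1 ∈ D ∧ ContDiffOn ℝ ∞ ρ D ∧ ∀ s ∈ D, rwHeight k (ρ s) = s ∧
      0 < rwSigma k (ρ s) ∧ 0 < ρ s ∧ ρ s < Real.pi := by
  have hstrict : HasStrictDerivAt (rwHeight k) (rwSigma k 1) 1 :=
    (contDiff_rwHeight k).contDiffAt.hasStrictDerivAt' (hasDerivAt_rwHeight k 1) (by simp)
  have hne := (rwSigma_one_pos k).ne'
  have hs := hstrict.hasStrictFDerivAt_equiv hne
  set Ψ := hs.toOpenPartialHomeomorph (rwHeight k)
  have hΨ : ∀ r, Ψ r = rwHeight k r := fun r => rfl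
  have h1 : (1 : ℝ) ∈ Ψ.source := hs.mem_toOpenPartialHomeomorph_source
  -- The domain is cut down so that radii stay in `(0, π)`, where also `Σ` is positive.
  have hW : IsOpen {r : ℝ | 0 < rwSigma k r ∧ 0 < r ∧ r < Real.pi} :=
    (isOpen_lt continuous_const (contDiff_rwSigma k).continuous).inter
      ((isOpen_lt continuous_const continuous_id).inter (isOpen_lt continuous_id continuous_const))
  refine ⟨Ψ.symm, Ψ.target ∩ Ψ.symm ⁻¹' {r : ℝ | 0 < rwSigma k r ∧ 0 < r ∧ r < Real.pi},
    Ψ.isOpen_inter_preimage_symm hW, ⟨Ψ.map_source h1, ?_⟩, ?_, ?_⟩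
  · have : Ψ.symm (rwHeight k 1) = 1 := Ψ.left_inv h1
    rw [Set.mem_preimage, this]
    exact ⟨rwSigma_one_pos k, one_pos, by linarith [Real.pi_gt_three]⟩
  · rintro s ⟨hs1, hs2⟩
    exact (Ψ.contDiffAt_symm_deriv hs2.1.ne' hs1 (hasDerivAt_rwHeight k _)
      (contDiff_rwHeight k).contDiffAt).contDiffWithinAt
  · rintro s ⟨hs1, hs2⟩
    exact ⟨Ψ.right_inv hs1, hs2⟩

/-- Polar coordinates of a point of the model space of constant curvature. -/
lemma exists_polar {E : Type*} [NormedAddCommGroup E] [NormedSpace ℝ E] {B : Set E}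
    (hB : IsOpen B) (hk : k = 1 ∨ k = 0 ∨ k = -1) {y : Fin 3 → E → ℝ} {T : E → ℝ}
    (hy : ∀ i, ContDiffOn ℝ ∞ (y i) B) (hT : ContDiffOn ℝ ∞ T B)
    (hq : ∀ x ∈ B, y 0 x ^ 2 + y 1 x ^ 2 + y 2 x ^ 2 + k * T x ^ 2 = 2 * T x) {x₀ : E}
    (hx₀ : x₀ ∈ B) (hy₁ : 0 < y 1 x₀) (hT₀ : T x₀ = rwHeight k 1) :
    ∃ (N : Set E) (r φ ψ : E → ℝ), IsOpen N ∧ x₀ ∈ N ∧ N ⊆ B ∧ ContDiffOn ℝ ∞ r N ∧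
      ContDiffOn ℝ ∞ φ N ∧ ContDiffOn ℝ ∞ ψ N ∧ ∀ x ∈ N, 0 < r x ∧ r x < Real.pi ∧
      0 < φ x ∧ φ x < Real.pi ∧ 0 < rwSigma k (r x) ∧ 0 < Real.cos (ψ x) ∧
      T x = rwHeight k (r x) ∧ y 0 x = rwSigma k (r x) * Real.cos (φ x) ∧
      y 1 x = rwSigma k (r x) * (Real.sin (φ x) * Real.cos (ψ x)) ∧
      y 2 x = rwSigma k (r x) * (Real.sin (φ x) * Real.sin (ψ x)) := by
  obtain ⟨ρ, D, hD, hD1, hρ, hρD⟩ := exists_inverse_rwHeight k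
  -- `y 1 > 0` keeps the points off the polar axis `φ = 0, π` and in the half-space `cos ψ > 0`,
  -- where arccosine and arcsine are smooth and recover the angles.
  set N : Set E := (B ∩ T ⁻¹' D) ∩ (B ∩ y 1 ⁻¹' Set.Ioi 0)
  have hN : IsOpen N := (hT.continuousOn.isOpen_inter_preimage hB hD).inter
    ((hy 1).continuousOn.isOpen_inter_preimage hB isOpen_Ioi)
  have hNB : N ⊆ B := fun x hx => hx.1.1
  set r : E → ℝ := fun x => ρ (T x) with hr
  set φ : E → ℝ := fun x => Real.arccos (y 0 x / rwSigma k (r x)) with hφ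
  set ψ : E → ℝ := fun x => Real.arcsin (y 2 x / (rwSigma k (r x) * Real.sin (φ x))) with hψ
  have key : ∀ x ∈ N, 0 < rwSigma k (r x) ∧ T x = rwHeight k (r x) ∧
      y 0 x ^ 2 + y 1 x ^ 2 + y 2 x ^ 2 = rwSigma k (r x) ^ 2 ∧ 0 < y 1 x := by
    intro x hx
    obtain ⟨h1, h2, -⟩ := hρD (T x) hx.1.2
    refine ⟨h2, h1.symm, ?_, hx.2.2⟩
    have h3 := rwSigma_sq hk (r x)
    rw [h1] at h3
    linarith [hq x hx.1.1]
  have hlt : ∀ x ∈ N, -1 < y 0 x / rwSigma k (r x) ∧ y 0 x / rwSigma k (r x) < 1 := by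
    intro x hx
    obtain ⟨h1, -, h3, h4⟩ := key x hx
    have : |y 0 x / rwSigma k (r x)| < 1 := by
      rw [abs_div, abs_of_pos h1, div_lt_one h1]
      refine abs_lt_of_sq_lt_sq ?_ h1.le
      nlinarith [sq_nonneg (y 2 x)]
    exact abs_lt.1 this
  have hcos : ∀ x ∈ N, Real.cos (φ x) = y 0 x / rwSigma k (r x) := fun x hx =>
    Real.cos_arccos (hlt x hx).1.le (hlt x hx).2.le
  have hφr : ∀ x ∈ N, 0 < φ x ∧ φ x < Real.pi := fun x hx =>
    ⟨Real.arccos_pos.2 (hlt x hx).2, Real.arccos_lt_pi.2 (hlt x hx).1⟩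
  have hsin : ∀ x ∈ N, 0 < Real.sin (φ x) := fun x hx =>
    Real.sin_pos_of_pos_of_lt_pi (hφr x hx).1 (hφr x hx).2
  have hSs : ∀ x ∈ N, (rwSigma k (r x) * Real.sin (φ x)) ^ 2 = y 1 x ^ 2 + y 2 x ^ 2 := by
    intro x hx
    obtain ⟨h1, -, h3, -⟩ := key x hx
    have h5 : y 0 x = rwSigma k (r x) * Real.cos (φ x) := by
      rw [hcos x hx]; field_simp
    rw [h5] at h3
    linear_combination rwSigma k (r x) ^ 2 * Real.sin_sq_add_cos_sq (φ x) - h3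
  have hSpos : ∀ x ∈ N, 0 < rwSigma k (r x) * Real.sin (φ x) := fun x hx =>
    mul_pos (key x hx).1 (hsin x hx)
  have hlt' : ∀ x ∈ N, -1 < y 2 x / (rwSigma k (r x) * Real.sin (φ x)) ∧
      y 2 x / (rwSigma k (r x) * Real.sin (φ x)) < 1 := by
    intro x hx
    have h1 := hSpos x hx
    have : |y 2 x / (rwSigma k (r x) * Real.sin (φ x))| < 1 := by
      rw [abs_div, abs_of_pos h1, div_lt_one h1]
      refine abs_lt_of_sq_lt_sq ?_ h1.le
      rw [hSs x hx]
      nlinarith [(key x hx).2.2.2]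
    exact abs_lt.1 this
  have hrN : ContDiffOn ℝ ∞ r N := hρ.comp (hT.mono hNB) fun x hx => hx.1.2
  have hσN : ContDiffOn ℝ ∞ (fun x => rwSigma k (r x)) N := (contDiff_rwSigma k).comp_contDiffOn hrN
  have hφN : ContDiffOn ℝ ∞ φ N := by
    have h1 : ContDiffOn ℝ ∞ (fun x => y 0 x / rwSigma k (r x)) N :=
      ((hy 0).mono hNB).div hσN fun x hx => (key x hx).1.ne'
    intro x hx
    exact ContDiffAt.comp_contDiffWithinAt (g := Real.arccos) x
      (Real.contDiffAt_arccos (hlt x hx).1.ne' (hlt x hx).2.ne) (h1 x hx)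
  have hψN : ContDiffOn ℝ ∞ ψ N := by
    have h1 : ContDiffOn ℝ ∞ (fun x => y 2 x / (rwSigma k (r x) * Real.sin (φ x))) N :=
      ((hy 2).mono hNB).div (hσN.mul (Real.contDiff_sin.comp_contDiffOn hφN))
        fun x hx => (hSpos x hx).ne'
    intro x hx
    exact ContDiffAt.comp_contDiffWithinAt (g := Real.arcsin) x
      (Real.contDiffAt_arcsin (hlt' x hx).1.ne' (hlt' x hx).2.ne) (h1 x hx)
  refine ⟨N, r, φ, ψ, hN, ⟨⟨hx₀, by rw [Set.mem_preimage, hT₀]; exact hD1⟩, hx₀, hy₁⟩, hNB, hrN,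
    hφN, hψN, fun x hx => ?_⟩
  obtain ⟨k1, k2, -, k4⟩ := key x hx
  obtain ⟨-, -, r1, r2⟩ := hρD (T x) hx.1.2
  have hsψ : Real.sin (ψ x) = y 2 x / (rwSigma k (r x) * Real.sin (φ x)) :=
    Real.sin_arcsin (hlt' x hx).1.le (hlt' x hx).2.le
  have hcψ : 0 < Real.cos (ψ x) := Real.cos_pos_of_mem_Ioo
    ⟨Real.neg_pi_div_two_lt_arcsin.2 (hlt' x hx).1, Real.arcsin_lt_pi_div_two.2 (hlt' x hx).2⟩
  have h2 : y 2 x = rwSigma k (r x) * (Real.sin (φ x) * Real.sin (ψ x)) := by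
    have := (hSpos x hx).ne'
    rw [hsψ]
    have h5 := k1.ne'
    have h6 := (hsin x hx).ne'
    field_simp
  refine ⟨r1, r2, (hφr x hx).1, (hφr x hx).2, k1, hcψ, k2, ?_, ?_, h2⟩
  · rw [hcos x hx]; field_simp
  · refine (sq_eq_sq₀ k4.le ?_).1 ?_
    · rw [← mul_assoc]; exact (mul_pos (hSpos x hx) hcψ).le
    · have h3 := hSs x hx
      rw [h2] at h3
      linear_combination -h3 -
        (rwSigma k (r x) * Real.sin (φ x)) ^ 2 * Real.sin_sq_add_cos_sq (ψ x)

end Polar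

/-! ### Robertson-Walker charts -/

section Chart

variable {k : ℤ} {g : MetricField} {B : Set Coord} {y : Fin 3 → Coord → ℝ} {T t A b : Coord → ℝ}
  {u : Coord → Coord}

/-- A metric that is expressed by Cartesian coordinates `y` and a height `T` on the space of
constant curvature `k`, a time function `t` and a scale factor `A` is a Robertson-Walker
metric: the case of a base point at distance `1` from the pole. -/
lemma exists_isRobertsonWalkerChart_of_polar (hB : IsOpen B) (hk : k = 1 ∨ k = 0 ∨ k = -1)
    (hy : ∀ i, ContDiffOn ℝ ∞ (y i) B) (hT : ContDiffOn ℝ ∞ T B) (ht : ContDiffOn ℝ ∞ t B)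
    (hA : ContDiffOn ℝ ∞ A B) (hApos : ∀ x ∈ B, 0 < A x)
    (hq : ∀ x ∈ B, y 0 x ^ 2 + y 1 x ^ 2 + y 2 x ^ 2 + k * T x ^ 2 = 2 * T x)
    (hg : ∀ x ∈ B, ∀ V W, g.inner x V W = A x ^ 2 *
      (∑ i, fderiv ℝ (y i) x V * fderiv ℝ (y i) x W + k * (fderiv ℝ T x V * fderiv ℝ T x W))
      - fderiv ℝ t x V * fderiv ℝ t x W)
    (hnd : ∀ x ∈ B, ∀ V, (∀ W, g.inner x V W = 0) → V = 0)
    (hdA : ∀ x ∈ B, ∀ V, fderiv ℝ A x V = b x * fderiv ℝ t x V)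
    (huy : ∀ x ∈ B, ∀ i, fderiv ℝ (y i) x (u x) = 0) (huT : ∀ x ∈ B, fderiv ℝ T x (u x) = 0)
    (hut : ∀ x ∈ B, fderiv ℝ t x (u x) = 1) {x₀ : Coord}
    (hx₀ : x₀ ∈ B) (hy₁ : 0 < y 1 x₀) (hT₀ : T x₀ = rwHeight k 1) :
    ∃ (Φ : OpenPartialHomeomorph Coord Coord) (a : ℝ → ℝ), x₀ ∈ Φ.source ∧ Φ.source ⊆ B ∧
      IsRobertsonWalkerChart g k a Φ ∧ ∀ x ∈ Φ.source, fderiv ℝ Φ x (u x) = Pi.single 3 1 ∧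
        a (Φ x 3) = A x ∧ deriv a (Φ x 3) = b x := by
  obtain ⟨N, r, φ, ψ, hN, hxN, hNB, hr, hφ, hψ, hpol⟩ := exists_polar hB hk hy hT hq hx₀ hy₁ hT₀
  set F : Coord → Coord := fun x => ![r x, φ x, ψ x, t x] with hFdef
  have hFi : ∀ i, ContDiffOn ℝ ∞ (fun x => F x i) N := by
    intro i
    fin_cases i
    exacts [hr, hφ, hψ, ht.mono hNB]
  have hF : ContDiffOn ℝ ∞ F N := contDiffOn_pi.2 hFi
  have hFd : ∀ x ∈ N, ∀ V i, fderiv ℝ F x V i = fderiv ℝ (fun z => F z i) x V := by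
    intro x hx V i
    have h1 := (differentiableAt_of_smoothOn hN hF hx).hasFDerivAt
    have h2 := (hasFDerivAt_pi'.1 h1 i).fderiv
    rw [h2]; rfl
  have hF0 : ∀ x ∈ N, ∀ V, fderiv ℝ F x V 0 = fderiv ℝ r x V := fun x hx V => hFd x hx V 0
  have hF1 : ∀ x ∈ N, ∀ V, fderiv ℝ F x V 1 = fderiv ℝ φ x V := fun x hx V => hFd x hx V 1
  have hF2 : ∀ x ∈ N, ∀ V, fderiv ℝ F x V 2 = fderiv ℝ ψ x V := fun x hx V => hFd x hx V 2
  have hF3 : ∀ x ∈ N, ∀ V, fderiv ℝ F x V 3 = fderiv ℝ t x V := fun x hx V => hFd x hx V 3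
  have hder : ∀ x ∈ N, ∀ V,
      fderiv ℝ T x V = rwSigma k (r x) * fderiv ℝ r x V ∧
      fderiv ℝ (y 0) x V = rwCos k (r x) * Real.cos (φ x) * fderiv ℝ r x V
        - rwSigma k (r x) * Real.sin (φ x) * fderiv ℝ φ x V ∧
      fderiv ℝ (y 1) x V = rwCos k (r x) * Real.sin (φ x) * Real.cos (ψ x) * fderiv ℝ r x V
        + rwSigma k (r x) * Real.cos (φ x) * Real.cos (ψ x) * fderiv ℝ φ x V
        - rwSigma k (r x) * Real.sin (φ x) * Real.sin (ψ x) * fderiv ℝ ψ x V ∧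
      fderiv ℝ (y 2) x V = rwCos k (r x) * Real.sin (φ x) * Real.sin (ψ x) * fderiv ℝ r x V
        + rwSigma k (r x) * Real.cos (φ x) * Real.sin (ψ x) * fderiv ℝ φ x V
        + rwSigma k (r x) * Real.sin (φ x) * Real.cos (ψ x) * fderiv ℝ ψ x V := by
    intro x hx V
    have dr := (differentiableAt_of_smoothOn hN hr hx).hasFDerivAt
    have dφ := (differentiableAt_of_smoothOn hN hφ hx).hasFDerivAt
    have dψ := (differentiableAt_of_smoothOn hN hψ hx).hasFDerivAt
    have dS : HasFDerivAt (fun z => rwSigma k (r z)) (rwCos k (r x) • fderiv ℝ r x) x :=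
      (hasDerivAt_rwSigma k (r x)).comp_hasFDerivAt x dr
    have dH : HasFDerivAt (fun z => rwHeight k (r z)) (rwSigma k (r x) • fderiv ℝ r x) x :=
      (hasDerivAt_rwHeight k (r x)).comp_hasFDerivAt x dr
    refine ⟨?_, ?_, ?_, ?_⟩
    · rw [fderiv_eq_of_eqOn hN (fun z hz => (hpol z hz).2.2.2.2.2.2.1) hx,
        dH.fderiv]
      simp
    · rw [fderiv_eq_of_eqOn hN (fun z hz => (hpol z hz).2.2.2.2.2.2.2.1) hx,
        (dS.fun_mul dφ.cos).fderiv]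
      simp
      ring
    · rw [fderiv_eq_of_eqOn hN (fun z hz => (hpol z hz).2.2.2.2.2.2.2.2.1) hx,
        (dS.fun_mul (dφ.sin.fun_mul dψ.cos)).fderiv]
      simp
      ring
    · rw [fderiv_eq_of_eqOn hN (fun z hz => (hpol z hz).2.2.2.2.2.2.2.2.2) hx,
        (dS.fun_mul (dφ.sin.fun_mul dψ.sin)).fderiv]
      simp
      ring
  have hiso : ∀ x ∈ N, ∀ V W, g.inner x V W = A x ^ 2 * (fderiv ℝ r x V * fderiv ℝ r x W +
      rwSigma k (r x) ^ 2 * (fderiv ℝ φ x V * fderiv ℝ φ x W +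
        Real.sin (φ x) ^ 2 * (fderiv ℝ ψ x V * fderiv ℝ ψ x W)))
      - fderiv ℝ t x V * fderiv ℝ t x W := by
    intro x hx V W
    obtain ⟨v1, v2, v3, v4⟩ := hder x hx V
    obtain ⟨w1, w2, w3, w4⟩ := hder x hx W
    rw [hg x (hNB hx), Fin.sum_univ_three, v1, v2, v3, v4, w1, w2, w3, w4]
    have h1 := rwCos_sq hk (r x)
    have h2 := Real.sin_sq_add_cos_sq (φ x)
    have h3 := Real.sin_sq_add_cos_sq (ψ x)
    have h1' : rwCos k (r x) ^ 2 = 1 - k * rwSigma k (r x) ^ 2 := by linarith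
    have h2' : Real.cos (φ x) ^ 2 = 1 - Real.sin (φ x) ^ 2 := by linarith
    have h3' : Real.cos (ψ x) ^ 2 = 1 - Real.sin (ψ x) ^ 2 := by linarith
    ring_nf
    simp only [h1', h2', h3']
    ring
  -- A vector killed by the four differentials is `g`-orthogonal to everything by `hiso`, hence zero
  -- by nondegeneracy.
  have hinj : ∀ x ∈ N, Function.Injective (fderiv ℝ F x) := by
    intro x hx
    rw [injective_iff_map_eq_zero]
    intro V hV
    refine hnd x (hNB hx) V fun W => ?_
    rw [hiso x hx, ← hF0 x hx V, ← hF1 x hx V, ← hF2 x hx V, ← hF3 x hx V, hV]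
    simp
  obtain ⟨Φ, δ, hΦF, hxs, hsN, -, htar, hsymm⟩ := exists_chart_of_injective_fderiv hN hF hinj hxN
  have hΦ : (Φ : Coord → Coord) = F := funext hΦF
  obtain ⟨a, ha, haA⟩ := exists_eq_comp_coord hN hF hΦF hsN htar hsymm (hA.mono hNB)
    (b := b) (fun x hx V => by rw [hdA x (hNB hx), hF3 x hx])
  have htN : ∀ z ∈ Φ.target, ∃ x ∈ N, x ∈ Φ.source ∧ z = F x := fun z hz =>
    ⟨Φ.symm z, hsN (Φ.map_target hz), Φ.map_target hz, by rw [← hΦF, Φ.right_inv hz]⟩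
  refine ⟨Φ, a, hxs, hsN.trans hNB, ⟨?_, hsymm, ha, ?_, ?_, ?_, ?_⟩, ?_⟩
  · rw [hΦ]; exact hF.mono hsN
  · intro z hz
    obtain ⟨x, hx, hxs, rfl⟩ := htN z hz
    rw [← hΦF, (haA x hxs).1]
    exact hApos x (hNB hx)
  · intro z hz
    obtain ⟨x, hx, hxs, rfl⟩ := htN z hz
    exact ⟨(hpol x hx).1, fun _ => (hpol x hx).2.1⟩
  · intro z hz
    obtain ⟨x, hx, hxs, rfl⟩ := htN z hz
    exact ⟨(hpol x hx).2.2.1, (hpol x hx).2.2.2.1⟩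
  · intro x hxs V W
    have hx := hsN hxs
    rw [rwInner, (haA x hxs).1, hΦ, hiso x hx, hF0 x hx, hF0 x hx, hF1 x hx, hF1 x hx, hF2 x hx,
      hF2 x hx, hF3 x hx, hF3 x hx]
    rfl
  · intro x hxs
    have hx := hsN hxs
    refine ⟨?_, haA x hxs⟩
    obtain ⟨u1, u2, u3, u4⟩ := hder x hx (u x)
    obtain ⟨-, -, q1, q2, q3, q4, -⟩ := hpol x hx
    have hs := Real.sin_pos_of_pos_of_lt_pi q1 q2
    rw [huT x (hNB hx)] at u1
    have r0 : fderiv ℝ r x (u x) = 0 := (mul_eq_zero.1 u1.symm).resolve_left q3.ne'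
    rw [huy x (hNB hx), r0] at u2 u4
    have φ0 : fderiv ℝ φ x (u x) = 0 := by
      have : rwSigma k (r x) * Real.sin (φ x) * fderiv ℝ φ x (u x) = 0 := by linarith
      exact (mul_eq_zero.1 this).resolve_left (mul_pos q3 hs).ne'
    rw [φ0] at u4
    have ψ0 : fderiv ℝ ψ x (u x) = 0 := by
      have : rwSigma k (r x) * Real.sin (φ x) * Real.cos (ψ x) * fderiv ℝ ψ x (u x) = 0 := by
        linarith
      exact (mul_eq_zero.1 this).resolve_left (mul_pos (mul_pos q3 hs) q4).ne'
    rw [hΦ]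
    funext i
    fin_cases i
    · simpa using (hF0 x hx (u x)).trans r0
    · simpa using (hF1 x hx (u x)).trans φ0
    · simpa using (hF2 x hx (u x)).trans ψ0
    · simpa using (hF3 x hx (u x)).trans (hut x (hNB hx))

/-- A metric that is expressed by Cartesian coordinates `y` and a height `T` on the space of
constant curvature `k`, a time function `t` and a scale factor `A` is a Robertson-Walker
metric. -/
lemma exists_isRobertsonWalkerChart (hB : IsOpen B) (hk : k = 1 ∨ k = 0 ∨ k = -1)
    (hy : ∀ i, ContDiffOn ℝ ∞ (y i) B) (hT : ContDiffOn ℝ ∞ T B) (ht : ContDiffOn ℝ ∞ t B)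
    (hA : ContDiffOn ℝ ∞ A B) (hApos : ∀ x ∈ B, 0 < A x)
    (hq : ∀ x ∈ B, y 0 x ^ 2 + y 1 x ^ 2 + y 2 x ^ 2 + k * T x ^ 2 = 2 * T x)
    (hg : ∀ x ∈ B, ∀ V W, g.inner x V W = A x ^ 2 *
      (∑ i, fderiv ℝ (y i) x V * fderiv ℝ (y i) x W + k * (fderiv ℝ T x V * fderiv ℝ T x W))
      - fderiv ℝ t x V * fderiv ℝ t x W)
    (hnd : ∀ x ∈ B, ∀ V, (∀ W, g.inner x V W = 0) → V = 0)
    (hdA : ∀ x ∈ B, ∀ V, fderiv ℝ A x V = b x * fderiv ℝ t x V)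
    (huy : ∀ x ∈ B, ∀ i, fderiv ℝ (y i) x (u x) = 0) (huT : ∀ x ∈ B, fderiv ℝ T x (u x) = 0)
    (hut : ∀ x ∈ B, fderiv ℝ t x (u x) = 1) {x₀ : Coord}
    (hx₀ : x₀ ∈ B) (hy₀ : y 1 x₀ = 0) (hT₀ : T x₀ = 0) :
    ∃ (Φ : OpenPartialHomeomorph Coord Coord) (a : ℝ → ℝ), x₀ ∈ Φ.source ∧ Φ.source ⊆ B ∧
      IsRobertsonWalkerChart g k a Φ ∧ ∀ x ∈ Φ.source, fderiv ℝ Φ x (u x) = Pi.single 3 1 ∧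
        a (Φ x 3) = A x ∧ deriv a (Φ x 3) = b x := by
  set S := rwSigma k 1
  set C := rwCos k 1
  set H := rwHeight k 1
  have c1 : C ^ 2 + k * S ^ 2 = 1 := rwCos_sq hk 1
  have c2 : C = 1 - k * H := rwCos_eq hk 1
  have c3 : S ^ 2 + k * H ^ 2 = 2 * H := rwSigma_sq hk 1
  -- The base point is the pole, where polar coordinates are singular. A symmetry of the model in
  -- the `(y 1, T)` plane (rotation, translation or boost for `k = 1, 0, -1`) moves it to distance
  -- `1` from the pole.
  set y' : Fin 3 → Coord → ℝ := ![y 0, fun x => S * (1 - k * T x) + C * y 1 x, y 2] with hy'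
  set T' : Coord → ℝ := fun x => H + C * T x + S * y 1 x with hT'
  have dy' : ∀ x ∈ B, ∀ V, fderiv ℝ (y' 1) x V =
      -(S * k) * fderiv ℝ T x V + C * fderiv ℝ (y 1) x V := by
    intro x hx V
    have h1 := (differentiableAt_of_smoothOn hB hT hx).hasFDerivAt
    have h2 := (differentiableAt_of_smoothOn hB (hy 1) hx).hasFDerivAt
    have h3 := ((((h1.const_mul (k : ℝ)).const_sub 1).const_mul S).fun_add (h2.const_mul C)).fderiv
    change fderiv ℝ (y' 1) x = _ at h3
    rw [h3]
    simp
    ring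
  have dT' : ∀ x ∈ B, ∀ V, fderiv ℝ T' x V =
      C * fderiv ℝ T x V + S * fderiv ℝ (y 1) x V := by
    intro x hx V
    have h1 := (differentiableAt_of_smoothOn hB hT hx).hasFDerivAt
    have h2 := (differentiableAt_of_smoothOn hB (hy 1) hx).hasFDerivAt
    have h3 := (((h1.const_mul C).const_add H).fun_add (h2.const_mul S)).fderiv
    change fderiv ℝ T' x = _ at h3
    rw [h3]
    simp
  refine exists_isRobertsonWalkerChart_of_polar (y := y') (T := T') hB hk ?_ ?_ ht hA hApos ?_ ?_
    hnd hdA ?_ ?_ hut hx₀ ?_ ?_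
  · intro i
    fin_cases i
    · exact hy 0
    · exact (contDiffOn_const.mul (contDiffOn_const.sub (contDiffOn_const.mul hT))).add
        (contDiffOn_const.mul (hy 1))
    · exact hy 2
  · exact (contDiffOn_const.add (contDiffOn_const.mul hT)).add (contDiffOn_const.mul (hy 1))
  · intro x hx
    have h1 := hq x hx
    simp only [hy', hT', Matrix.cons_val_zero, Matrix.cons_val_one, Matrix.cons_val]
    linear_combination h1 + (y 1 x ^ 2 + k * T x ^ 2 - 2 * T x) * c1 + c3 +
      (2 * S * y 1 x + 2 * C * T x) * c2
  · intro x hx V W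
    rw [hg x hx, Fin.sum_univ_three, Fin.sum_univ_three, dy' x hx, dy' x hx, dT' x hx, dT' x hx]
    simp only [hy', Matrix.cons_val_zero, Matrix.cons_val]
    linear_combination (-A x ^ 2 * (fderiv ℝ (y 1) x V * fderiv ℝ (y 1) x W
      + k * fderiv ℝ T x V * fderiv ℝ T x W)) * c1
  · intro x hx i
    fin_cases i
    · exact huy x hx 0
    · change fderiv ℝ (y' 1) x (u x) = 0
      rw [dy' x hx, huy x hx, huT x hx]; ring
    · exact huy x hx 2
  · intro x hx
    rw [dT' x hx, huy x hx, huT x hx]; ring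
  · simp only [hy', Matrix.cons_val_one, Matrix.cons_val, hT₀, hy₀]
    have := rwSigma_one_pos k
    simpa using this
  · simp [hT', hT₀, hy₀, H]

end Chart

/-! ### Construction of the comoving coordinates in the ambient space -/

namespace PrincipalFrame

variable {ε : ℝ} {U : Set Coord} {X ξ : Coord → Ambient} {e : Fin 4 → Coord → Coord}
  {κ : Fin 4 → Coord → ℝ}

lemma metric_nondegenerate (h : PrincipalFrame ε U X ξ e κ) {x : Coord} (hx : x ∈ U) {V : Coord}
    (hV : ∀ W, (inducedMetric ε X).inner x V W = 0) : V = 0 := by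
  have h1 : ∀ a, eta ε (fderiv ℝ X x V) (pushFrame X e a x) = 0 := fun a => by
    rw [← hV (e a x), inducedMetric_inner]; rfl
  rw [h.tangent_eq_sum hx V]
  simp [h1]

section Umbilic

variable (h : PrincipalFrame ε U X ξ e κ) (hk : ∀ x ∈ U, ∀ i, i ≠ 3 → κ i x = κ 0 x)
  (h3 : ∀ x ∈ U, κ 3 x = 3 * κ 0 x) (hne : ∀ x ∈ U, κ 0 x ≠ 0)
include h hk h3 hne

/-- The spatial curvature and the scale of the principal curvature. -/
lemma exists_curvature_constants (hUc : IsPreconnected U) {x₀ : Coord} (hx₀ : x₀ ∈ U) :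
    ∃ k : ℤ, (k = 1 ∨ k = 0 ∨ k = -1) ∧ ∃ c : ℝ, c ≠ 0 ∧ ∀ x ∈ U, 0 < κ 0 x / c ∧
      (ε * κ 0 x ^ 2 - connCoeff ε X e 0 3 0 x ^ 2) * (κ 0 x / c) = k := by
  set θ := connCoeff ε X e 0 3 0 with hθ
  -- First integral of the system `dl = 2lθτ`, `dθ = (3εl² - θ²)τ`.
  set J : Coord → ℝ := fun x => (ε * κ 0 x ^ 2 - θ x ^ 2) * κ 0 x with hJ
  have hsl := h.smooth_curvature 0
  have hsθ := h.smooth_connCoeff 0 3 0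
  have hJs : ContDiffOn ℝ ∞ J U :=
    ((contDiffOn_const.mul (hsl.pow 2)).sub (hsθ.pow 2)).mul hsl
  have hconst : ∀ x ∈ U, J x = J x₀ := by
    intro x hx
    refine h.isOpen.is_const_of_fderiv_eq_zero hUc (hJs.differentiableOn (by simp)) ?_ hx hx₀
    intro z hz
    have dl := (differentiableAt_of_smoothOn h.isOpen hsl hz).hasFDerivAt
    have dθ := (differentiableAt_of_smoothOn h.isOpen hsθ hz).hasFDerivAt
    rw [h.fderiv_curvature hk h3 hz] at dl
    rw [h.fderiv_expansion hk h3 hne hz] at dθ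
    have := ((((dl.pow 2).const_mul ε).sub (dθ.pow 2)).mul dl).fderiv
    change fderiv ℝ J z = _ at this
    rw [this]
    ext V
    simp [← hθ]
    ring
  -- The nowhere vanishing `κ 0` has constant sign on the connected set, so one sign of `c` makes `κ
  -- 0 / c` positive everywhere.
  have hsame : ∀ x ∈ U, 0 < κ 0 x * κ 0 x₀ := by
    intro x hx
    by_contra hneg
    have hneg' : κ 0 x * κ 0 x₀ ≤ 0 := not_lt.1 hneg
    have hcont : ContinuousOn (fun z => κ 0 z * κ 0 x₀) U := hsl.continuousOn.mul continuousOn_const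
    obtain ⟨z, hz, hz0⟩ := hUc.intermediate_value hx hx₀ hcont ⟨hneg', mul_self_nonneg _⟩
    exact mul_ne_zero (hne z hz) (hne x₀ hx₀) hz0
  have hpos : ∀ x ∈ U, ∀ c, 0 < c * κ 0 x₀ → 0 < κ 0 x / c := by
    intro x hx c hc
    have hc0 : c ≠ 0 := fun h0 => by simp [h0] at hc
    have h1 := hsame x hx
    have h2 : 0 < (κ 0 x / c) * (c * κ 0 x₀) ^ 2 := by
      have : (κ 0 x / c) * (c * κ 0 x₀) ^ 2 = (κ 0 x * κ 0 x₀) * (c * κ 0 x₀) := by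
        field_simp
      rw [this]; positivity
    exact pos_of_mul_pos_left h2 (sq_nonneg _)
  have hval : ∀ x ∈ U, ∀ c, (ε * κ 0 x ^ 2 - θ x ^ 2) * (κ 0 x / c) = J x₀ / c := by
    intro x hx c
    rw [← hconst x hx, hJ]; ring
  -- `k` is the sign of `J x₀ * κ 0 x₀`. For `k ≠ 0` the condition `J / c = k` fixes `c`; for `k =
  -- 0` any `c` of the right sign works.
  rcases lt_trichotomy 0 (J x₀ * κ 0 x₀) with hs | hs | hs
  · have hJ0 : J x₀ ≠ 0 := fun h0 => by simp [h0] at hs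
    refine ⟨1, Or.inl rfl, J x₀, hJ0, fun x hx => ⟨hpos x hx _ hs, ?_⟩⟩
    rw [hval x hx, div_self hJ0]; simp
  · have hJ0 : J x₀ = 0 := (mul_eq_zero.1 hs.symm).resolve_right (hne x₀ hx₀)
    refine ⟨0, Or.inr (Or.inl rfl), κ 0 x₀, hne x₀ hx₀, fun x hx => ⟨hpos x hx _ ?_, ?_⟩⟩
    · exact mul_self_pos.2 (hne x₀ hx₀)
    · rw [hval x hx, hJ0]; simp
  · have hJ0 : J x₀ ≠ 0 := fun h0 => by simp [h0] at hs
    refine ⟨-1, Or.inr (Or.inr rfl), -J x₀, neg_ne_zero.2 hJ0,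
      fun x hx => ⟨hpos x hx _ (by linarith), ?_⟩⟩
    rw [hval x hx, div_neg, div_self hJ0]; simp

/-- A proper time function of the comoving observers. -/
lemma exists_time {B : Set Coord} (hB : IsOpen B) (hBU : B ⊆ U) (hBc : Convex ℝ B) :
    ∃ t : Coord → ℝ, ContDiffOn ℝ ∞ t B ∧
      ∀ x ∈ B, ∀ V, fderiv ℝ t x V = timeForm ε X (pushFrame X e 3) x V := by
  have hω : ContDiffOn ℝ ∞ (timeForm ε X (pushFrame X e 3)) B :=
    (smoothOn_timeForm h.isOpen h.smooth_X (h.smooth_pushFrame 3)).mono hBU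
  -- Poincaré lemma on a convex set: `τ` is closed because the tangential part of `D u` is
  -- symmetric, that is, `u` is irrotational.
  obtain ⟨t, ht⟩ := hBc.exists_forall_hasFDerivAt_of_fderiv_symmetric hB
    (hω.differentiableOn (by simp)) (by
      intro x hx V W
      have hxU := hBU hx
      have hd := differentiableAt_of_smoothOn hB hω hx
      have h1 : ∀ V W, fderiv ℝ (timeForm ε X (pushFrame X e 3)) x V W =
          -(eta ε (fderiv ℝ (fun y => fderiv ℝ X y W) x V) (pushFrame X e 3 x) +
            eta ε (fderiv ℝ X x W) (fderiv ℝ (pushFrame X e 3) x V)) := by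
        intro V W
        have h2 : fderiv ℝ (fun y => timeForm ε X (pushFrame X e 3) y W) x V =
            fderiv ℝ (timeForm ε X (pushFrame X e 3)) x V W := by
          rw [fderiv_clm_apply hd (differentiableAt_const W)]; simp
        rw [← h2]
        simp only [timeForm_apply]
        rw [fderiv_fun_neg, neg_apply, fderiv_eta (differentiableAt_of_smoothOn h.isOpen
          (smoothOn_fderiv_apply h.isOpen h.smooth_X contDiffOn_const) hxU)
          (differentiableAt_of_smoothOn h.isOpen (h.smooth_pushFrame 3) hxU)]
      rw [h1, h1, fderiv_fderiv_comm h.isOpen h.smooth_X hxU, h.fderiv_time hk h3 hne hxU,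
        h.fderiv_time hk h3 hne hxU]
      simp only [eta_sub_right, eta_smul_right, timeForm_apply, h.normal x hxU]
      rw [eta_comm ε (fderiv ℝ X x W) (fderiv ℝ X x V)]
      ring)
  have hfd : ∀ x ∈ B, fderiv ℝ t x = timeForm ε X (pushFrame X e 3) x := fun x hx =>
    (ht x hx).fderiv
  refine ⟨t, ?_, fun x hx V => by rw [hfd x hx]⟩
  rw [contDiffOn_infty_iff_fderiv_of_isOpen hB]
  exact ⟨fun x hx => (ht x hx).differentiableAt.differentiableWithinAt, hω.congr hfd⟩

/-- Local Robertson-Walker coordinates on a hypersurface with principal curvatures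
`l, l, l, 3l`. -/
lemma exists_robertsonWalker {k : ℤ} (hk1 : k = 1 ∨ k = 0 ∨ k = -1) {c : ℝ} (hc : c ≠ 0)
    (hpos : ∀ x ∈ U, 0 < κ 0 x / c)
    (hkc : ∀ x ∈ U, (ε * κ 0 x ^ 2 - connCoeff ε X e 0 3 0 x ^ 2) * (κ 0 x / c) = k)
    {x₀ : Coord} (hx₀ : x₀ ∈ U) :
    ∃ (Φ : OpenPartialHomeomorph Coord Coord) (a : ℝ → ℝ), x₀ ∈ Φ.source ∧ Φ.source ⊆ U ∧
      IsRobertsonWalkerChart (inducedMetric ε X) k a Φ ∧ ∀ y ∈ Φ.source,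
        fderiv ℝ Φ y (e 3 y) = Pi.single 3 1 ∧
        (deriv a (Φ y 3)) ^ 2 = ε * c ^ 2 * a (Φ y 3) ^ 6 - k ∧ κ 0 y = c * a (Φ y 3) ^ 2 := by
  obtain ⟨δ, hδ, hBU⟩ := Metric.isOpen_iff.1 h.isOpen x₀ hx₀
  set B := Metric.ball x₀ δ
  have hB : IsOpen B := Metric.isOpen_ball
  have hBc : Convex ℝ B := convex_ball _ _
  have hx₀B : x₀ ∈ B := Metric.mem_ball_self hδ
  obtain ⟨t, ht, htτ⟩ := h.exists_time hk h3 hne hB hBU hBc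
  have hN := h.smooth_pushFrame 3
  have hNN : ∀ x ∈ U, eta ε (pushFrame X e 3 x) (pushFrame X e 3 x) = -1 := fun x hx => by
    rw [h.eta_pushFrame hx, if_pos rfl]; rfl
  have hdN := fun x (hx : x ∈ B) => h.fderiv_time hk h3 hne (hBU hx)
  have hdξ := fun x (hx : x ∈ B) => h.fderiv_normal hk h3 (hBU hx)
  have hdl := fun x (hx : x ∈ B) => h.fderiv_curvature hk h3 (hBU hx)
  have hdθ := fun x (hx : x ∈ B) => h.fderiv_expansion hk h3 hne (hBU hx)
  have hsl := h.smooth_curvature 0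
  have hsθ := h.smooth_connCoeff 0 3 0
  have hεε := h.sq_sign
  set N := pushFrame X e 3 with hNdef
  set θ := connCoeff ε X e 0 3 0 with hθ
  set τ := timeForm ε X N with hτ
  set l := κ 0 with hl
  -- The scale factor as a function on the patch, determined by the required `λ = c a²`.
  set A : Coord → ℝ := fun x => √(l x / c) with hAdef
  have hApos : ∀ x ∈ B, 0 < A x := fun x hx => Real.sqrt_pos.2 (hpos x (hBU hx))
  have hA2 : ∀ x ∈ B, l x = c * A x ^ 2 := fun x hx => by
    rw [hAdef]; simp only; rw [Real.sq_sqrt (hpos x (hBU hx)).le]; field_simp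
  have hkA : ∀ x ∈ B, (ε * l x ^ 2 - θ x ^ 2) * A x ^ 2 = k := fun x hx => by
    rw [← hkc x (hBU hx), hAdef]; simp only; rw [Real.sq_sqrt (hpos x (hBU hx)).le]
  have hA : ContDiffOn ℝ ∞ A B := ((hsl.mono hBU).div_const c).sqrt fun x hx =>
    (hpos x (hBU hx)).ne'
  have hdA : ∀ x ∈ B, ∀ V, fderiv ℝ A x V = θ x * A x * τ x V := by
    intro x hx V
    have h1 := (((differentiableAt_of_smoothOn h.isOpen hsl (hBU hx)).hasFDerivAt.mul_const
      c⁻¹).sqrt (by rw [← div_eq_mul_inv]; exact (hpos x (hBU hx)).ne')).fderiv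
    simp only [← div_eq_mul_inv] at h1
    change fderiv ℝ A x = _ at h1
    rw [h1, hdl x hx]
    have h2 := (hApos x hx).ne'
    have h3 := hA2 x hx
    have h4 : √(l x / c) = A x := rfl
    simp only [smul_apply, smul_eq_mul, h4]
    rw [h3]
    field_simp
  have hdAl : ∀ x ∈ B, ∀ V, fderiv ℝ (fun z => A z * l z) x V = 3 * A x * l x * θ x * τ x V := by
    intro x hx V
    rw [fderiv_fun_mul (differentiableAt_of_smoothOn hB hA hx)
      (differentiableAt_of_smoothOn h.isOpen hsl (hBU hx)), add_apply, smul_apply, smul_apply,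
      hdA x hx, hdl x hx]
    simp only [smul_apply, smul_eq_mul]
    ring
  have hdAθ : ∀ x ∈ B, ∀ V, fderiv ℝ (fun z => A z * θ z) x V =
      3 * ε * A x * l x ^ 2 * τ x V := by
    intro x hx V
    rw [fderiv_fun_mul (differentiableAt_of_smoothOn hB hA hx)
      (differentiableAt_of_smoothOn h.isOpen hsθ (hBU hx)), add_apply, smul_apply, smul_apply,
      hdA x hx, hdθ x hx]
    simp only [smul_apply, smul_eq_mul]
    ring
  have hAl : ContDiffOn ℝ ∞ (fun z => A z * l z) B := hA.mul (hsl.mono hBU)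
  have hAθ : ContDiffOn ℝ ∞ (fun z => A z * θ z) B := hA.mul (hsθ.mono hBU)
  have hNB : ContDiffOn ℝ ∞ N B := hN.mono hBU
  have hξB : ContDiffOn ℝ ∞ ξ B := h.smooth_ξ.mono hBU
  have hcomb : ∀ (f g : Coord → ℝ), ContDiffOn ℝ ∞ f B → ContDiffOn ℝ ∞ g B → ∀ x ∈ B, ∀ V,
      fderiv ℝ (fun z => f z • N z + g z • ξ z) x V =
        f x • fderiv ℝ N x V + fderiv ℝ f x V • N x
          + (g x • fderiv ℝ ξ x V + fderiv ℝ g x V • ξ x) := by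
    intro f g hf hg x hx V
    have d1 := differentiableAt_of_smoothOn hB hf hx
    have d2 := differentiableAt_of_smoothOn hB hg hx
    have d3 := differentiableAt_of_smoothOn hB hNB hx
    have d4 := differentiableAt_of_smoothOn hB hξB hx
    have d5 := ((d1.hasFDerivAt.smul d3.hasFDerivAt).add
      (d2.hasFDerivAt.smul d4.hasFDerivAt)).fderiv
    change fderiv ℝ (fun z => f z • N z + g z • ξ z) x = _ at d5
    rw [d5]
    simp
  -- A constant ambient vector with `η(P,P) = -εk`; the comoving spatial directions are orthogonal
  -- to it.
  set P : Coord → Ambient := fun z => (A z * l z) • N z + (A z * θ z) • ξ z with hPdef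
  have hPs : ContDiffOn ℝ ∞ P B := (hAl.smul hNB).add (hAθ.smul hξB)
  have hP : ∀ x ∈ B, P x = P x₀ := by
    intro x hx
    refine hB.is_const_of_fderiv_eq_zero hBc.isPreconnected (hPs.differentiableOn (by simp)) ?_
      hx hx₀B
    intro z hz
    ext1 V
    rw [hcomb _ _ hAl hAθ z hz, hdAl z hz, hdAθ z hz, hdN z hz, hdξ z hz]
    change _ = (0 : Ambient)
    module
  -- The spatial part of `dX` with the scale factor removed: it kills `u`, and the induced metric is
  -- `A² η(β,β) - τ²`.
  set β : Coord → Coord → Ambient := fun x V => (A x)⁻¹ • (fderiv ℝ X x V - τ x V • N x) with hβ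
  -- `Y` is the combination of `N` and `ξ` orthogonal to `P` with `η(Y,Y) = k`. For `k ≠ 0` it is
  -- the position vector on the curved model; for `k = 0` it is constant.
  set Y : Coord → Ambient := fun z => (ε * (A z * θ z)) • N z + (A z * l z) • ξ z with hYdef
  have hYs : ContDiffOn ℝ ∞ Y B := ((contDiffOn_const.mul hAθ).smul hNB).add (hAl.smul hξB)
  have hdY : ∀ x ∈ B, ∀ V, fderiv ℝ Y x V = (-(ε * k)) • β x V := by
    intro x hx V
    rw [hcomb _ _ (contDiffOn_const.mul hAθ) hAl x hx, fderiv_const_mul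
      (differentiableAt_of_smoothOn hB hAθ hx), smul_apply, hdAl x hx, hdAθ x hx, hdN x hx,
      hdξ x hx, ← hkA x hx]
    have h1 := (hApos x hx).ne'
    have h2 : (-(ε * ((ε * l x ^ 2 - θ x ^ 2) * A x ^ 2))) • β x V =
        (-(ε * ((ε * l x ^ 2 - θ x ^ 2) * A x))) • (fderiv ℝ X x V - τ x V • N x) := by
      rw [hβ, smul_smul]; congr 1; field_simp
    rw [h2]
    ext i
    simp only [Pi.add_apply, Pi.sub_apply, Pi.neg_apply, Pi.smul_apply, smul_eq_mul]
    linear_combination (A x * (l x ^ 2 * fderiv ℝ X x V i) - 3 * A x * θ x * τ x V * l x * ξ x i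
      + 2 * A x * τ x V * N x i * l x ^ 2) * hεε
  -- Since `l = c A²`, this multiple of `ξ` has differential `β` modulo the constant vector `P`. It
  -- serves as position vector for all `k` at once, including `k = 0` where `Y` carries no
  -- information.
  set Z : Coord → Ambient := fun z => (0 : ℝ) • N z + (-(c * A z ^ 3)⁻¹) • ξ z with hZdef
  have hcA : ∀ x ∈ B, c * A x ^ 3 ≠ 0 := fun x hx =>
    mul_ne_zero hc (pow_ne_zero 3 (hApos x hx).ne')
  have hζ : ContDiffOn ℝ ∞ (fun z => -(c * A z ^ 3)⁻¹) B :=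
    ((contDiffOn_const.mul (hA.pow 3)).inv hcA).neg
  have hZs : ContDiffOn ℝ ∞ Z B := ((contDiffOn_const (c := (0 : ℝ))).smul hNB).add (hζ.smul hξB)
  have hdZ : ∀ x ∈ B, ∀ V, fderiv ℝ Z x V = β x V + (3 * τ x V * (c * A x ^ 4)⁻¹) • P x := by
    intro x hx V
    have h1 := (hApos x hx).ne'
    have h2 : fderiv ℝ (fun z => -(c * A z ^ 3)⁻¹) x V = 3 * θ x * τ x V * (c * A x ^ 3)⁻¹ := by
      have d1 := (differentiableAt_of_smoothOn hB hA hx).hasFDerivAt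
      have d2 := ((hasDerivAt_inv (hcA x hx)).comp_hasFDerivAt x ((d1.pow 3).const_mul c)).neg
      have d3 := d2.fderiv
      change fderiv ℝ (fun z => -(c * A z ^ 3)⁻¹) x = _ at d3
      rw [d3]
      simp [hdA x hx]
      field_simp
    rw [hcomb _ _ contDiffOn_const hζ x hx, h2, hdξ x hx, hβ, hPdef]
    simp only [hA2 x hx]
    ext i
    simp
    field_simp
    ring
  have hNξ : ∀ x ∈ U, eta ε (N x) (ξ x) = 0 := fun x hx => h.eta_pushFrame_normal hx 3
  have hξN : ∀ x ∈ U, eta ε (ξ x) (N x) = 0 := fun x hx => h.eta_normal_pushFrame hx 3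
  have hβP : ∀ x ∈ B, ∀ V, eta ε (β x V) (P x₀) = 0 := by
    intro x hx V
    rw [← hP x hx]
    simp only [hβ, hPdef, eta_smul_left, eta_sub_left, eta_add_right, eta_smul_right,
      hNN x (hBU hx), hNξ x (hBU hx), h.normal x (hBU hx), hτ, timeForm_apply]
    ring
  have hββ : ∀ x ∈ B, ∀ V W, A x ^ 2 * eta ε (β x V) (β x W) =
      (inducedMetric ε X).inner x V W + τ x V * τ x W := by
    intro x hx V W
    have h1 := (hApos x hx).ne'
    simp only [hβ, eta_smul_left, eta_sub_left, eta_sub_right, eta_smul_right,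
      hNN x (hBU hx), inducedMetric_inner, hτ, timeForm_apply,
      eta_comm ε (N x) (fderiv ℝ X x W)]
    field_simp
    ring
  have hτu : ∀ x ∈ B, τ x (e 3 x) = 1 := by
    intro x hx
    rw [hτ, timeForm_apply]
    change -eta ε (N x) (N x) = 1
    rw [hNN x (hBU hx), neg_neg]
  have hβu : ∀ x ∈ B, β x (e 3 x) = 0 := by
    intro x hx
    simp only [hβ, hτu x hx]
    change (A x)⁻¹ • (N x - (1 : ℝ) • N x) = 0
    simp
  have hYP : ∀ x ∈ B, eta ε (Y x) (P x₀) = 0 := by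
    intro x hx
    rw [← hP x hx]
    simp only [hYdef, hPdef, eta_smul_left, eta_add_left, eta_add_right, eta_smul_right,
      hNN x (hBU hx), hNξ x (hBU hx), hξN x (hBU hx), h.unit_normal x (hBU hx)]
    ring
  have hYY : ∀ x ∈ B, eta ε (Y x) (Y x) = k := by
    intro x hx
    rw [← hkA x hx]
    simp only [hYdef, eta_smul_left, eta_add_left, eta_add_right, eta_smul_right,
      hNN x (hBU hx), hNξ x (hBU hx), hξN x (hBU hx), h.unit_normal x (hBU hx)]
    linear_combination (-(A x * θ x) ^ 2) * hεε
  have hYZ : ∀ x ∈ B, Y x = (ε * θ x / l x) • P x - (ε * k) • Z x := by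
    intro x hx
    have h1 := (hApos x hx).ne'
    have h2 := hne x (hBU hx)
    have h4 : -(ε * k) * -(c * A x ^ 3)⁻¹ = A x * l x - ε * θ x / l x * (A x * θ x) := by
      have h5 := hA2 x hx
      have h6 : c * A x ^ 3 = l x * A x := by rw [h5]; ring
      have h2' : l x ≠ 0 := h2
      rw [h6, ← hkA x hx]
      field_simp
      linear_combination (l x ^ 2) * hεε
    ext i
    simp only [hYdef, hPdef, hZdef, Pi.add_apply, Pi.sub_apply, Pi.smul_apply, smul_eq_mul]
    have h7 : ε * θ x / l x * (A x * l x) = ε * (A x * θ x) := by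
      have h2' : l x ≠ 0 := h2
      field_simp
    linear_combination (-N x i) * h7 - ξ x i * h4
  set f : Fin 3 → Ambient := fun i => pushFrame X e i.castSucc x₀ with hf
  have hNf : ∀ i, eta ε (N x₀) (f i) = 0 := fun i => by
    rw [hNdef, hf, h.eta_pushFrame hx₀, if_neg (by fin_cases i <;> decide)]
  have hξf : ∀ i, eta ε (ξ x₀) (f i) = 0 := fun i => h.eta_normal_pushFrame hx₀ _
  have hPf : ∀ i, eta ε (P x₀) (f i) = 0 := fun i => by
    simp only [hPdef, eta_add_left, eta_smul_left, hNf, hξf]; ring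
  have hk3 : (k : ℝ) ^ 3 = k := by rcases hk1 with h0 | h0 | h0 <;> rw [h0] <;> norm_num
  -- On the complement of `P x₀` the pair (`ξ`, `N`) components of a vector are proportional to `(l,
  -- -θ)`. Their contribution is `(εl² - θ²) s s'`, which equals the `Y` term when `k = ±1` and
  -- vanishes when `k = 0`; `hk3` treats the cases together.
  have hexp : ∀ C C', eta ε C (P x₀) = 0 → eta ε C' (P x₀) = 0 →
      eta ε C C' = ∑ i, eta ε C (f i) * eta ε C' (f i)
        + k * (eta ε C (Y x₀) * eta ε C' (Y x₀)) := by
    intro C C' hC hC'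
    have hl0 : l x₀ ≠ 0 := hne x₀ hx₀
    have hA0 := (hApos x₀ hx₀B).ne'
    have key : ∀ C, eta ε C (P x₀) = 0 → ∃ s, eta ε C (ξ x₀) = l x₀ * s ∧
        eta ε C (N x₀) = -(θ x₀ * s) := by
      intro C hC
      refine ⟨eta ε C (ξ x₀) / l x₀, by field_simp, ?_⟩
      simp only [hPdef, eta_add_right, eta_smul_right] at hC
      have h1 : l x₀ * eta ε C (N x₀) + θ x₀ * eta ε C (ξ x₀) = 0 := by
        have h2 : A x₀ * (l x₀ * eta ε C (N x₀) + θ x₀ * eta ε C (ξ x₀)) = 0 := by linarith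
        exact (mul_eq_zero.1 h2).resolve_left hA0
      field_simp
      linarith
    obtain ⟨s, hs1, hs2⟩ := key C hC
    obtain ⟨s', hs1', hs2'⟩ := key C' hC'
    have hD := hkA x₀ hx₀B
    have hkk : (k : ℝ) ^ 2 * (ε * l x₀ ^ 2 - θ x₀ ^ 2) = ε * l x₀ ^ 2 - θ x₀ ^ 2 := by
      have h1 : ((k : ℝ) ^ 2 * (ε * l x₀ ^ 2 - θ x₀ ^ 2) - (ε * l x₀ ^ 2 - θ x₀ ^ 2))
          * A x₀ ^ 2 = 0 := by
        linear_combination (k ^ 2 - 1) * hD + hk3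
      exact sub_eq_zero.1 ((mul_eq_zero.1 h1).resolve_right (pow_ne_zero 2 hA0))
    have hY : ∀ C s, eta ε C (ξ x₀) = l x₀ * s → eta ε C (N x₀) = -(θ x₀ * s) →
        eta ε C (Y x₀) = ε * A x₀ * (ε * l x₀ ^ 2 - θ x₀ ^ 2) * s := by
      intro C s h1 h2
      simp only [hYdef, eta_add_right, eta_smul_right, h1, h2]
      linear_combination (-A x₀ * l x₀ ^ 2 * s) * hεε
    have s0 : tetradSign 0 = 1 := rfl
    have s1 : tetradSign 1 = 1 := rfl
    have s2 : tetradSign 2 = 1 := rfl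
    have s3 : tetradSign 3 = -1 := rfl
    rw [h.eta_eq_sum hx₀, hY C s hs1 hs2, hY C' s' hs1' hs2', hs1, hs1', Fin.sum_univ_four,
      Fin.sum_univ_three, ← hNdef, hs2, hs2', s0, s1, s2, s3]
    simp only [hf, Fin.castSucc_zero, Fin.castSucc_one, show (2 : Fin 3).castSucc = 2 from rfl]
    linear_combination (-(s * s')) * hkk
      - (k * A x₀ ^ 2 * (ε * l x₀ ^ 2 - θ x₀ ^ 2) ^ 2 * s * s') * hεε
      - (k * (ε * l x₀ ^ 2 - θ x₀ ^ 2) * s * s') * hD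
  set y : Fin 3 → Coord → ℝ := fun i z => eta ε (Z z) (f i) with hy
  have hys : ∀ i, ContDiffOn ℝ ∞ (y i) B := fun i => contDiffOn_eta hZs contDiffOn_const ε
  have hdy : ∀ x ∈ B, ∀ i V, fderiv ℝ (y i) x V = eta ε (β x V) (f i) := by
    intro x hx i V
    rw [hy, fderiv_eta (differentiableAt_of_smoothOn hB hZs hx) (differentiableAt_const _),
      hdZ x hx, hP x hx]
    simp [eta_add_left, eta_smul_left, hPf, eta_zero_right]
  have hy₀ : ∀ i, y i x₀ = 0 := fun i => by
    simp only [hy, hZdef, eta_add_left, eta_smul_left, hNf, hξf]; ring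
  have hYf : ∀ x ∈ B, ∀ i, eta ε (Y x) (f i) = -(ε * k) * y i x := by
    intro x hx i
    rw [hYZ x hx, hP x hx, eta_sub_left, eta_smul_left, eta_smul_left, hPf]
    ring
  -- The height over the tangent space at the base point: for `k = 0` it is `|y|²/2`, as the quadric
  -- equation demands; for `k ≠ 0` it is `k - η(Y, Y x₀)`, and the quadric equation is `hexp`
  -- applied to `Y`.
  obtain ⟨T, hTs, hT₀, hTβ, hTq⟩ : ∃ T : Coord → ℝ, ContDiffOn ℝ ∞ T B ∧ T x₀ = 0 ∧
      (∀ x ∈ B, fderiv ℝ T x (e 3 x) = 0 ∧ ∀ V W, k * (fderiv ℝ T x V * fderiv ℝ T x W) =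
        k * (eta ε (β x V) (Y x₀) * eta ε (β x W) (Y x₀))) ∧
      ∀ x ∈ B, y 0 x ^ 2 + y 1 x ^ 2 + y 2 x ^ 2 + k * T x ^ 2 = 2 * T x := by
    by_cases hk0 : k = 0
    · have hT : ContDiffOn ℝ ∞ (fun x => (y 0 x ^ 2 + y 1 x ^ 2 + y 2 x ^ 2) * 2⁻¹) B :=
        ((((hys 0).pow 2).add ((hys 1).pow 2)).add ((hys 2).pow 2)).mul contDiffOn_const
      refine ⟨_, hT, by simp [hy₀], fun x hx => ⟨?_, by simp [hk0]⟩, fun x hx => ?_⟩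
      · have d := fun i => (differentiableAt_of_smoothOn hB (hys i) hx).hasFDerivAt
        have d' := (((((d 0).pow 2).add ((d 1).pow 2)).add ((d 2).pow 2)).mul_const 2⁻¹).fderiv
        change fderiv ℝ (fun x => (y 0 x ^ 2 + y 1 x ^ 2 + y 2 x ^ 2) * 2⁻¹) x = _ at d'
        rw [d']
        simp [hdy x hx, hβu x hx, eta_zero_left]
      · simp [hk0]; ring
    · have hkk : (k : ℝ) ^ 2 = 1 := by
        rcases hk1 with h0 | h0 | h0
        · rw [h0]; norm_num
        · exact absurd h0 hk0
        · rw [h0]; norm_num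
      have hdT : ∀ x ∈ B, ∀ V, fderiv ℝ (fun x => k - eta ε (Y x) (Y x₀)) x V =
          ε * k * eta ε (β x V) (Y x₀) := by
        intro x hx V
        rw [fderiv_const_sub, neg_apply, fderiv_eta (differentiableAt_of_smoothOn hB hYs hx)
          (differentiableAt_const _), hdY x hx, eta_smul_left]
        simp [eta_zero_right]
      refine ⟨fun x => k - eta ε (Y x) (Y x₀),
        contDiffOn_const.sub (contDiffOn_eta hYs contDiffOn_const ε), ?_,
        fun x hx => ⟨?_, fun V W => ?_⟩, fun x hx => ?_⟩
      · simp only [hYY x₀ hx₀B, sub_self]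
      · rw [hdT x hx, hβu x hx, eta_zero_left, mul_zero]
      · rw [hdT x hx, hdT x hx]
        linear_combination (k ^ 3 * (eta ε (β x V) (Y x₀) * eta ε (β x W) (Y x₀))) * hεε
          + (k * (eta ε (β x V) (Y x₀) * eta ε (β x W) (Y x₀))) * hkk
      · have h1 := hexp (Y x) (Y x) (hYP x hx) (hYP x hx)
        rw [hYY x hx, Fin.sum_univ_three, hYf x hx, hYf x hx, hYf x hx] at h1
        simp only
        linear_combination (-1 : ℝ) * h1 - (k ^ 2 * (y 0 x ^ 2 + y 1 x ^ 2 + y 2 x ^ 2)) * hεε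
          + (k - 2 * eta ε (Y x) (Y x₀) - (y 0 x ^ 2 + y 1 x ^ 2 + y 2 x ^ 2)) * hkk
  -- `b = θ A` is the coefficient in `dA = θ A dt`, so it becomes the derivative of `a`; with `hkA`
  -- this is the Friedmann equation.
  obtain ⟨Φ, a, hΦ₀, hΦB, hΦ, hΦa⟩ := exists_isRobertsonWalkerChart (g := inducedMetric ε X)
    (u := e 3) (b := fun x => θ x * A x) hB hk1 hys hTs ht hA hApos hTq
    (fun x hx V W => by
      rw [(hTβ x hx).2 V W, htτ x hx, htτ x hx]
      simp only [hdy x hx]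
      rw [← hexp _ _ (hβP x hx V) (hβP x hx W), hββ x hx]
      ring)
    (fun x hx V hV => h.metric_nondegenerate (hBU hx) hV)
    (fun x hx V => by rw [hdA x hx, htτ x hx])
    (fun x hx i => by rw [hdy x hx, hβu x hx, eta_zero_left])
    (fun x hx => (hTβ x hx).1) (fun x hx => by rw [htτ x hx, hτu x hx]) hx₀B (hy₀ 1) hT₀
  refine ⟨Φ, a, hΦ₀, hΦB.trans hBU, hΦ, fun z hz => ?_⟩
  obtain ⟨h1, h2, h4⟩ := hΦa z hz
  have hzB := hΦB hz
  refine ⟨h1, ?_, by rw [h2]; exact hA2 z hzB⟩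
  rw [h2, h4, ← hkA z hzB, hA2 z hzB]
  ring

end Umbilic

end PrincipalFrame

end IdealEmbedding

end

open IdealEmbedding

theorem mainTheorem4 (ε : ℝ) (hε : ε = 1 ∨ ε = -1)
    (U : Set Coord) (hU : IsOpen U) (hUc : IsPreconnected U)
    (X ξ : Coord → Ambient) (w v q u : Coord → Coord) (μ lam ν σ : Coord → ℝ)
    (h : IsIdealTetrad ε U X ξ w v q u μ lam ν σ) :
    (((∀ x ∈ U, μ x = -lam x ∧ ν x = lam x) ∨
        (∀ x ∈ U, μ x = -ν x ∧ lam x = -3 * ν x) ∨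
        (∀ x ∈ U, μ x = -lam x ∧ ν x = -3 * lam x)) →
      ∀ x ∈ U, μ x = 0 ∧ lam x = 0 ∧ ν x = 0 ∧ IsFlatAt (inducedMetric ε X) x) ∧
    ((∀ x ∈ U, μ x = 3 * lam x ∧ ν x = lam x) →
      (∀ x ∈ U, lam x = 0 ∧ IsFlatAt (inducedMetric ε X) x) ∨
      ∃ k : ℤ, (k = 1 ∨ k = 0 ∨ k = -1) ∧ ∃ c : ℝ, c ≠ 0 ∧
        ∀ x₀ ∈ U, ∃ (Φ : OpenPartialHomeomorph Coord Coord) (a : ℝ → ℝ),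
          x₀ ∈ Φ.source ∧ Φ.source ⊆ U ∧
          IsRobertsonWalkerChart (inducedMetric ε X) k a Φ ∧
          ∀ y ∈ Φ.source,
            fderiv ℝ Φ y (u y) = Pi.single 3 1 ∧
            (deriv a (Φ y 3)) ^ 2 = ε * c ^ 2 * a (Φ y 3) ^ 6 - k ∧
            lam y = c * a (Φ y 3) ^ 2 ∧
            ∀ (κ ρ p : ℝ) (V : Coord),
              IsPerfectFluidAt (inducedMetric ε X) κ ρ p V y ↔
                (κ * ρ = 3 * ε * c ^ 2 * a (Φ y 3) ^ 4 ∧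
                  κ * p = -7 * ε * c ^ 2 * a (Φ y 3) ^ 4 ∧
                  (V = u y ∨ V = -u y))) := by
  refine ⟨fun hr x hx => h.eq_zero_of_ratio hε hU hr hx, fun hr => ?_⟩
  have hF := h.principalFrame hε hU
  have hσ : ∀ x ∈ U, σ x = lam x := fun x hx => by
    rw [h.sigma_eq hε hU hx, (hr x hx).1, (hr x hx).2]; ring
  have hk : ∀ x ∈ U, ∀ i, i ≠ 3 → ![σ, lam, ν, μ] i x = ![σ, lam, ν, μ] 0 x := by
    intro x hx i hi
    fin_cases i
    · rfl
    · exact (hσ x hx).symm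
    · exact (hr x hx).2.trans (hσ x hx).symm
    · exact absurd rfl hi
  have h3 : ∀ x ∈ U, ![σ, lam, ν, μ] 3 x = 3 * ![σ, lam, ν, μ] 0 x := fun x hx => by
    change μ x = 3 * σ x
    rw [hσ x hx, (hr x hx).1]
  rcases hF.curvature_eq_zero_or_ne_zero hk h3 hUc with hz | hne
  · left
    intro x hx
    have h0 : lam x = 0 := (hσ x hx).symm.trans (hz x hx)
    refine ⟨h0, hF.isFlatAt hx fun a => ?_⟩
    by_cases ha : a = 3
    · rw [ha, h3 x hx, hz x hx, mul_zero]
    · rw [hk x hx a ha, hz x hx]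
  -- Preconnectedness allows `U = ∅`, while the constants `k` and `c` are read off at a base point.
  · rcases U.eq_empty_or_nonempty with rfl | ⟨x₁, hx₁⟩
    · exact Or.inl fun x hx => absurd hx (Set.notMem_empty x)
    right
    obtain ⟨k, hk1, c, hc, hkc⟩ := hF.exists_curvature_constants hk h3 hne hUc hx₁
    refine ⟨k, hk1, c, hc, fun x₀ hx₀ => ?_⟩
    obtain ⟨Φ, a, hΦ₀, hΦU, hΦ, hΦa⟩ := hF.exists_robertsonWalker hk h3 hne hk1 hc
      (fun x hx => (hkc x hx).1) (fun x hx => (hkc x hx).2) hx₀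
    refine ⟨Φ, a, hΦ₀, hΦU, hΦ, fun y hy => ?_⟩
    obtain ⟨h1, h2, h4⟩ := hΦa y hy
    have hyU := hΦU hy
    have hlam : lam y = c * a (Φ y 3) ^ 2 := (hσ y hyU).symm.trans h4
    refine ⟨h1, h2, hlam, fun K ρ p V => ?_⟩
    have hpf := hF.isPerfectFluidAt_iff hyU (hne y hyU) rfl (hk y hyU 1 (by decide))
      (hk y hyU 2 (by decide)) (h3 y hyU) K ρ p V
    rw [h4] at hpf
    rw [hpf, show 3 * ε * (c * a (Φ y 3) ^ 2) ^ 2 = 3 * ε * c ^ 2 * a (Φ y 3) ^ 4 by ring,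
      show -7 * ε * (c * a (Φ y 3) ^ 2) ^ 2 = -7 * ε * c ^ 2 * a (Φ y 3) ^ 4 by ring]
    rfl
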